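/- Notation. For $f\in L^2(\mathbb R)=L^2(\mathbb R;\mathbb C)$ let $\|f\|$ be the $L^2$ norm, $\hat f(\eta)=(2\pi)^{-1/2}\int_{\mathbb R} e^{-ix\eta}f(x)\,dx$ the unitary Fourier transform, $T_r=e^{ir\partial_x^2}$ the free Schrödinger evolution (multiplication of $\hat f(\eta)$ by $e^{-ir\eta^2}$), $f'$ the distributional derivative ($\|f'\|=\infty$ if $f\notin H^1(\mathbb R)$) and $\|f\|_{H^1}^2=\|f\|^2+\|f'\|^2$. Let $x_+=\max\{x,0\}$. For $d_{\rm av}\ge0$, $V:[0,\infty)\to\mathbb R$, $\psi:\mathbb R\to[0,\infty)$ and $\lambda>0$ put $$N(f)=\int_{\mathbb R}\Big(\int_{\mathbb R} V(|T_rf(x)|)\,dx\Big)\psi(r)\,dr,\qquad H(f)=\tfrac{d_{\rm av}}2\|f'\|^2-N(f),\qquad E_\lambda^{d_{\rm av}}=\inf\{H(f):\|f\|^2=\lambda\}\in[-\infty,\infty),$$ (no kinetic term if $d_{\rm av}=0$; $f$ ranges over $L^2(\mathbb R)$, effectively over $H^1(\mathbb R)$ if $d_{\rm av}>0$). Assumptions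 on $V$: $V$ is continuous on $[0,\infty)$, differentiable on $(0,\infty)$, $V(0)=0$, and (A1) $|V'(a)|\le c\,(a^{\gamma_1-1}+a^{\gamma_2-1})$ for all $a>0$, with a constant $c$; (A2) $V'(a)a\ge\gamma_0V(a)$ for all $a>0$, with some $\gamma_0>2$. For $0<\alpha\le1$ and $s>0$ let $G_\alpha(s)=\big[(s+1)^{\frac{2\alpha}{1+2\alpha}}-1\big]^{-1/2}$ and $G_\alpha(0)=+\infty$. For $2<\gamma<6$, $\tau>1$ let $\alpha(\gamma,\tau)=\min\{\frac{\gamma-2}{6\tau},\frac{6-\gamma}{2\tau}\}$ and $\beta(\gamma,\tau)=\frac{4}{6-\gamma-2\alpha(\gamma,\tau)}$. Inequalities below are between extended real numbers. **(i) Positive average dispersion.** Let $d_{\rm av}>0$, $2<\gamma_1\le\gamma_2<10$, $V$ satisfy (A1), (A2), and $0\le\psi\in L^1(\mathbb R)$ have compact support. Then $N(f)$ converges absolutely for every $f\in H^1(\mathbb R)$. Moreover, there is a constant $C>0$ such that for all $\lambda>0$, $f\in H^1(\mathbb R)$ with $\|f\|^2=\lambda$, $0<\delta<\lambda/2$ and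 $a,b\in\mathbb R$ with $$\int_{-\infty}^a|f(x)|^2dx\ge\delta\quad\text{and}\quad\int_b^\infty|f(x)|^2dx\ge\delta \qquad(*)$$ one has $$H(f)\ge\Big[1-(2^{\gamma_0/2}-2)\big(\tfrac\delta\lambda\big)^{\gamma_0/2}\Big]E_\lambda^{d_{\rm av}}-C\|f\|_{H^1}^2\big(1+\|f\|_{H^1}^8\big)\,G_1\big((b-a-1)_+\big).$$ The constant $C$ depends on $\psi$ only through $R$ with $\operatorname{supp}\psi\subset[-R,R]$ and an upper bound $K$ for $\|\psi\|_{L^1}$, and otherwise only on $d_{\rm av},\gamma_1,\gamma_2$ and $c$. **(ii) Zero average dispersion.** Let $d_{\rm av}=0$, $2<\gamma_1\le\gamma_2<6$, $\tau>1$, $V$ satisfy (A1), (A2), and $0\le\psi\in L^{\beta(\gamma_2,\tau)}(\mathbb R)$ have compact support. Then $N(f)$ converges absolutely for every $f\in L^2(\mathbb R)$. Moreover, there is a constant $C>0$ such that for all $\lambda>0$, $f\in L^2(\mathbb R)$ with $\|f\|^2=\lambda$, $0<\delta<\lambda/2$ and $a,b\in\mathbb R$ such that $(*)$ holds for $f$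 or $(*)$ holds with $\hat f$ in place of $f$, one has $$H(f)\ge\Big[1-(2^{\gamma_0/2}-2)\big(\tfrac\delta\lambda\big)^{\gamma_0/2}\Big]E_\lambda^{0}-C\lambda(1+\lambda^2)\,G_{\min\{\alpha(\gamma_1,\tau),\alpha(\gamma_2,\tau)\}}\big((b-a-1)_+\big).$$ The constant $C$ depends on $\psi$ only through $R$ with $\operatorname{supp}\psi\subset[-R,R]$ and an upper bound $K$ for $\|\psi\|_{L^{\beta(\gamma_2,\tau)}}$, and otherwise only on $\gamma_1,\gamma_2,\tau$ and $c$. **(iii)** For $0<\alpha\le1$ the function $G_\alpha$ is decreasing on $[0,\infty)$ and $G_\alpha(s)\to0$ as $s\to\infty$. -/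

import Mathlib

open MeasureTheory Set
open scoped ENNReal NNReal FourierTransform

noncomputable section

namespace FatTail

/-- The complex Hilbert space `L²(ℝ)`. -/
abbrev L2 : Type := Lp ℂ 2 (volume : Measure ℝ)

/-! ### The free Schrödinger evolution -/

/-- The symbol of `e^{i r ∂ₓ²}` in the variable `ξ = η / (2π)` dual to `x` under Mathlib's Fourier
transform `𝓕 f ξ = ∫ e^{-2π i x ξ} f(x) dx`, that is, `e^{-i r η²}` with `η = 2π ξ`. -/
def schrodingerSymbol (r ξ : ℝ) : ℂ :=
  Complex.exp (-(Complex.I * ((r * (2 * Real.pi * ξ) ^ 2 : ℝ) : ℂ)))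

theorem continuous_schrodingerSymbol (r : ℝ) : Continuous (schrodingerSymbol r) := by
  unfold schrodingerSymbol
  fun_prop

theorem norm_schrodingerSymbol (r ξ : ℝ) : ‖schrodingerSymbol r ξ‖ = 1 := by
  rw [schrodingerSymbol, ← mul_neg, ← Complex.ofReal_neg, mul_comm]
  exact Complex.norm_exp_ofReal_mul_I _

theorem memLp_schrodingerSymbol_mul (r : ℝ) (g : L2) :
    MemLp (fun ξ => schrodingerSymbol r ξ * g ξ) 2 volume := by
  refine (Lp.memLp g).of_le
    ((continuous_schrodingerSymbol r).aestronglyMeasurable.mul (Lp.aestronglyMeasurable g)) ?_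
  filter_upwards with ξ
  simp [norm_schrodingerSymbol]

/-- `T_r = e^{i r ∂ₓ²}` on `L²(ℝ)`, as a Fourier multiplier. -/
def T (r : ℝ) (f : L2) : L2 :=
  𝓕⁻ (memLp_schrodingerSymbol_mul r (𝓕 f)).toLp

/-- The unitary Fourier transform `f̂(η) = (2π)^{-1/2} ∫ e^{-i x η} f(x) dx` of `f ∈ L²(ℝ)`
(determined up to null sets), obtained by rescaling Mathlib's `𝓕`. -/
def hat (f : L2) (η : ℝ) : ℂ :=
  (((2 * Real.pi) ^ (-(1 / 2) : ℝ) : ℝ) : ℂ) * (𝓕 f : L2) (η / (2 * Real.pi))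

/-! ### Weak derivatives and `H¹(ℝ)` -/

/-- `g ∈ L²(ℝ)` is the distributional derivative of `f ∈ L²(ℝ)`. -/
def IsWeakDeriv (f g : L2) : Prop :=
  TemperedDistribution.derivCLM ℂ (Lp.toTemperedDistribution f) = Lp.toTemperedDistribution g

/-- `f ∈ H¹(ℝ)`. -/
def MemH1 (f : L2) : Prop := ∃ g : L2, IsWeakDeriv f g

/-- `‖f'‖`, which is `∞` for `f ∈ L² \ H¹`. (The weak derivative is unique, so for `f ∈ H¹` the
infimum is over one element.) -/
def derivNorm (f : L2) : ℝ≥0∞ := ⨅ (g : L2) (_ : IsWeakDeriv f g), ‖g‖ₑ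

/-- `‖f‖_{H¹} = (‖f‖² + ‖f'‖²)^{1/2}`. -/
def h1Norm (f : L2) : ℝ≥0∞ := (‖f‖ₑ ^ 2 + derivNorm f ^ 2) ^ (1 / 2 : ℝ)

/-! ### The nonlinearity and the energies -/

/-- Growth assumption on the nonlinear potential, with explicit constant `c`. -/
structure AssumptionA1 (V : ℝ → ℝ) (γ₁ γ₂ c : ℝ) : Prop where
  two_le : 2 ≤ γ₁
  le : γ₁ ≤ γ₂
  continuousOn : ContinuousOn V (Ici 0)
  differentiableOn : DifferentiableOn ℝ V (Ioi 0)
  map_zero : V 0 = 0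
  abs_deriv_le : ∀ a : ℝ, 0 < a → |deriv V a| ≤ c * (a ^ (γ₁ - 1) + a ^ (γ₂ - 1))

/-- Superhomogeneity assumption on the nonlinear potential. -/
structure AssumptionA2 (V : ℝ → ℝ) (γ₀ : ℝ) : Prop where
  two_lt : 2 < γ₀
  continuousOn : ContinuousOn V (Ici 0)
  differentiableOn : DifferentiableOn ℝ V (Ioi 0)
  map_zero : V 0 = 0
  le_deriv_mul : ∀ a : ℝ, 0 < a → γ₀ * V a ≤ deriv V a * a

/-- `N(f) = ∬ V(|T_r f(x)|) dx ψ(r) dr`. -/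
def N (V ψ : ℝ → ℝ) (f : L2) : ℝ :=
  ∫ r : ℝ, (∫ x : ℝ, V ‖T r f x‖) * ψ r

/-- The double integral defining `N(f)` converges absolutely. -/
def NConverges (V ψ : ℝ → ℝ) (f : L2) : Prop :=
  (∀ᵐ r : ℝ, Integrable (fun x : ℝ => V ‖T r f x‖)) ∧
    Integrable (fun r : ℝ => (∫ x : ℝ, V ‖T r f x‖) * ψ r) ∧
    Integrable (fun r : ℝ => (∫ x : ℝ, |V ‖T r f x‖|) * ψ r)

/-- The Hamiltonian `H(f) = (d/2) ‖f'‖² - N(f)`, with value `+∞` if `d > 0` and `f ∉ H¹`, and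
without kinetic term if `d = 0`. -/
def H (d : ℝ) (V ψ : ℝ → ℝ) (f : L2) : EReal :=
  ((ENNReal.ofReal (d / 2) * derivNorm f ^ 2 : ℝ≥0∞) : EReal) - ((N V ψ f : ℝ) : EReal)

/-- The ground state energy `E_λ = inf {H(f) : ‖f‖² = λ}`, a number in `[-∞, ∞]`. -/
def E (d : ℝ) (V ψ : ℝ → ℝ) (lam : ℝ) : EReal :=
  ⨅ (f : L2) (_ : ‖f‖ ^ 2 = lam), H d V ψ f

/-! ### Exponents, error function, tails -/

/-- `α(γ, τ) = min {(γ - 2) / (6 τ), (6 - γ) / (2 τ)}`. -/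
def alphaExp (γ τ : ℝ) : ℝ := min ((γ - 2) / (6 * τ)) ((6 - γ) / (2 * τ))

/-- `β(γ, τ) = 4 / (6 - γ - 2 α(γ, τ))`. -/
def betaExp (γ τ : ℝ) : ℝ := 4 / (6 - γ - 2 * alphaExp γ τ)

/-- `G_α(s) = [(s + 1)^{2α / (1 + 2α)} - 1]^{-1/2}`, with `G_α(0) = ∞`. -/
def G (α s : ℝ) : ℝ≥0∞ :=
  ENNReal.ofReal ((s + 1) ^ (2 * α / (1 + 2 * α)) - 1) ^ (-(1 / 2) : ℝ)

/-- The function `u` has at least `δ` of its `L²` mass to the left of `a` and to the right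
of `b`. -/
def HasFatTails (u : ℝ → ℂ) (δ a b : ℝ) : Prop :=
  δ ≤ ∫ x in Iic a, ‖u x‖ ^ 2 ∧ δ ≤ ∫ x in Ici b, ‖u x‖ ^ 2

/-- `ψ` is nonnegative, belongs to `L^p` with norm at most `K`, and is supported
in `[-R, R]`. -/
structure AdmissibleDensity (ψ : ℝ → ℝ) (p : ℝ≥0∞) (R : ℝ) (K : ℝ≥0) : Prop where
  nonneg : ∀ᵐ r : ℝ, 0 ≤ ψ r
  memLp : MemLp ψ p volume
  norm_le : eLpNorm ψ p volume ≤ K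
  support : ∀ᵐ r : ℝ, R < |r| → ψ r = 0

/-- The factor `1 - (2^{γ₀/2} - 2) (δ/λ)^{γ₀/2}`. -/
def factor (γ₀ δ lam : ℝ) : ℝ :=
  1 - ((2 : ℝ) ^ (γ₀ / 2) - 2) * (δ / lam) ^ (γ₀ / 2)

end FatTail

end

open MeasureTheory Set
open scoped ENNReal NNReal FourierTransform

noncomputable section

namespace FatTail

/-! A function with two fat tails can be cut, inside the gap between them, into two far-apart pieces
that hardly interact. Its energy is then almost the sum of two energies of smaller mass, and strict
superhomogeneity makes such a sum costly.

The cut. By pigeonhole (`exists_window`) the gap contains a window of length `ℓ` carrying at most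
about `ℓ/(b-a)` of the mass. Writing `f = f₁ + f₀ + f₂` with `f₀` living on the window,
`AssumptionA1.abs_split_le` bounds the defect `V|f| - V|f₁| - V|f₂|` pointwise by terms that contain
either a factor `|f₀|` or a product `|f₁||f₂|`. The first kind is small because the window is light,
the second because `f₁` and `f₂` are at distance of order `ℓ`. The choice `ℓ = (b-a)^{1/(1+2α)}` in
`exists_window_G` bounds both gains by `G_α`.

Zero dispersion. The separation gain is a bilinear estimate: the product of two waves whose data
have supports at distance `ℓ`, in space or in frequency, is of size `ℓ^{-1/2}` in space-time `L²`
(`exists_bilinear_space`, `exists_bilinear_fourier`). Both come from one oscillatory integral, the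
chirp transform: the product of two chirps is an integral over a plane, and Plancherel in suitable
coordinates produces the weight `1/w`, where `w` is essentially the distance of the two points
(`lintegral_enorm_sq_integral_phase_halfPlane_le`). The `L⁶` Strichartz inequality follows in the
same way from the cube of a chirp, where `w` is a polar radius and its Jacobian cancels the weight.
Hölder's inequality between mass, Strichartz and the bilinear bound, with weight `ψ ∈ L^β`, finishes
the estimate of the defect (`StrichartzBound.lintegral_split_le`). The same interpolation without
the bilinear factor gives the convergence of `N`.

Positive dispersion. In `H¹` the waves are bounded uniformly in time, so the exponents may go up to
`10`. The cut must be smooth. Its kinetic cost is `O(ℓ⁻¹)`, and so is the overlap of the two outer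
waves, since an `H¹` wave leaks through a cutoff of slope `1/ℓ` only at rate `O(1/ℓ)`
(`Cutoff.norm_rmul_T_le`, `exists_h1_splitting`). Hence `α = 1`.

The energy balance. Superhomogeneity turns `f₁` of mass `μ₁` into a competitor of mass `λ`, whence
its energy is at least `(μ₁/λ)^{γ₀/2} E_λ` (`le_energy_of_le_E`); likewise for `f₂`. Convexity
bounds the sum of the two coefficients by `factor` (`rpow_add_rpow_le`), and `E_λ ≤ 0` (`E_nonpos`,
by spreading a trial function) gives the inequality its direction. All constants are fixed before
`V`, `ψ` and `γ₀`. -/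

/-! ### `L²` norms as integrals -/

theorem enorm_sq_eq_lintegral (f : L2) : ‖f‖ₑ ^ 2 = ∫⁻ x, ‖f x‖ₑ ^ 2 := by
  rw [Lp.enorm_def, eLpNorm_eq_lintegral_rpow_enorm_toReal (by norm_num) (by norm_num)]
  rw [← ENNReal.rpow_natCast, ← ENNReal.rpow_mul]
  simp

theorem norm_sq_eq_integral (f : L2) : ‖f‖ ^ 2 = ∫ x, ‖f x‖ ^ 2 := by
  have h : ‖f‖ ^ 2 = (‖f‖ₑ ^ 2).toReal := by simp
  rw [h, enorm_sq_eq_lintegral, integral_eq_lintegral_of_nonneg_ae]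
  · congr 1
    refine lintegral_congr fun x => ?_
    rw [ENNReal.ofReal_pow (norm_nonneg _), ofReal_norm]
  · exact Filter.Eventually.of_forall fun x => by positivity
  · exact (Lp.aestronglyMeasurable f).norm.pow 2

theorem integrable_norm_sq (f : L2) : Integrable (fun x => ‖f x‖ ^ 2) :=
  (Lp.memLp f).integrable_norm_pow (by norm_num)

/-! ### The Fourier transform on `L¹ ∩ L²` -/

/-- Both sides have the same pairing with every test function, namely `∫ 𝓕Φ · g`: for the integral
transform by Fubini, for the `L²` transform by its compatibility with tempered distributions. -/
theorem fourier_toLp_ae {g : ℝ → ℂ} (h1 : Integrable g) (h2 : MemLp g 2) :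
    (𝓕 (h2.toLp g) : L2) =ᵐ[volume] 𝓕 g := by
  refine ae_eq_of_integral_contDiff_smul_eq ((Lp.memLp _).locallyIntegrable (by norm_num)) ?_ ?_
  · exact (VectorFourier.fourierIntegral_continuous Real.continuous_fourierChar continuous_inner
      h1).locallyIntegrable
  · intro φ hφ hc
    have hg₁ : HasCompactSupport (Complex.ofRealCLM ∘ φ) := hc.comp_left rfl
    have hg₂ : ContDiff ℝ _ (Complex.ofRealCLM ∘ φ) := Complex.ofRealCLM.contDiff.comp hφ
    set Φ := hg₁.toSchwartzMap hg₂
    have e0 : ∫ x, (𝓕 Φ) x • g x = ∫ x, Φ x • 𝓕 g x := by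
      simpa using! VectorFourier.integral_fourierIntegral_smul_eq_flip (L := innerₗ ℝ)
        Real.continuous_fourierChar continuous_inner Φ.integrable h1
    have e1 : Lp.toTemperedDistribution (𝓕 (h2.toLp g) : L2) Φ = ∫ x, Φ x • 𝓕 g x := by
      rw [← Lp.fourier_toTemperedDistribution_eq, TemperedDistribution.fourier_apply,
        Lp.toTemperedDistribution_apply, ← e0]
      refine integral_congr_ae ?_
      filter_upwards [h2.coeFn_toLp] with x hx
      rw [hx]
    rw [Lp.toTemperedDistribution_apply] at e1
    simpa [Φ] using e1

theorem continuous_fourierInv_of_integrable {g : ℝ → ℂ} (h1 : Integrable g) :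
    Continuous (𝓕⁻ g) := by
  have hL : Continuous fun p : ℝ × ℝ => (-innerₗ ℝ) p.1 p.2 := by
    simp only [LinearMap.neg_apply]
    exact continuous_inner.neg
  exact VectorFourier.fourierIntegral_continuous Real.continuous_fourierChar hL h1

theorem fourierInv_toLp_ae {g : ℝ → ℂ} (h1 : Integrable g) (h2 : MemLp g 2) :
    (𝓕⁻ (h2.toLp g) : L2) =ᵐ[volume] 𝓕⁻ g := by
  have hL : Continuous fun p : ℝ × ℝ => (-innerₗ ℝ) p.1 p.2 := by
    simp only [LinearMap.neg_apply]
    exact continuous_inner.neg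
  refine ae_eq_of_integral_contDiff_smul_eq ((Lp.memLp _).locallyIntegrable (by norm_num)) ?_ ?_
  · exact (continuous_fourierInv_of_integrable h1).locallyIntegrable
  · intro φ hφ hc
    have hg₁ : HasCompactSupport (Complex.ofRealCLM ∘ φ) := hc.comp_left rfl
    have hg₂ : ContDiff ℝ _ (Complex.ofRealCLM ∘ φ) := Complex.ofRealCLM.contDiff.comp hφ
    set Φ := hg₁.toSchwartzMap hg₂
    have e0 : ∫ x, (𝓕⁻ Φ : SchwartzMap ℝ ℂ) x • g x = ∫ x, Φ x • 𝓕⁻ g x := by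
      have hflip : (-innerₗ ℝ : ℝ →ₗ[ℝ] ℝ →ₗ[ℝ] ℝ).flip = -innerₗ ℝ := by
        ext; simp
      have := VectorFourier.integral_fourierIntegral_smul_eq_flip (L := -innerₗ ℝ)
        Real.continuous_fourierChar hL (Φ.integrable (μ := volume)) h1
      rw [hflip] at this
      simpa [SchwartzMap.fourierInv_coe] using! this
    have e1 : Lp.toTemperedDistribution (𝓕⁻ (h2.toLp g) : L2) Φ = ∫ x, Φ x • 𝓕⁻ g x := by
      rw [← Lp.fourierInv_toTemperedDistribution_eq, TemperedDistribution.fourierInv_apply,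
        Lp.toTemperedDistribution_apply, ← e0]
      refine integral_congr_ae ?_
      filter_upwards [h2.coeFn_toLp] with x hx
      rw [hx]
    rw [Lp.toTemperedDistribution_apply] at e1
    simpa [Φ] using e1

/-- Plancherel, as an inequality: an infinite right side leaves nothing to prove, so integrability
of `g` is enough and no square integrability has to be checked in the applications. -/
theorem lintegral_enorm_sq_fourier_le {g : ℝ → ℂ} (h1 : Integrable g) :
    ∫⁻ ξ, ‖𝓕 g ξ‖ₑ ^ 2 ≤ ∫⁻ x, ‖g x‖ₑ ^ 2 := by
  by_cases h : ∫⁻ x, ‖g x‖ₑ ^ 2 = ⊤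
  · rw [h]; exact le_top
  have h2 : MemLp g 2 := by
    refine ⟨h1.1, ?_⟩
    rw [eLpNorm_lt_top_iff_lintegral_rpow_enorm_lt_top (by norm_num) (by norm_num)]
    simpa using lt_top_iff_ne_top.2 h
  have e1 := enorm_sq_eq_lintegral (𝓕 (h2.toLp g) : L2)
  have e2 := enorm_sq_eq_lintegral (h2.toLp g)
  have e3 : ‖(𝓕 (h2.toLp g) : L2)‖ₑ = ‖h2.toLp g‖ₑ := by
    rw [← ofReal_norm, ← ofReal_norm, Lp.norm_fourier_eq]
  rw [e3, e2] at e1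
  refine le_of_eq ?_
  calc ∫⁻ ξ, ‖𝓕 g ξ‖ₑ ^ 2 = ∫⁻ ξ, ‖(𝓕 (h2.toLp g) : L2) ξ‖ₑ ^ 2 := by
        refine lintegral_congr_ae ?_
        filter_upwards [fourier_toLp_ae h1 h2] with x hx
        rw [hx]
    _ = ∫⁻ x, ‖h2.toLp g x‖ₑ ^ 2 := e1.symm
    _ = _ := by
        refine lintegral_congr_ae ?_
        filter_upwards [h2.coeFn_toLp] with x hx
        rw [hx]

/-! ### Elementary properties of the evolution -/

theorem fourier_T_ae (r : ℝ) (f : L2) :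
    (𝓕 (T r f) : L2) =ᵐ[volume] fun ξ => schrodingerSymbol r ξ * (𝓕 f : L2) ξ := by
  rw [T, FourierTransform.fourier_fourierInv_eq]
  exact (memLp_schrodingerSymbol_mul r (𝓕 f)).coeFn_toLp

theorem fourier_injective {f g : L2} (h : (𝓕 f : L2) = 𝓕 g) : f = g := by
  have := congrArg (fun u : L2 => (𝓕⁻ u : L2)) h
  simpa [FourierTransform.fourierInv_fourier_eq] using this

theorem T_add (r : ℝ) (f g : L2) : T r (f + g) = T r f + T r g := by
  apply fourier_injective
  rw [FourierTransform.fourier_add]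
  apply Lp.ext
  filter_upwards [fourier_T_ae r (f + g), fourier_T_ae r f, fourier_T_ae r g,
    Lp.coeFn_add (𝓕 (T r f) : L2) (𝓕 (T r g)), Lp.coeFn_add (𝓕 f : L2) (𝓕 g)] with x h1 h2 h3 h4 h5
  rw [h1, h4, Pi.add_apply, h2, h3, FourierTransform.fourier_add, h5, Pi.add_apply, mul_add]

theorem T_smul (r : ℝ) (c : ℂ) (f : L2) : T r (c • f) = c • T r f := by
  apply fourier_injective
  rw [FourierTransform.fourier_smul]
  apply Lp.ext
  filter_upwards [fourier_T_ae r (c • f), fourier_T_ae r f,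
    Lp.coeFn_smul c (𝓕 (T r f) : L2), Lp.coeFn_smul c (𝓕 f : L2)] with x h1 h2 h4 h5
  rw [h1, h4, Pi.smul_apply, h2, FourierTransform.fourier_smul, h5, Pi.smul_apply]
  simp only [smul_eq_mul]
  ring

theorem T_sub (r : ℝ) (f g : L2) : T r (f - g) = T r f - T r g := by
  have := T_add r f ((-1 : ℂ) • g)
  rw [T_smul] at this
  simpa [sub_eq_add_neg] using this

theorem enorm_fourier (f : L2) : ‖(𝓕 f : L2)‖ₑ = ‖f‖ₑ := by
  rw [← ofReal_norm, ← ofReal_norm, Lp.norm_fourier_eq]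

theorem enorm_schrodingerSymbol (r ξ : ℝ) : ‖schrodingerSymbol r ξ‖ₑ = 1 := by
  rw [← ofReal_norm, norm_schrodingerSymbol, ENNReal.ofReal_one]

theorem enorm_T (r : ℝ) (f : L2) : ‖T r f‖ₑ = ‖f‖ₑ := by
  rw [← enorm_fourier (T r f), ← enorm_fourier f]
  have : ‖(𝓕 (T r f) : L2)‖ₑ ^ 2 = ‖(𝓕 f : L2)‖ₑ ^ 2 := by
    rw [enorm_sq_eq_lintegral, enorm_sq_eq_lintegral]
    refine lintegral_congr_ae ?_
    filter_upwards [fourier_T_ae r f] with x hx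
    rw [hx, enorm_mul, enorm_schrodingerSymbol, one_mul]
  exact (ENNReal.pow_right_strictMono two_ne_zero).injective this

theorem norm_T (r : ℝ) (f : L2) : ‖T r f‖ = ‖f‖ := by
  rw [← toReal_enorm, ← toReal_enorm, enorm_T]

theorem integrable_symbol_mul {h : ℝ → ℂ} (hh : Integrable h) (r : ℝ) :
    Integrable (fun ξ => schrodingerSymbol r ξ * h ξ) :=
  hh.bdd_mul (continuous_schrodingerSymbol r).aestronglyMeasurable
    (Filter.Eventually.of_forall fun ξ => (norm_schrodingerSymbol r ξ).le)

/-- If `f̂` is integrable, then `T_r f` is given by an absolutely convergent integral. -/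
theorem T_ae_of_integrable {f : L2} (hf : Integrable (𝓕 f : L2)) (r : ℝ) :
    T r f =ᵐ[volume] 𝓕⁻ (fun ξ => schrodingerSymbol r ξ * (𝓕 f : L2) ξ) :=
  fourierInv_toLp_ae (integrable_symbol_mul hf r) _

/-! ### Multiplication by bounded functions -/

/-- Multiplication of `g ∈ L²` by a bounded function. -/
def bmul (χ : ℝ → ℂ) (g : L2) : L2 :=
  open Classical in if h : MemLp (fun x => χ x * g x) 2 then h.toLp else 0

theorem memLp_bmul {χ : ℝ → ℂ} (hχ : Measurable χ) {K : ℝ} (hK : ∀ x, ‖χ x‖ ≤ K) (g : L2) :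
    MemLp (fun x => χ x * g x) 2 := by
  refine (Lp.memLp g).of_le_mul (c := K)
    (hχ.aestronglyMeasurable.mul (Lp.aestronglyMeasurable g)) ?_
  filter_upwards with x
  rw [norm_mul]
  gcongr
  exact hK x

theorem bmul_ae {χ : ℝ → ℂ} (hχ : Measurable χ) {K : ℝ} (hK : ∀ x, ‖χ x‖ ≤ K) (g : L2) :
    bmul χ g =ᵐ[volume] fun x => χ x * g x := by
  rw [bmul, dif_pos (memLp_bmul hχ hK g)]
  exact MemLp.coeFn_toLp _

/-- Restriction of `g ∈ L²` to a set. -/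
def cut (S : Set ℝ) (g : L2) : L2 := bmul (S.indicator 1) g

theorem norm_indicator_one_le (S : Set ℝ) (x : ℝ) : ‖S.indicator (1 : ℝ → ℂ) x‖ ≤ 1 := by
  by_cases h : x ∈ S <;> simp [h]

theorem cut_ae {S : Set ℝ} (hS : MeasurableSet S) (g : L2) :
    cut S g =ᵐ[volume] S.indicator g := by
  filter_upwards [bmul_ae (measurable_one.indicator hS) (norm_indicator_one_le S) g] with x hx
  rw [cut, hx]
  by_cases h : x ∈ S <;> simp [h]

theorem enorm_cut_sq {S : Set ℝ} (hS : MeasurableSet S) (g : L2) :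
    ‖cut S g‖ₑ ^ 2 = ∫⁻ x in S, ‖g x‖ₑ ^ 2 := by
  rw [enorm_sq_eq_lintegral, ← lintegral_indicator hS]
  refine lintegral_congr_ae ?_
  filter_upwards [cut_ae hS g] with x hx
  rw [hx]
  by_cases h : x ∈ S <;> simp [h]

theorem norm_cut_sq {S : Set ℝ} (hS : MeasurableSet S) (g : L2) :
    ‖cut S g‖ ^ 2 = ∫ x in S, ‖g x‖ ^ 2 := by
  rw [norm_sq_eq_integral, ← integral_indicator hS]
  refine integral_congr_ae ?_
  filter_upwards [cut_ae hS g] with x hx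
  rw [hx]
  by_cases h : x ∈ S <;> simp [h]

theorem enorm_cut_le {S : Set ℝ} (hS : MeasurableSet S) (g : L2) : ‖cut S g‖ₑ ≤ ‖g‖ₑ := by
  have : ‖cut S g‖ₑ ^ 2 ≤ ‖g‖ₑ ^ 2 := by
    rw [enorm_cut_sq hS, enorm_sq_eq_lintegral]
    exact setLIntegral_le_lintegral _ _
  exact (ENNReal.pow_right_strictMono two_ne_zero).le_iff_le.1 this

theorem integrable_cut_Icc (M : ℝ) (g : L2) : Integrable (cut (Icc (-M) M) g) := by
  rw [integrable_congr (cut_ae measurableSet_Icc g), integrable_indicator_iff measurableSet_Icc]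
  have : IntegrableOn g (Icc (-M) M) := ((Lp.memLp g).restrict _).integrable (by norm_num)
  exact this

theorem tendsto_cut (g : L2) :
    Filter.Tendsto (fun n : ℕ => cut (Icc (-(n : ℝ)) n) g) Filter.atTop (nhds g) := by
  rw [tendsto_iff_norm_sub_tendsto_zero]
  have key : Filter.Tendsto (fun n : ℕ => ∫ x, ‖(Icc (-(n : ℝ)) n).indicator g x - g x‖ ^ 2)
      Filter.atTop (nhds (∫ _ : ℝ, (0 : ℝ))) := by
    refine tendsto_integral_of_dominated_convergence (fun x => ‖g x‖ ^ 2) (fun n => ?_)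
      (integrable_norm_sq g) (fun n => ?_) ?_
    · exact (((Lp.aestronglyMeasurable g).indicator measurableSet_Icc).sub
        (Lp.aestronglyMeasurable g)).norm.pow 2
    · filter_upwards with x
      by_cases h : x ∈ Icc (-(n : ℝ)) n <;> simp [h]
    · filter_upwards with x
      refine tendsto_const_nhds.congr' ?_
      filter_upwards [Filter.eventually_ge_atTop ⌈|x|⌉₊] with n hn
      have h1 : |x| ≤ n := (Nat.le_ceil _).trans (by exact_mod_cast hn)
      have : x ∈ Icc (-(n : ℝ)) n := abs_le.1 h1
      simp [this]
  have h2 : ∀ n : ℕ, ‖cut (Icc (-(n : ℝ)) n) g - g‖ ^ 2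
      = ∫ x, ‖(Icc (-(n : ℝ)) n).indicator g x - g x‖ ^ 2 := by
    intro n
    rw [norm_sq_eq_integral]
    refine integral_congr_ae ?_
    filter_upwards [cut_ae (S := Icc (-(n : ℝ)) n) measurableSet_Icc g,
      Lp.coeFn_sub (cut (Icc (-(n : ℝ)) n) g) g] with x h1 h2
    rw [h2, Pi.sub_apply, h1]
  simp_rw [← h2] at key
  have := (Real.continuous_sqrt.tendsto _).comp key
  simpa [Function.comp_def, Real.sqrt_sq] using this

theorem exists_subseq_norm_sub_le {f : ℕ → L2} {g : L2}
    (h : Filter.Tendsto f Filter.atTop (nhds g)) :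
    ∃ φ : ℕ → ℕ, StrictMono φ ∧ ∀ n, ‖f (φ n) - g‖ ≤ (1 / 2 : ℝ) ^ n := by
  refine Filter.extraction_forall_of_eventually' (P := fun n k => ‖f k - g‖ ≤ (1 / 2 : ℝ) ^ n)
    fun n => ?_
  have := (tendsto_iff_norm_sub_tendsto_zero.1 h).eventually
    (gt_mem_nhds (show (0 : ℝ) < (1 / 2) ^ n by positivity))
  obtain ⟨N, hN⟩ := Filter.eventually_atTop.1 this
  exact ⟨N, fun k hk => (hN k hk).le⟩

/-- A geometric rate makes the sum of `‖f n - g‖²` finite, hence the pointwise sum of `|f n - g|²`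
finite almost everywhere. The rate is preserved by the isometries `T r`, so one sequence serves all
times at once. -/
theorem ae_tendsto_of_norm_sub_le {f : ℕ → L2} {g : L2}
    (h : ∀ n, ‖f n - g‖ ≤ (1 / 2 : ℝ) ^ n) :
    ∀ᵐ x, Filter.Tendsto (fun n => f n x) Filter.atTop (nhds (g x)) := by
  have hfin : ∑' n, ∫⁻ x, ‖(f n - g) x‖ₑ ^ 2 ≠ ⊤ := by
    simp_rw [← enorm_sq_eq_lintegral]
    refine ne_top_of_le_ne_top (b := ∑' n : ℕ, (1 / 2 : ℝ≥0∞) ^ n) ?_ ?_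
    · simp [ENNReal.tsum_geometric]
    · refine ENNReal.tsum_le_tsum fun n => ?_
      have h1 : ‖f n - g‖ₑ ≤ (1 / 2 : ℝ≥0∞) ^ n := by
        rw [← ofReal_norm]
        refine (ENNReal.ofReal_le_ofReal (h n)).trans (le_of_eq ?_)
        rw [ENNReal.ofReal_pow (by norm_num), ENNReal.ofReal_div_of_pos (by norm_num)]
        simp
      have h2 : (1 / 2 : ℝ≥0∞) ^ n ≤ 1 := pow_le_one₀ (by simp) (by simp)
      calc ‖f n - g‖ₑ ^ 2 = ‖f n - g‖ₑ * ‖f n - g‖ₑ := sq _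
        _ ≤ (1 / 2 : ℝ≥0∞) ^ n * 1 := mul_le_mul' h1 (h1.trans h2)
        _ = _ := mul_one _
  rw [← lintegral_tsum (fun n => (Lp.aestronglyMeasurable (f n - g)).enorm.pow_const 2)] at hfin
  have hae := ae_lt_top' (AEMeasurable.tsum
    (fun n => (Lp.aestronglyMeasurable (f n - g)).enorm.pow_const 2)) hfin
  have hsub : ∀ᵐ x, ∀ n, (f n - g) x = f n x - g x :=
    ae_all_iff.2 fun n => Lp.coeFn_sub (f n) g
  filter_upwards [hae, hsub] with x hx hs
  have h0 := ENNReal.tendsto_atTop_zero_of_tsum_ne_top hx.ne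
  rw [tendsto_iff_norm_sub_tendsto_zero]
  have h1 := (ENNReal.continuous_rpow_const (y := (1/2 : ℝ))).tendsto 0 |>.comp h0
  have h2 := (ENNReal.tendsto_toReal (by simp)).comp h1
  refine (h2.congr fun n => ?_).trans (by simp)
  simp only [Function.comp_apply, hs n]
  rw [← ENNReal.rpow_natCast, ← ENNReal.rpow_mul]
  simp

/-! ### Jointly measurable representatives -/

/-- `u` is a jointly measurable representative of `(r, x) ↦ T_r f(x)`. -/
def JointRep (f : L2) (u : ℝ × ℝ → ℂ) : Prop :=
  Measurable u ∧ ∀ r, (fun x => u (r, x)) =ᵐ[volume] T r f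

theorem JointRep.of_integrable {f : L2} (hf : Integrable (𝓕 f : L2)) :
    JointRep f (fun p => 𝓕⁻ (fun ξ => schrodingerSymbol p.1 ξ * (𝓕 f : L2) ξ) p.2) := by
  refine ⟨Continuous.measurable ?_, fun r => (T_ae_of_integrable hf r).symm⟩
  simp_rw [Real.fourierInv_eq']
  refine continuous_of_dominated (bound := fun ξ => ‖(𝓕 f : L2) ξ‖) (fun p => ?_) (fun p => ?_)
    hf.norm ?_
  · have h1 : Continuous fun v : ℝ =>
      Complex.exp (((2 * Real.pi * inner ℝ v p.2 : ℝ) : ℂ) * Complex.I) := by fun_prop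
    exact h1.aestronglyMeasurable.smul (integrable_symbol_mul hf p.1).1
  · filter_upwards with ξ
    rw [norm_smul, norm_mul, norm_schrodingerSymbol, Complex.norm_exp_ofReal_mul_I]
    simp
  · filter_upwards with ξ
    unfold schrodingerSymbol
    fun_prop

theorem exists_bandlimited_approx (f : L2) :
    ∃ F : ℕ → L2, (∀ n, Integrable (𝓕 (F n) : L2)) ∧ ∀ n, ‖F n - f‖ ≤ (1 / 2 : ℝ) ^ n := by
  obtain ⟨φ, -, hφ⟩ := exists_subseq_norm_sub_le (tendsto_cut (𝓕 f))
  refine ⟨fun n => 𝓕⁻ (cut (Icc (-(φ n : ℝ)) (φ n)) (𝓕 f)), fun n => ?_, fun n => ?_⟩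
  · rw [FourierTransform.fourier_fourierInv_eq]
    exact integrable_cut_Icc _ _
  · have e : ∀ u v : L2, (𝓕 (u - v) : L2) = 𝓕 u - 𝓕 v := fun u v =>
      (Lp.fourierTransformₗᵢ ℝ ℂ).map_sub u v
    rw [← Lp.norm_fourier_eq, e, FourierTransform.fourier_fourierInv_eq]
    exact hφ n

theorem ae_tendsto_T {f : ℕ → L2} {g : L2} (h : ∀ n, ‖f n - g‖ ≤ (1 / 2 : ℝ) ^ n) (r : ℝ) :
    ∀ᵐ x, Filter.Tendsto (fun n => T r (f n) x) Filter.atTop (nhds (T r g x)) :=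
  ae_tendsto_of_norm_sub_le fun n => by rw [← T_sub, norm_T]; exact h n

/-- For each `r` the wave `T r f` is only a class of functions, while Tonelli in `(r, x)` needs a
jointly measurable one. Band-limited data give a continuous formula; in general the pointwise limit
is taken along an approximating sequence that does not depend on `r`. -/
theorem exists_jointRep (f : L2) : ∃ u, JointRep f u := by
  obtain ⟨F, hF, hFf⟩ := exists_bandlimited_approx f
  choose u hu using fun n => (⟨_, JointRep.of_integrable (hF n)⟩ : ∃ u, JointRep (F n) u)
  refine ⟨fun p => Filter.limUnder Filter.atTop fun n => u n p,
    (StronglyMeasurable.limUnder fun n => (hu n).1.stronglyMeasurable).measurable, fun r => ?_⟩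
  have hall : ∀ᵐ x, ∀ n, u n (r, x) = T r (F n) x := ae_all_iff.2 fun n => (hu n).2 r
  filter_upwards [ae_tendsto_T hFf r, hall] with x h1 h2
  simp_rw [← h2] at h1
  exact h1.limUnder_eq

/-- Space-time Fatou lemma along a rapidly convergent sequence of data. -/
theorem lintegral_T_mul_T_le_of_approx {S : Set ℝ} {f g : L2} {F G : ℕ → L2}
    (hF : ∀ n, ‖F n - f‖ ≤ (1 / 2 : ℝ) ^ n) (hG : ∀ n, ‖G n - g‖ ≤ (1 / 2 : ℝ) ^ n) (k : ℕ)
    {B : ℝ≥0∞}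
    (hB : ∀ n, ∫⁻ r in S, ∫⁻ x, (‖T r (F n) x‖ₑ * ‖T r (G n) x‖ₑ) ^ k ≤ B) :
    ∫⁻ r in S, ∫⁻ x, (‖T r f x‖ₑ * ‖T r g x‖ₑ) ^ k ≤ B := by
  choose u hu using fun n => exists_jointRep (F n)
  choose v hv using fun n => exists_jointRep (G n)
  have e : ∀ n r, ∫⁻ x, (‖T r (F n) x‖ₑ * ‖T r (G n) x‖ₑ) ^ k
      = ∫⁻ x, (‖u n (r, x)‖ₑ * ‖v n (r, x)‖ₑ) ^ k := by
    intro n r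
    refine lintegral_congr_ae ?_
    filter_upwards [(hu n).2 r, (hv n).2 r] with x h1 h2
    rw [← h1, ← h2]
  calc ∫⁻ r in S, ∫⁻ x, (‖T r f x‖ₑ * ‖T r g x‖ₑ) ^ k
      ≤ ∫⁻ r in S, Filter.liminf
          (fun n => ∫⁻ x, (‖T r (F n) x‖ₑ * ‖T r (G n) x‖ₑ) ^ k) Filter.atTop := by
        refine lintegral_mono fun r => ?_
        have hlim : ∀ᵐ x, (‖T r f x‖ₑ * ‖T r g x‖ₑ) ^ k
            = Filter.liminf (fun n => (‖T r (F n) x‖ₑ * ‖T r (G n) x‖ₑ) ^ k) Filter.atTop := by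
          filter_upwards [ae_tendsto_T hF r, ae_tendsto_T hG r] with x h1 h2
          refine (Filter.Tendsto.liminf_eq ?_).symm
          refine ((ENNReal.continuous_pow k).tendsto _).comp
            (ENNReal.Tendsto.mul ?_ (Or.inr (by simp)) ?_ (Or.inr (by simp)))
          · exact (continuous_enorm.tendsto _).comp h1
          · exact (continuous_enorm.tendsto _).comp h2
        rw [lintegral_congr_ae hlim]
        refine lintegral_liminf_le' fun n => ?_
        exact ((Lp.aestronglyMeasurable _).enorm.mul (Lp.aestronglyMeasurable _).enorm).pow_const k
    _ ≤ Filter.liminf (fun n => ∫⁻ r in S, ∫⁻ x, (‖T r (F n) x‖ₑ * ‖T r (G n) x‖ₑ) ^ k)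
          Filter.atTop := by
        refine lintegral_liminf_le fun n => ?_
        simp_rw [e n]
        exact Measurable.lintegral_prod_right'
          (f := fun p : ℝ × ℝ => (‖u n p‖ₑ * ‖v n p‖ₑ) ^ k)
          (((hu n).1.enorm.mul (hv n).1.enorm).pow_const k)
    _ ≤ B := by
        refine Filter.liminf_le_of_le (by isBoundedDefault) fun b hb => ?_
        obtain ⟨n, hn⟩ := hb.exists
        exact hn.trans (hB n)

/-! ### The one-dimensional oscillatory Plancherel estimate -/

/-- The oscillating factor `e^{-2π i t}`. -/
def phase (t : ℝ) : ℂ := Complex.exp (((-2 * Real.pi * t : ℝ) : ℂ) * Complex.I)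

theorem phase_add (s t : ℝ) : phase (s + t) = phase s * phase t := by
  rw [phase, phase, phase, ← Complex.exp_add]
  push_cast
  ring_nf

theorem norm_phase (t : ℝ) : ‖phase t‖ = 1 := Complex.norm_exp_ofReal_mul_I _

theorem enorm_phase (t : ℝ) : ‖phase t‖ₑ = 1 := by
  rw [← ofReal_norm, norm_phase, ENNReal.ofReal_one]

theorem continuous_phase : Continuous phase := by unfold phase; fun_prop

theorem integrable_phase_mul {α : Type*} [MeasurableSpace α] {μ : Measure α} {F : α → ℂ}
    (hF : Integrable F μ) {φ : α → ℝ} (hφ : Measurable φ) :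
    Integrable (fun a => phase (φ a) * F a) μ :=
  hF.bdd_mul (continuous_phase.measurable.comp hφ).aestronglyMeasurable
    (Filter.Eventually.of_forall fun _ => (norm_phase _).le)

theorem fourier_eq_integral_phase (g : ℝ → ℂ) (ξ : ℝ) : 𝓕 g ξ = ∫ y, phase (ξ * y) * g y := by
  rw [Real.fourier_real_eq_integral_exp_smul]
  refine integral_congr_ae (Filter.Eventually.of_forall fun y => ?_)
  simp only [phase, smul_eq_mul]
  ring_nf

theorem image_sq_Ioi : (fun w : ℝ => w ^ 2) '' Ioi 0 = Ioi 0 := by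
  ext p
  simp only [mem_image, mem_Ioi]
  constructor
  · rintro ⟨w, hw, rfl⟩; positivity
  · intro hp
    exact ⟨√p, Real.sqrt_pos.2 hp, Real.sq_sqrt hp.le⟩

theorem injOn_sq_Ioi : InjOn (fun w : ℝ => w ^ 2) (Ioi 0) := by
  intro x hx y hy h
  exact (pow_left_inj₀ (le_of_lt hx) (le_of_lt hy) two_ne_zero).1 h

/-- With `p = w²` the inner integral is the Fourier transform of `k(√p)/(2√p)` on the half-line.
Plancherel and the substitution back produce the weight `1/(2w)`; the factor `1/2` is discarded. -/
theorem lintegral_enorm_sq_integral_phase_sq_le {k : ℝ → ℂ}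
    (hk : IntegrableOn k (Ioi 0)) :
    ∫⁻ ρ, ‖∫ w in Ioi 0, phase (ρ * w ^ 2) * k w‖ₑ ^ 2
      ≤ ∫⁻ w in Ioi 0, ‖k w‖ₑ ^ 2 / ENNReal.ofReal w := by
  set κ : ℝ → ℂ := fun p => ((2 * √p)⁻¹ : ℝ) • k √p with hκ
  have hd : ∀ x ∈ Ioi (0 : ℝ), HasDerivWithinAt (fun w : ℝ => w ^ 2) (2 * x) (Ioi 0) x :=
    fun x _ => by simpa using (hasDerivAt_pow 2 x).hasDerivWithinAt
  have hval : ∀ w ∈ Ioi (0 : ℝ), |2 * w| • κ (w ^ 2) = k w := by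
    intro w hw
    have hw' : (0 : ℝ) < w := hw
    rw [hκ]
    simp only
    rw [Real.sqrt_sq hw'.le, smul_smul, abs_of_pos (by positivity), mul_inv_cancel₀ (by positivity),
      one_smul]
  have hκi : IntegrableOn κ (Ioi 0) := by
    rw [← image_sq_Ioi, integrableOn_image_iff_integrableOn_abs_deriv_smul measurableSet_Ioi hd
      injOn_sq_Ioi]
    exact hk.congr_fun (fun w hw => (hval w hw).symm) measurableSet_Ioi
  have h1 : ∀ ρ, ∫ w in Ioi 0, phase (ρ * w ^ 2) * k w = 𝓕 ((Ioi 0).indicator κ) ρ := by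
    intro ρ
    rw [fourier_eq_integral_phase]
    have : (fun y => phase (ρ * y) * (Ioi 0).indicator κ y)
        = (Ioi 0).indicator fun y => phase (ρ * y) * κ y := by
      ext y; by_cases hy : y ∈ Ioi (0 : ℝ) <;> simp [hy]
    rw [this, integral_indicator measurableSet_Ioi]
    conv_rhs => rw [← image_sq_Ioi]
    rw [integral_image_eq_integral_abs_deriv_smul measurableSet_Ioi hd injOn_sq_Ioi]
    refine setIntegral_congr_fun measurableSet_Ioi fun w hw => ?_
    rw [← hval w hw, mul_smul_comm]
  simp_rw [h1]
  refine (lintegral_enorm_sq_fourier_le (hκi.integrable_indicator measurableSet_Ioi)).trans ?_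
  have : (fun y => ‖(Ioi 0).indicator κ y‖ₑ ^ 2)
        = (Ioi 0).indicator fun y => ‖κ y‖ₑ ^ 2 := by
    ext y; by_cases hy : y ∈ Ioi (0 : ℝ) <;> simp [hy]
  rw [this, lintegral_indicator measurableSet_Ioi]
  conv_lhs => rw [← image_sq_Ioi]
  rw [lintegral_image_eq_lintegral_abs_deriv_mul measurableSet_Ioi hd injOn_sq_Ioi]
  refine setLIntegral_mono' measurableSet_Ioi fun w hw => ?_
  have hw' : (0 : ℝ) < w := hw
  have h2 : ‖k w‖ₑ = ENNReal.ofReal (2 * w) * ‖κ (w ^ 2)‖ₑ := by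
    rw [← hval w hw, enorm_smul, abs_of_pos (by positivity),
      Real.enorm_eq_ofReal (by positivity)]
  rw [h2, abs_of_pos (by positivity), ENNReal.le_div_iff_mul_le (by simp [hw']) (by simp)]
  rw [mul_pow, sq (ENNReal.ofReal (2 * w))]
  have h3 : ENNReal.ofReal w ≤ ENNReal.ofReal (2 * w) :=
    ENNReal.ofReal_le_ofReal (by linarith)
  calc ENNReal.ofReal (2 * w) * ‖κ (w ^ 2)‖ₑ ^ 2 * ENNReal.ofReal w
      ≤ ENNReal.ofReal (2 * w) * ‖κ (w ^ 2)‖ₑ ^ 2 * ENNReal.ofReal (2 * w) := by gcongr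
    _ = _ := by ring

/-- The half-plane `ℝ × (0, ∞)` with Lebesgue measure. -/
abbrev halfPlane : Measure (ℝ × ℝ) := (volume : Measure ℝ).prod (volume.restrict (Ioi 0))

/-- Plancherel twice. For fixed `ρ` the integral is a Fourier transform in `p.1`, where `ω` only
contributes a unimodular factor; after exchanging the order of integration, the half-line estimate
applies for each fixed `p.1`. -/
theorem lintegral_enorm_sq_integral_phase_halfPlane_le {F : ℝ × ℝ → ℂ} (hF : Measurable F)
    (hFi : Integrable F halfPlane) {ω : ℝ → ℝ} (hω : Measurable ω) :
    ∫⁻ ρ, ∫⁻ ξ, ‖∫ p, phase (ξ * p.1 + ρ * (ω p.1 + p.2 ^ 2)) * F p ∂halfPlane‖ₑ ^ 2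
      ≤ ∫⁻ p, ‖F p‖ₑ ^ 2 / ENNReal.ofReal p.2 ∂halfPlane := by
  set J : ℝ → ℝ → ℂ := fun ρ z => ∫ w in Ioi 0, phase (ρ * w ^ 2) * F (z, w) with hJ
  have hJm : Measurable (Function.uncurry J) := by
    refine StronglyMeasurable.measurable (StronglyMeasurable.integral_prod_right
      (f := fun (q : ℝ × ℝ) (w : ℝ) => phase (q.1 * w ^ 2) * F (q.2, w)) ?_)
    refine Measurable.stronglyMeasurable ?_
    have h1 : Measurable fun x : (ℝ × ℝ) × ℝ => phase (x.1.1 * x.2 ^ 2) :=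
      continuous_phase.measurable.comp (by fun_prop)
    exact h1.mul (hF.comp (by fun_prop))
  have hmeas : ∀ ρ : ℝ, Measurable fun p : ℝ × ℝ => ρ * (ω p.1 + p.2 ^ 2) := by
    intro ρ; fun_prop
  have hI : ∀ ρ, Integrable (fun z => phase (ρ * ω z) * J ρ z) := by
    intro ρ
    have := (integrable_phase_mul hFi (hmeas ρ)).integral_prod_left
    refine this.congr (Filter.Eventually.of_forall fun z => ?_)
    simp only [hJ]
    rw [← integral_const_mul]
    refine integral_congr_ae (Filter.Eventually.of_forall fun w => ?_)
    simp only [mul_add, phase_add]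
    ring
  have h1 : ∀ ρ ξ, ∫ p, phase (ξ * p.1 + ρ * (ω p.1 + p.2 ^ 2)) * F p ∂halfPlane
      = 𝓕 (fun z => phase (ρ * ω z) * J ρ z) ξ := by
    intro ρ ξ
    rw [fourier_eq_integral_phase, integral_prod _ (integrable_phase_mul hFi (by fun_prop))]
    refine integral_congr_ae (Filter.Eventually.of_forall fun z => ?_)
    simp only [hJ]
    rw [← integral_const_mul, ← integral_const_mul]
    refine integral_congr_ae (Filter.Eventually.of_forall fun w => ?_)
    simp only [mul_add, phase_add]
    ring
  simp_rw [h1]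
  calc ∫⁻ ρ, ∫⁻ ξ, ‖𝓕 (fun z => phase (ρ * ω z) * J ρ z) ξ‖ₑ ^ 2
      ≤ ∫⁻ ρ, ∫⁻ z, ‖J ρ z‖ₑ ^ 2 := by
        refine lintegral_mono fun ρ => (lintegral_enorm_sq_fourier_le (hI ρ)).trans (le_of_eq ?_)
        refine lintegral_congr fun z => ?_
        rw [enorm_mul, enorm_phase, one_mul]
    _ = ∫⁻ z, ∫⁻ ρ, ‖J ρ z‖ₑ ^ 2 :=
        lintegral_lintegral_swap (hJm.enorm.pow_const 2).aemeasurable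
    _ ≤ ∫⁻ z, ∫⁻ w in Ioi 0, ‖F (z, w)‖ₑ ^ 2 / ENNReal.ofReal w := by
        refine lintegral_mono_ae ?_
        filter_upwards [hFi.prod_right_ae] with z hz
        exact lintegral_enorm_sq_integral_phase_sq_le hz
    _ = _ := by
        rw [lintegral_prod]
        exact ((hF.enorm.pow_const 2).div (by fun_prop)).aemeasurable

/-! ### Bilinear and trilinear estimates for the chirp transform -/

/-- Linear changes of variables, up to an unspecified constant. -/
theorem exists_volume_eq_smul_map {E : Type*} [NormedAddCommGroup E] [NormedSpace ℝ E]
    [MeasureSpace E] [BorelSpace E] [FiniteDimensional ℝ E]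
    [(volume : Measure E).IsAddHaarMeasure] {L : E →ₗ[ℝ] E} (hL : Function.Injective L) :
    ∃ D : ℝ≥0, (volume : Measure E) = D • (volume : Measure E).map L := by
  have hdet : LinearMap.det L ≠ 0 := by
    have := LinearEquiv.isUnit_det' (LinearEquiv.ofInjectiveEndo L hL)
    have e : (LinearEquiv.ofInjectiveEndo L hL : E →ₗ[ℝ] E) = L := rfl
    rw [e] at this
    exact this.ne_zero
  refine ⟨‖LinearMap.det L‖₊, ?_⟩
  rw [Measure.map_linearMap_addHaar_eq_smul_addHaar _ hdet]
  rw [← smul_assoc, ENNReal.smul_def, smul_eq_mul, abs_inv,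
    ENNReal.ofReal_inv_of_pos (abs_pos.2 hdet), ← Real.norm_eq_abs, ofReal_norm, enorm_eq_nnnorm,
    ENNReal.mul_inv_cancel (by simpa using hdet) (by simp), one_smul]

theorem integral_linearMap {E : Type*} [NormedAddCommGroup E] [NormedSpace ℝ E]
    [MeasureSpace E] [BorelSpace E] [FiniteDimensional ℝ E] {L : E →ₗ[ℝ] E}
    {D : ℝ≥0} (h : (volume : Measure E) = D • (volume : Measure E).map L) {G : E → ℂ}
    (hG : Measurable G) : ∫ y, G y = D * ∫ v, G (L v) := by
  conv_lhs => rw [h]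
  rw [integral_smul_nnreal_measure, integral_map]
  · rw [NNReal.smul_def]; simp
  · exact L.continuous_of_finiteDimensional.measurable.aemeasurable
  · exact hG.aestronglyMeasurable

theorem lintegral_linearMap {E : Type*} [NormedAddCommGroup E] [NormedSpace ℝ E]
    [MeasureSpace E] [BorelSpace E] [FiniteDimensional ℝ E] {L : E →ₗ[ℝ] E}
    {D : ℝ≥0} (h : (volume : Measure E) = D • (volume : Measure E).map L) {G : E → ℝ≥0∞}
    (hG : Measurable G) : ∫⁻ y, G y = D * ∫⁻ v, G (L v) := by
  conv_lhs => rw [h]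
  rw [lintegral_smul_measure, lintegral_map hG L.continuous_of_finiteDimensional.measurable]
  rw [ENNReal.smul_def, smul_eq_mul]

theorem integrable_linearMap {E : Type*} [NormedAddCommGroup E] [NormedSpace ℝ E]
    [MeasureSpace E] [BorelSpace E] [FiniteDimensional ℝ E] {L : E →ₗ[ℝ] E}
    {D : ℝ≥0} (hD : D ≠ 0) (h : (volume : Measure E) = D • (volume : Measure E).map L) {G : E → ℂ}
    (hG : Measurable G) (hGi : Integrable G) : Integrable fun v => G (L v) := by
  refine ⟨(hG.comp L.continuous_of_finiteDimensional.measurable).aestronglyMeasurable, ?_⟩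
  have h1 := hGi.2
  rw [hasFiniteIntegral_iff_enorm] at h1 ⊢
  rw [lintegral_linearMap h hG.enorm] at h1
  by_contra h2
  rw [not_lt, top_le_iff] at h2
  rw [h2, ENNReal.mul_top (by simpa using hD)] at h1
  exact lt_irrefl _ h1

/-- The chirp transform `ξ ↦ ∫ e^{-2π i (ξ y + ρ y²)} h(y) dy`. -/
def chirp (ρ : ℝ) (h : ℝ → ℂ) (ξ : ℝ) : ℂ := ∫ y, phase (ξ * y + ρ * y ^ 2) * h y

/-- The substitution `y₁ = z / 2 - w / √2`, `y₂ = z / 2 + w / √2`. -/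
def planeMap : ℝ × ℝ →ₗ[ℝ] ℝ × ℝ where
  toFun v := (v.1 / 2 - v.2 * (√2)⁻¹, v.1 / 2 + v.2 * (√2)⁻¹)
  map_add' u v := by ext <;> simp <;> ring
  map_smul' c v := by ext <;> simp <;> ring

theorem planeMap_injective : Function.Injective planeMap := by
  rw [← LinearMap.ker_eq_bot, LinearMap.ker_eq_bot']
  rintro ⟨z, w⟩ h
  simp only [planeMap, LinearMap.coe_mk, AddHom.coe_mk, Prod.mk_eq_zero] at h
  obtain ⟨h1, h2⟩ := h
  have hz : z = 0 := by linarith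
  have hw : w * (√2)⁻¹ = 0 := by linarith
  have : w = 0 := by simpa using hw
  simp [hz, this]

/-- In the coordinates of `planeMap` one has `y₁ + y₂ = z` and `y₁² + y₂² = z²/2 + w²`, so the
product of the two chirps is an oscillatory integral of half-plane type. The separation of the
supports keeps `w` away from zero, which bounds the weight `1/w`. -/
theorem exists_lintegral_chirp_mul_chirp_le : ∃ C : ℝ≥0, ∀ (h₁ h₂ : ℝ → ℂ) (a b : ℝ), a < b →
    Measurable h₁ → Measurable h₂ → Integrable h₁ → Integrable h₂ →
    (∀ x, a < x → h₁ x = 0) → (∀ x, x < b → h₂ x = 0) →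
    ∫⁻ ρ, ∫⁻ ξ, (‖chirp ρ h₁ ξ‖ₑ * ‖chirp ρ h₂ ξ‖ₑ) ^ 2
      ≤ C * ENNReal.ofReal (b - a)⁻¹ * ((∫⁻ x, ‖h₁ x‖ₑ ^ 2) * ∫⁻ x, ‖h₂ x‖ₑ ^ 2) := by
  obtain ⟨D, hD⟩ := exists_volume_eq_smul_map planeMap_injective
  have hD0 : D ≠ 0 := by
    rintro rfl
    rw [zero_smul] at hD
    exact (NeZero.ne (volume : Measure (ℝ × ℝ))) hD
  -- Squaring the product brings `D²`; one factor `D` is used up when the norm of `F` is converted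
  -- back into the product of the norms of `h₁` and `h₂`. The `√2` comes from `w ≥ (b - a)/√2`.
  refine ⟨D * Real.toNNReal √2, fun h₁ h₂ a b hab m₁ m₂ i₁ i₂ s₁ s₂ => ?_⟩
  have h2pos : (0 : ℝ) < (√2)⁻¹ := by positivity
  have h2sq : ((√2)⁻¹ : ℝ) ^ 2 = 1 / 2 := by rw [inv_pow, Real.sq_sqrt (by norm_num)]; norm_num
  set F0 : ℝ × ℝ → ℂ := fun y => h₁ y.1 * h₂ y.2 with hF0
  have mF0 : Measurable F0 := by fun_prop
  have iF0 : Integrable F0 := i₁.mul_prod i₂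
  set F : ℝ × ℝ → ℂ := fun v => F0 (planeMap v) with hF
  have mL : Measurable planeMap := planeMap.continuous_of_finiteDimensional.measurable
  have mF : Measurable F := mF0.comp mL
  have iF : Integrable F := integrable_linearMap hD0 hD mF0 iF0
  have supp : ∀ v : ℝ × ℝ, F v ≠ 0 → (√2)⁻¹ * (b - a) ≤ v.2 := by
    intro v hv
    have hn := mul_ne_zero_iff.1 hv
    have ha : (planeMap v).1 ≤ a := by
      by_contra hc; exact hn.1 (s₁ _ (not_le.1 hc))
    have hb : b ≤ (planeMap v).2 := by
      by_contra hc; exact hn.2 (s₂ _ (not_le.1 hc))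
    simp only [planeMap, LinearMap.coe_mk, AddHom.coe_mk] at ha hb
    have : b - a ≤ 2 * (√2)⁻¹ * v.2 := by linarith
    nlinarith
  have hrestr : halfPlane = (volume : Measure (ℝ × ℝ)).restrict (univ ×ˢ Ioi 0) := by
    rw [halfPlane, Measure.volume_eq_prod, ← Measure.prod_restrict, Measure.restrict_univ]
  -- The supports are ordered, so only `w > 0` contributes and the substitution `p = w²` is
  -- injective there.
  have hpos : ∀ v : ℝ × ℝ, v ∉ (univ : Set ℝ) ×ˢ Ioi (0 : ℝ) → F v = 0 := by
    intro v hv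
    by_contra hc
    have h1 := supp v hc
    refine hv ⟨trivial, lt_of_lt_of_le ?_ h1⟩
    have : 0 < b - a := by linarith
    positivity
  have key : ∀ ρ ξ, chirp ρ h₁ ξ * chirp ρ h₂ ξ
      = D * ∫ p, phase (ξ * p.1 + ρ * (p.1 ^ 2 / 2 + p.2 ^ 2)) * F p ∂halfPlane := by
    intro ρ ξ
    rw [chirp, chirp, ← integral_prod_mul, ← Measure.volume_eq_prod]
    have e1 : ∀ y : ℝ × ℝ, phase (ξ * y.1 + ρ * y.1 ^ 2) * h₁ y.1
        * (phase (ξ * y.2 + ρ * y.2 ^ 2) * h₂ y.2)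
        = phase (ξ * (y.1 + y.2) + ρ * (y.1 ^ 2 + y.2 ^ 2)) * F0 y := by
      intro y
      have : ξ * (y.1 + y.2) + ρ * (y.1 ^ 2 + y.2 ^ 2)
        = (ξ * y.1 + ρ * y.1 ^ 2) + (ξ * y.2 + ρ * y.2 ^ 2) := by ring
      conv_rhs => rw [this, phase_add]
      simp only [hF0]
      ring
    simp_rw [e1]
    rw [integral_linearMap hD (by
      exact (continuous_phase.measurable.comp (by fun_prop)).mul mF0)]
    congr 1
    rw [hrestr, setIntegral_eq_integral_of_forall_compl_eq_zero
      (fun v hv => by rw [hpos v hv, mul_zero])]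
    refine integral_congr_ae (Filter.Eventually.of_forall fun v => ?_)
    simp only [hF]
    congr 2
    simp only [planeMap, LinearMap.coe_mk, AddHom.coe_mk]
    have : (v.1 / 2 - v.2 * (√2)⁻¹) ^ 2 + (v.1 / 2 + v.2 * (√2)⁻¹) ^ 2
      = v.1 ^ 2 / 2 + 2 * v.2 ^ 2 * (√2)⁻¹ ^ 2 := by ring
    rw [this, h2sq]
    ring
  calc ∫⁻ ρ, ∫⁻ ξ, (‖chirp ρ h₁ ξ‖ₑ * ‖chirp ρ h₂ ξ‖ₑ) ^ 2
      = ∫⁻ ρ, ∫⁻ ξ, (D : ℝ≥0∞) ^ 2 * ‖∫ p, phase (ξ * p.1 + ρ * (p.1 ^ 2 / 2 + p.2 ^ 2)) * F p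
          ∂halfPlane‖ₑ ^ 2 := by
        refine lintegral_congr fun ρ => lintegral_congr fun ξ => ?_
        rw [← enorm_mul, key, enorm_mul, mul_pow]
        simp [← ofReal_norm]
    _ = (D : ℝ≥0∞) ^ 2 * ∫⁻ ρ, ∫⁻ ξ, ‖∫ p, phase (ξ * p.1 + ρ * (p.1 ^ 2 / 2 + p.2 ^ 2)) * F p
          ∂halfPlane‖ₑ ^ 2 := by
        have hne : (D : ℝ≥0∞) ^ 2 ≠ ⊤ := by simp
        simp_rw [lintegral_const_mul' _ _ hne]
    _ ≤ (D : ℝ≥0∞) ^ 2 * ∫⁻ p, ‖F p‖ₑ ^ 2 / ENNReal.ofReal p.2 ∂halfPlane := by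
        gcongr
        refine lintegral_enorm_sq_integral_phase_halfPlane_le mF ?_ (ω := fun z => z ^ 2 / 2)
          (by fun_prop)
        rw [hrestr]
        exact iF.integrableOn
    _ ≤ (D : ℝ≥0∞) ^ 2 * ∫⁻ p, (ENNReal.ofReal √2 * ENNReal.ofReal (b - a)⁻¹) * ‖F p‖ₑ ^ 2 := by
        refine mul_le_mul' le_rfl ?_
        rw [hrestr]
        refine (setLIntegral_le_lintegral _ _).trans (lintegral_mono fun p => ?_)
        by_cases h0 : F p = 0
        · simp [h0]
        · have h1 := supp p h0
          have hba : 0 < b - a := by linarith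
          have hp : 0 < (√2)⁻¹ * (b - a) := by positivity
          rw [div_eq_mul_inv, mul_comm]
          gcongr
          rw [← ENNReal.ofReal_mul (by positivity), ← ENNReal.ofReal_inv_of_pos (hp.trans_le h1)]
          refine ENNReal.ofReal_le_ofReal ?_
          refine (inv_anti₀ hp h1).trans (le_of_eq ?_)
          rw [mul_inv, inv_inv]
    _ = _ := by
        have hprod : (∫⁻ x, ‖h₁ x‖ₑ ^ 2) * ∫⁻ x, ‖h₂ x‖ₑ ^ 2 = D * ∫⁻ p, ‖F p‖ₑ ^ 2 := by
          rw [← lintegral_prod_mul (m₁.enorm.pow_const 2).aemeasurable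
            (m₂.enorm.pow_const 2).aemeasurable, ← Measure.volume_eq_prod,
            ← lintegral_linearMap hD (mF0.enorm.pow_const 2)]
          refine lintegral_congr fun p => ?_
          rw [← mul_pow, ← enorm_mul]
        rw [hprod, lintegral_const_mul' _ _ (by finiteness)]
        rw [ENNReal.coe_mul, ENNReal.ofReal]
        ring

/-- An orthogonal (up to scaling) change of variables adapted to the direction `(1, 1, 1)`. -/
def spaceMap : ℝ × (ℝ × ℝ) →ₗ[ℝ] ℝ × (ℝ × ℝ) where
  toFun v := (v.1 / 3 + v.2.1 * (√2)⁻¹ + v.2.2 * (√6)⁻¹,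
    (v.1 / 3 - v.2.1 * (√2)⁻¹ + v.2.2 * (√6)⁻¹, v.1 / 3 - 2 * (v.2.2 * (√6)⁻¹)))
  map_add' u v := by ext <;> simp <;> ring
  map_smul' c v := by ext <;> simp <;> ring

theorem spaceMap_injective : Function.Injective spaceMap := by
  rw [← LinearMap.ker_eq_bot, LinearMap.ker_eq_bot']
  rintro ⟨z, m, n⟩ h
  simp only [spaceMap, LinearMap.coe_mk, AddHom.coe_mk, Prod.mk_eq_zero] at h
  obtain ⟨h1, h2, h3⟩ := h
  have hz : z = 0 := by linarith
  have hm : m * (√2)⁻¹ = 0 := by linarith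
  have hn : n * (√6)⁻¹ = 0 := by linarith
  have hm' : m = 0 := by simpa using hm
  have hn' : n = 0 := by simpa using hn
  simp [hz, hm', hn']

theorem spaceMap_sum (v : ℝ × (ℝ × ℝ)) :
    (spaceMap v).1 + (spaceMap v).2.1 + (spaceMap v).2.2 = v.1 := by
  simp only [spaceMap, LinearMap.coe_mk, AddHom.coe_mk]
  ring

theorem spaceMap_sum_sq (v : ℝ × (ℝ × ℝ)) :
    (spaceMap v).1 ^ 2 + (spaceMap v).2.1 ^ 2 + (spaceMap v).2.2 ^ 2
      = v.1 ^ 2 / 3 + (v.2.1 ^ 2 + v.2.2 ^ 2) := by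
  have h2 : ((√2)⁻¹ : ℝ) ^ 2 = 1 / 2 := by rw [inv_pow, Real.sq_sqrt (by norm_num)]; norm_num
  have h6 : ((√6)⁻¹ : ℝ) ^ 2 = 1 / 6 := by rw [inv_pow, Real.sq_sqrt (by norm_num)]; norm_num
  simp only [spaceMap, LinearMap.coe_mk, AddHom.coe_mk]
  linear_combination 2 * v.2.1 ^ 2 * h2 + 6 * v.2.2 ^ 2 * h6

/-- The product measure on radii and angles. -/
abbrev polarMeasure : Measure (ℝ × ℝ) :=
  (volume.restrict (Ioi 0)).prod (volume.restrict (Ioo (-Real.pi) Real.pi))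

theorem polarMeasure_eq : polarMeasure = volume.restrict polarCoord.target := by
  rw [polarMeasure, Measure.prod_restrict]
  rfl

theorem integral_eq_integral_polarMeasure (f : ℝ × ℝ → ℂ) :
    ∫ p, f p = ∫ q, (q.1 : ℂ) * f (polarCoord.symm q) ∂polarMeasure := by
  rw [← integral_comp_polarCoord_symm, polarMeasure_eq]
  simp_rw [Complex.real_smul]

theorem lintegral_eq_lintegral_polarMeasure (f : ℝ × ℝ → ℝ≥0∞) :
    ∫⁻ p, f p = ∫⁻ q, ENNReal.ofReal q.1 * f (polarCoord.symm q) ∂polarMeasure := by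
  rw [← lintegral_comp_polarCoord_symm, polarMeasure_eq]
  rfl

theorem measurable_polarCoord_symm : Measurable polarCoord.symm := by
  have : (polarCoord.symm : ℝ × ℝ → ℝ × ℝ)
    = fun p => (p.1 * Real.cos p.2, p.1 * Real.sin p.2) := rfl
  rw [this]
  fun_prop

/-- Cauchy–Schwarz against the constant `1` on the circle of angles. -/
theorem enorm_integral_sq_le {k : ℝ → ℂ} (hk : Measurable k) :
    ‖∫ θ in Ioo (-Real.pi) Real.pi, k θ‖ₑ ^ 2
      ≤ ENNReal.ofReal (2 * Real.pi) * ∫⁻ θ in Ioo (-Real.pi) Real.pi, ‖k θ‖ₑ ^ 2 := by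
  set μ := (volume : Measure ℝ).restrict (Ioo (-Real.pi) Real.pi)
  have h1 : ‖∫ θ, k θ ∂μ‖ₑ ≤ ∫⁻ θ, ‖k θ‖ₑ ∂μ := enorm_integral_le_lintegral_enorm _
  have h2 := ENNReal.lintegral_mul_le_Lp_mul_Lq μ Real.HolderConjugate.two_two
    (f := fun _ => (1 : ℝ≥0∞)) (g := fun θ => ‖k θ‖ₑ) aemeasurable_const hk.enorm.aemeasurable
  have h3 : ∫⁻ _, (1 : ℝ≥0∞) ∂μ = ENNReal.ofReal (2 * Real.pi) := by
    simp only [μ, lintegral_const, Measure.restrict_apply_univ, Real.volume_Ioo, one_mul]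
    congr 1; ring
  simp only [Pi.mul_apply, one_mul, ENNReal.one_rpow, h3] at h2
  calc ‖∫ θ, k θ ∂μ‖ₑ ^ 2 ≤ _ := pow_le_pow_left' (h1.trans h2) 2
    _ = _ := by
      rw [mul_pow, ← ENNReal.rpow_natCast, ← ENNReal.rpow_natCast, ← ENNReal.rpow_mul,
        ← ENNReal.rpow_mul]
      simp

/-- The trilinear form of the `L⁶` Strichartz inequality for the chirp transform. -/
theorem exists_lintegral_chirp_pow_six_le : ∃ C : ℝ≥0, ∀ h : ℝ → ℂ,
    Measurable h → Integrable h →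
    ∫⁻ ρ, ∫⁻ ξ, (‖chirp ρ h ξ‖ₑ * ‖chirp ρ h ξ‖ₑ) ^ 3 ≤ C * (∫⁻ x, ‖h x‖ₑ ^ 2) ^ 3 := by
  have : (volume : Measure (ℝ × (ℝ × ℝ))).IsAddHaarMeasure :=
    Measure.prod.instIsAddHaarMeasure _ _
  obtain ⟨D, hD⟩ := exists_volume_eq_smul_map spaceMap_injective
  have hD0 : D ≠ 0 := by
    rintro rfl
    rw [zero_smul] at hD
    exact (NeZero.ne (volume : Measure (ℝ × (ℝ × ℝ)))) hD
  refine ⟨D * Real.toNNReal (2 * Real.pi), fun h mh ih => ?_⟩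
  set F0 : ℝ × (ℝ × ℝ) → ℂ := fun y => h y.1 * (h y.2.1 * h y.2.2) with hF0
  have mF0 : Measurable F0 := by fun_prop
  have iF0 : Integrable F0 := ih.mul_prod (ih.mul_prod ih)
  have mL : Measurable spaceMap := spaceMap.continuous_of_finiteDimensional.measurable
  set F : ℝ × (ℝ × ℝ) → ℂ := fun v => F0 (spaceMap v) with hF
  have mF : Measurable F := mF0.comp mL
  have iF : Integrable F := integrable_linearMap hD0 hD mF0 iF0
  -- the same function in cylindrical coordinates
  set P : ℝ × (ℝ × ℝ) → ℂ := fun v => (v.2.1 : ℂ) * F (v.1, polarCoord.symm v.2) with hP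
  have mP : Measurable P := by
    have : Measurable fun v : ℝ × (ℝ × ℝ) => F (v.1, polarCoord.symm v.2) :=
      mF.comp (measurable_fst.prodMk (measurable_polarCoord_symm.comp measurable_snd))
    exact (Complex.measurable_ofReal.comp (by fun_prop)).mul this
  have iP : Integrable P ((volume : Measure ℝ).prod polarMeasure) := by
    refine ⟨mP.aestronglyMeasurable, ?_⟩
    have h1 := iF.2
    rw [hasFiniteIntegral_iff_enorm, Measure.volume_eq_prod, lintegral_prod _
      mF.enorm.aemeasurable] at h1
    rw [hasFiniteIntegral_iff_enorm, lintegral_prod _ mP.enorm.aemeasurable]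
    refine lt_of_le_of_lt (lintegral_mono fun z => ?_) h1
    rw [lintegral_eq_lintegral_polarMeasure]
    rw [polarMeasure_eq]
    refine setLIntegral_mono' polarCoord.open_target.measurableSet fun q hq => ?_
    have hq1 : 0 < q.1 := hq.1
    rw [hP]
    simp only [enorm_mul]
    rw [← ofReal_norm (q.1 : ℂ), Complex.norm_real, Real.norm_of_nonneg hq1.le]
  -- The phase depends on the plane orthogonal to `(1, 1, 1)` only through the radius, so the angle
  -- is integrated out first and a half-plane integral remains.
  set Q : ℝ × ℝ → ℂ := fun v => ∫ θ in Ioo (-Real.pi) Real.pi, P (v.1, (v.2, θ)) with hQ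
  have mPθ : Measurable fun x : (ℝ × ℝ) × ℝ => P (x.1.1, (x.1.2, x.2)) := mP.comp (by fun_prop)
  have mQ : Measurable Q :=
    (StronglyMeasurable.integral_prod_right (f := fun (v : ℝ × ℝ) (θ : ℝ) => P (v.1, (v.2, θ)))
      mPθ.stronglyMeasurable).measurable
  have iP' : Integrable (fun x : (ℝ × ℝ) × ℝ => P (x.1.1, (x.1.2, x.2)))
      (halfPlane.prod (volume.restrict (Ioo (-Real.pi) Real.pi))) := by
    have := (measurePreserving_prodAssoc (volume : Measure ℝ) (volume.restrict (Ioi (0 : ℝ)))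
      (volume.restrict (Ioo (-Real.pi) Real.pi))).integrable_comp_emb
        MeasurableEquiv.prodAssoc.measurableEmbedding (g := P)
    exact this.2 iP
  have iQ : Integrable Q halfPlane := iP'.integral_prod_left
  have key : ∀ ρ ξ, chirp ρ h ξ * (chirp ρ h ξ * chirp ρ h ξ)
      = D * ∫ p, phase (ξ * p.1 + ρ * (p.1 ^ 2 / 3 + p.2 ^ 2)) * Q p ∂halfPlane := by
    intro ρ ξ
    rw [chirp, ← integral_prod_mul, ← integral_prod_mul, ← Measure.volume_eq_prod,
      ← Measure.volume_eq_prod]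
    have e1 : ∀ y : ℝ × (ℝ × ℝ), phase (ξ * y.1 + ρ * y.1 ^ 2) * h y.1
        * (phase (ξ * y.2.1 + ρ * y.2.1 ^ 2) * h y.2.1
          * (phase (ξ * y.2.2 + ρ * y.2.2 ^ 2) * h y.2.2))
        = phase (ξ * (y.1 + y.2.1 + y.2.2) + ρ * (y.1 ^ 2 + y.2.1 ^ 2 + y.2.2 ^ 2)) * F0 y := by
      intro y
      have : ξ * (y.1 + y.2.1 + y.2.2) + ρ * (y.1 ^ 2 + y.2.1 ^ 2 + y.2.2 ^ 2)
        = (ξ * y.1 + ρ * y.1 ^ 2) + ((ξ * y.2.1 + ρ * y.2.1 ^ 2)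
          + (ξ * y.2.2 + ρ * y.2.2 ^ 2)) := by ring
      conv_rhs => rw [this, phase_add, phase_add (ξ * y.2.1 + ρ * y.2.1 ^ 2)]
      simp only [hF0]
      ring
    simp_rw [e1]
    rw [integral_linearMap hD (by
      exact (continuous_phase.measurable.comp (by fun_prop)).mul mF0)]
    congr 1
    simp_rw [spaceMap_sum, spaceMap_sum_sq]
    have i1 : Integrable (fun v : ℝ × (ℝ × ℝ) =>
        phase (ξ * v.1 + ρ * (v.1 ^ 2 / 3 + (v.2.1 ^ 2 + v.2.2 ^ 2))) * F v) :=
      integrable_phase_mul iF (by fun_prop)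
    have i2 : Integrable (fun p : ℝ × ℝ =>
        phase (ξ * p.1 + ρ * (p.1 ^ 2 / 3 + p.2 ^ 2)) * Q p) halfPlane :=
      integrable_phase_mul iQ (by fun_prop)
    have i3 : Integrable (fun v : ℝ × (ℝ × ℝ) =>
        phase (ξ * v.1 + ρ * (v.1 ^ 2 / 3 + v.2.1 ^ 2)) * P v)
        ((volume : Measure ℝ).prod polarMeasure) :=
      integrable_phase_mul iP (by fun_prop)
    rw [Measure.volume_eq_prod] at i1
    rw [Measure.volume_eq_prod, integral_prod _ i1, integral_prod _ i2]
    refine integral_congr_ae ?_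
    filter_upwards [i3.prod_right_ae] with z hz
    rw [integral_eq_integral_polarMeasure]
    have e2 : ∀ q : ℝ × ℝ, (q.1 : ℂ) * (phase (ξ * z + ρ * (z ^ 2 / 3
        + ((polarCoord.symm q).1 ^ 2 + (polarCoord.symm q).2 ^ 2))) * F (z, polarCoord.symm q))
        = phase (ξ * z + ρ * (z ^ 2 / 3 + q.1 ^ 2)) * P (z, q) := by
      intro q
      have : (polarCoord.symm q).1 ^ 2 + (polarCoord.symm q).2 ^ 2 = q.1 ^ 2 := by
        simp only [polarCoord_symm_apply]
        linear_combination q.1 ^ 2 * Real.sin_sq_add_cos_sq q.2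
      rw [this]
      simp only [hP]
      ring
    simp only [e2]
    rw [integral_prod _ hz]
    refine integral_congr_ae (Filter.Eventually.of_forall fun t => ?_)
    simp only [hQ]
    rw [integral_const_mul]
  calc ∫⁻ ρ, ∫⁻ ξ, (‖chirp ρ h ξ‖ₑ * ‖chirp ρ h ξ‖ₑ) ^ 3
      = ∫⁻ ρ, ∫⁻ ξ, (D : ℝ≥0∞) ^ 2 * ‖∫ p, phase (ξ * p.1 + ρ * (p.1 ^ 2 / 3 + p.2 ^ 2)) * Q p
          ∂halfPlane‖ₑ ^ 2 := by
        refine lintegral_congr fun ρ => lintegral_congr fun ξ => ?_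
        have : (‖chirp ρ h ξ‖ₑ * ‖chirp ρ h ξ‖ₑ) ^ 3
          = ‖chirp ρ h ξ * (chirp ρ h ξ * chirp ρ h ξ)‖ₑ ^ 2 := by
          rw [enorm_mul, enorm_mul]; ring
        rw [this, key, enorm_mul, mul_pow]
        simp [← ofReal_norm]
    _ = (D : ℝ≥0∞) ^ 2 * ∫⁻ ρ, ∫⁻ ξ, ‖∫ p, phase (ξ * p.1 + ρ * (p.1 ^ 2 / 3 + p.2 ^ 2)) * Q p
          ∂halfPlane‖ₑ ^ 2 := by
        have hne : (D : ℝ≥0∞) ^ 2 ≠ ⊤ := by simp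
        simp_rw [lintegral_const_mul' _ _ hne]
    _ ≤ (D : ℝ≥0∞) ^ 2 * ∫⁻ p, ‖Q p‖ₑ ^ 2 / ENNReal.ofReal p.2 ∂halfPlane := by
        refine mul_le_mul' le_rfl ?_
        exact lintegral_enorm_sq_integral_phase_halfPlane_le mQ iQ (ω := fun z => z ^ 2 / 3)
          (by fun_prop)
    -- `P` carries one power of the radius `t`. Its square divided by `t` leaves exactly the polar
    -- Jacobian, so the singular weight disappears without any support condition.
    _ ≤ (D : ℝ≥0∞) ^ 2 * (ENNReal.ofReal (2 * Real.pi) * ∫⁻ v, ‖F v‖ₑ ^ 2) := by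
        refine mul_le_mul' le_rfl ?_
        have m1 : Measurable fun p : ℝ × ℝ => ‖Q p‖ₑ ^ 2 / ENNReal.ofReal p.2 :=
          (mQ.enorm.pow_const 2).div (by fun_prop)
        rw [lintegral_prod _ m1.aemeasurable, Measure.volume_eq_prod,
          lintegral_prod _ (mF.enorm.pow_const 2).aemeasurable,
          ← lintegral_const_mul' _ _ (by finiteness)]
        refine lintegral_mono fun z => ?_
        simp only
        have m2 : Measurable fun q : ℝ × ℝ =>
            ENNReal.ofReal q.1 * ‖F (z, polarCoord.symm q)‖ₑ ^ 2 := by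
          have : Measurable fun q : ℝ × ℝ => F (z, polarCoord.symm q) :=
            mF.comp (measurable_const.prodMk measurable_polarCoord_symm)
          fun_prop
        rw [lintegral_eq_lintegral_polarMeasure, lintegral_prod _ m2.aemeasurable,
          ← lintegral_const_mul' _ _ (by finiteness)]
        refine setLIntegral_mono' measurableSet_Ioi fun t ht => ?_
        have ht' : (0 : ℝ) < t := ht
        refine ENNReal.div_le_of_le_mul ?_
        refine (enorm_integral_sq_le (mP.comp (by fun_prop))).trans ?_
        rw [mul_assoc]
        refine mul_le_mul' le_rfl ?_
        rw [mul_comm, ← lintegral_const_mul' _ _ (by finiteness)]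
        refine lintegral_mono fun θ => ?_
        simp only [hP, enorm_mul, Function.comp]
        rw [← ofReal_norm (t : ℂ), Complex.norm_real, Real.norm_of_nonneg ht'.le, mul_pow, sq,
          mul_assoc]
    _ = _ := by
        have hprod : (∫⁻ x, ‖h x‖ₑ ^ 2) ^ 3 = D * ∫⁻ p, ‖F p‖ₑ ^ 2 := by
          have hm := (mh.enorm.pow_const 2).aemeasurable (μ := volume)
          have hm2 : Measurable fun p : ℝ × ℝ => ‖h p.1‖ₑ ^ 2 * ‖h p.2‖ₑ ^ 2 := by fun_prop
          rw [show (∫⁻ x, ‖h x‖ₑ ^ 2) ^ 3 = (∫⁻ x, ‖h x‖ₑ ^ 2)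
            * ((∫⁻ x, ‖h x‖ₑ ^ 2) * ∫⁻ x, ‖h x‖ₑ ^ 2) by ring,
            ← lintegral_prod_mul hm hm, ← lintegral_prod_mul hm hm2.aemeasurable,
            ← Measure.volume_eq_prod, ← Measure.volume_eq_prod,
            ← lintegral_linearMap hD (mF0.enorm.pow_const 2)]
          refine lintegral_congr fun p => ?_
          simp only [hF0, enorm_mul]
          ring
        rw [hprod, ENNReal.coe_mul, ENNReal.ofReal]
        ring

/-! ### Space-time estimates for the evolution -/

theorem lintegral_comp_mul_left {c : ℝ} (hc : c ≠ 0) (f : ℝ → ℝ≥0∞) :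
    ∫⁻ x, f (c * x) = ENNReal.ofReal |c⁻¹| * ∫⁻ x, f x := by
  have h := lintegral_map_equiv (μ := volume) f (Homeomorph.mulLeft₀ c hc).toMeasurableEquiv
  have h2 : ((Homeomorph.mulLeft₀ c hc).toMeasurableEquiv : ℝ → ℝ) = fun x => c * x := rfl
  rw [h2, Real.map_volume_mul_left hc, lintegral_smul_measure] at h
  exact h.symm

theorem chirp_congr_ae {h k : ℝ → ℂ} (e : h =ᵐ[volume] k) (ρ ξ : ℝ) :
    chirp ρ h ξ = chirp ρ k ξ := by
  refine integral_congr_ae ?_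
  filter_upwards [e] with y hy
  rw [hy]

/-- The symbol `e^{-4π² i r ξ²}` equals `phase (2π r ξ²)`, and the inverse Fourier kernel at `x` is
the phase of frequency `-x`. -/
theorem T_ae_eq_chirp {f : L2} (hf : Integrable (𝓕 f : L2)) (r : ℝ) :
    ∀ᵐ x, T r f x = chirp (2 * Real.pi * r) (𝓕 f : L2) (-x) := by
  filter_upwards [T_ae_of_integrable hf r] with x hx
  rw [hx, Real.fourierInv_eq', chirp]
  refine integral_congr_ae (Filter.Eventually.of_forall fun ξ => ?_)
  simp only [smul_eq_mul, ← mul_assoc]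
  congr 1
  rw [schrodingerSymbol, phase, ← Complex.exp_add]
  congr 1
  simp only [RCLike.inner_apply, conj_trivial]
  push_cast
  ring

theorem lintegral_T_mul_T_eq_chirp {f g : L2} (hf : Integrable (𝓕 f : L2))
    (hg : Integrable (𝓕 g : L2)) (k : ℕ) :
    ∫⁻ r, ∫⁻ x, (‖T r f x‖ₑ * ‖T r g x‖ₑ) ^ k = ENNReal.ofReal |(2 * Real.pi)⁻¹| *
      ∫⁻ ρ, ∫⁻ ξ, (‖chirp ρ (𝓕 f : L2) ξ‖ₑ * ‖chirp ρ (𝓕 g : L2) ξ‖ₑ) ^ k := by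
  rw [← lintegral_comp_mul_left (by positivity)]
  refine lintegral_congr fun r => ?_
  conv_rhs => rw [← lintegral_neg_eq_self]
  refine lintegral_congr_ae ?_
  filter_upwards [T_ae_eq_chirp hf r, T_ae_eq_chirp hg r] with x h1 h2
  rw [h1, h2]

theorem exists_cut_approx (g : L2) : ∃ N : ℕ → ℕ,
    ∀ n, ‖cut (Icc (-(N n : ℝ)) (N n)) g - g‖ ≤ (1 / 2 : ℝ) ^ n := by
  obtain ⟨φ, -, hφ⟩ := exists_subseq_norm_sub_le (tendsto_cut g)
  exact ⟨φ, hφ⟩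

theorem fourier_sub (f g : L2) : (𝓕 (f - g) : L2) = 𝓕 f - 𝓕 g :=
  (Lp.fourierTransformₗᵢ ℝ ℂ).map_sub f g

theorem norm_fourierInv_sub (g f : L2) : ‖(𝓕⁻ g : L2) - f‖ = ‖g - 𝓕 f‖ := by
  rw [← Lp.norm_fourier_eq, fourier_sub, FourierTransform.fourier_fourierInv_eq]

theorem enorm_fourierInv (f : L2) : ‖(𝓕⁻ f : L2)‖ₑ = ‖f‖ₑ := by
  rw [← enorm_fourier, FourierTransform.fourier_fourierInv_eq]

/-- The one-dimensional Strichartz inequality. -/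
theorem exists_strichartz : ∃ C : ℝ≥0, ∀ f : L2,
    ∫⁻ r, ∫⁻ x, ‖T r f x‖ₑ ^ 6 ≤ C * ‖f‖ₑ ^ 6 := by
  obtain ⟨C, hC⟩ := exists_lintegral_chirp_pow_six_le
  refine ⟨Real.toNNReal |(2 * Real.pi)⁻¹| * C, fun f => ?_⟩
  obtain ⟨N, hN⟩ := exists_cut_approx (𝓕 f)
  have hF : ∀ n, ‖(𝓕⁻ (cut (Icc (-(N n : ℝ)) (N n)) (𝓕 f)) : L2) - f‖ ≤ (1 / 2 : ℝ) ^ n :=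
    fun n => by rw [norm_fourierInv_sub]; exact hN n
  have := lintegral_T_mul_T_le_of_approx (S := univ) hF hF 3
    (B := (Real.toNNReal |(2 * Real.pi)⁻¹| * C : ℝ≥0) * ‖f‖ₑ ^ 6) fun n => ?_
  · simp only [Measure.restrict_univ, ← sq, ← pow_mul] at this
    exact this
  · have hi : Integrable (𝓕 (𝓕⁻ (cut (Icc (-(N n : ℝ)) (N n)) (𝓕 f)) : L2) : L2) := by
      rw [FourierTransform.fourier_fourierInv_eq]; exact integrable_cut_Icc _ _
    rw [Measure.restrict_univ, lintegral_T_mul_T_eq_chirp hi hi, ENNReal.coe_mul, mul_assoc,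
      ENNReal.ofReal]
    refine mul_le_mul' le_rfl ((hC _ (Lp.stronglyMeasurable _).measurable hi).trans ?_)
    rw [← enorm_sq_eq_lintegral, enorm_fourier, enorm_fourierInv, ← pow_mul]
    refine mul_le_mul' le_rfl (pow_le_pow_left' ?_ _)
    exact (enorm_cut_le measurableSet_Icc _).trans (enorm_fourier f).le

theorem ae_eq_indicator_of_eq_zero {S : Set ℝ} {f : L2} (h : ∀ᵐ x, x ∉ S → f x = 0) :
    f =ᵐ[volume] S.indicator f := by
  filter_upwards [h] with x hx
  by_cases hS : x ∈ S
  · simp [hS]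
  · simp [hS, hx hS]

/-- The chirp does not see null sets, so support conditions that hold almost everywhere suffice:
truncation to the half-lines gives representatives with genuine supports. -/
theorem lintegral_chirp_L2_le {C : ℝ≥0} (hC : ∀ (h₁ h₂ : ℝ → ℂ) (a b : ℝ), a < b →
    Measurable h₁ → Measurable h₂ → Integrable h₁ → Integrable h₂ →
    (∀ x, a < x → h₁ x = 0) → (∀ x, x < b → h₂ x = 0) →
    ∫⁻ ρ, ∫⁻ ξ, (‖chirp ρ h₁ ξ‖ₑ * ‖chirp ρ h₂ ξ‖ₑ) ^ 2
      ≤ C * ENNReal.ofReal (b - a)⁻¹ * ((∫⁻ x, ‖h₁ x‖ₑ ^ 2) * ∫⁻ x, ‖h₂ x‖ₑ ^ 2))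
    {f g : L2} {a b : ℝ} (hab : a < b) (hf : Integrable f) (hg : Integrable g)
    (sf : ∀ᵐ x, a < x → f x = 0) (sg : ∀ᵐ x, x < b → g x = 0) :
    ∫⁻ ρ, ∫⁻ ξ, (‖chirp ρ f ξ‖ₑ * ‖chirp ρ g ξ‖ₑ) ^ 2
      ≤ C * ENNReal.ofReal (b - a)⁻¹ * (‖f‖ₑ ^ 2 * ‖g‖ₑ ^ 2) := by
  have e1 : f =ᵐ[volume] (Iic a).indicator f :=
    ae_eq_indicator_of_eq_zero (by simpa using sf)
  have e2 : g =ᵐ[volume] (Ici b).indicator g :=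
    ae_eq_indicator_of_eq_zero (by simpa using sg)
  have := hC ((Iic a).indicator f) ((Ici b).indicator g) a b hab
    ((Lp.stronglyMeasurable f).measurable.indicator measurableSet_Iic)
    ((Lp.stronglyMeasurable g).measurable.indicator measurableSet_Ici)
    (hf.congr e1) (hg.congr e2)
    (fun x hx => by simp [hx]) (fun x hx => by simp [hx])
  simp_rw [← chirp_congr_ae e1, ← chirp_congr_ae e2] at this
  rw [enorm_sq_eq_lintegral, enorm_sq_eq_lintegral]
  refine this.trans (le_of_eq ?_)
  congr 2
  · refine lintegral_congr_ae ?_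
    filter_upwards [e1] with x hx
    rw [← hx]
  · refine lintegral_congr_ae ?_
    filter_upwards [e2] with x hx
    rw [← hx]

theorem cut_eq_zero_of {P : ℝ → Prop} {g : L2} (h : ∀ᵐ x, P x → g x = 0) {S : Set ℝ}
    (hS : MeasurableSet S) : ∀ᵐ x, P x → cut S g x = 0 := by
  filter_upwards [h, cut_ae hS g] with x h1 h2 hP
  rw [h2]
  by_cases hx : x ∈ S <;> simp [hx, h1 hP]

/-- A wave is the chirp transform of its frequency profile, so a frequency gap is a gap of the chirp
data. The change from `r` to `ρ = 2π r` is linear, which is why the bound is global in time. -/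
theorem exists_bilinear_fourier : ∃ C : ℝ≥0, ∀ (f g : L2) (a b : ℝ), a < b →
    (∀ᵐ ξ, a < ξ → (𝓕 f : L2) ξ = 0) → (∀ᵐ ξ, ξ < b → (𝓕 g : L2) ξ = 0) →
    ∫⁻ r, ∫⁻ x, (‖T r f x‖ₑ * ‖T r g x‖ₑ) ^ 2
      ≤ C * ENNReal.ofReal (b - a)⁻¹ * (‖f‖ₑ ^ 2 * ‖g‖ₑ ^ 2) := by
  obtain ⟨C, hC⟩ := exists_lintegral_chirp_mul_chirp_le
  refine ⟨Real.toNNReal |(2 * Real.pi)⁻¹| * C, fun f g a b hab sf sg => ?_⟩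
  have approx : ∀ u : L2, ∃ N : ℕ → ℕ,
      ∀ n, ‖(𝓕⁻ (cut (Icc (-(N n : ℝ)) (N n)) (𝓕 u)) : L2) - u‖ ≤ (1 / 2 : ℝ) ^ n := fun u => by
    obtain ⟨N, hN⟩ := exists_cut_approx (𝓕 u)
    exact ⟨N, fun n => by rw [norm_fourierInv_sub]; exact hN n⟩
  obtain ⟨N, hN⟩ := approx f
  obtain ⟨M, hM⟩ := approx g
  have hi : ∀ (u : L2) (n : ℕ),
      Integrable (𝓕 (𝓕⁻ (cut (Icc (-(n : ℝ)) n) (𝓕 u)) : L2) : L2) := fun u n => by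
    rw [FourierTransform.fourier_fourierInv_eq]; exact integrable_cut_Icc _ _
  have := lintegral_T_mul_T_le_of_approx (S := univ) hN hM 2
    (B := (Real.toNNReal |(2 * Real.pi)⁻¹| * C : ℝ≥0) * ENNReal.ofReal (b - a)⁻¹
      * (‖f‖ₑ ^ 2 * ‖g‖ₑ ^ 2)) fun n => ?_
  · simpa only [Measure.restrict_univ] using this
  · rw [Measure.restrict_univ, lintegral_T_mul_T_eq_chirp (hi _ _) (hi _ _), ENNReal.coe_mul,
      mul_assoc, mul_assoc, ENNReal.ofReal, ← mul_assoc (C : ℝ≥0∞)]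
    refine mul_le_mul' le_rfl ((lintegral_chirp_L2_le hC hab (hi _ _) (hi _ _) ?_ ?_).trans ?_)
    · rw [FourierTransform.fourier_fourierInv_eq]; exact cut_eq_zero_of sf measurableSet_Icc
    · rw [FourierTransform.fourier_fourierInv_eq]; exact cut_eq_zero_of sg measurableSet_Icc
    · simp only [enorm_fourier, enorm_fourierInv]
      gcongr
      · exact (enorm_cut_le measurableSet_Icc _).trans (enorm_fourier f).le
      · exact (enorm_cut_le measurableSet_Icc _).trans (enorm_fourier g).le

/-! ### The kernel of the evolution -/

theorem tendsto_bmul {χ : ℕ → ℝ → ℂ} (hm : ∀ n, Measurable (χ n)) (h1 : ∀ n x, ‖χ n x‖ ≤ 1)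
    (hlim : ∀ x, Filter.Tendsto (fun n => χ n x) Filter.atTop (nhds 1)) (g : L2) :
    Filter.Tendsto (fun n => bmul (χ n) g) Filter.atTop (nhds g) := by
  rw [tendsto_iff_norm_sub_tendsto_zero]
  have key : Filter.Tendsto (fun n : ℕ => ∫ x, ‖χ n x * g x - g x‖ ^ 2)
      Filter.atTop (nhds (∫ _ : ℝ, (0 : ℝ))) := by
    refine tendsto_integral_of_dominated_convergence (fun x => 4 * ‖g x‖ ^ 2) (fun n => ?_)
      ((integrable_norm_sq g).const_mul 4) (fun n => ?_) ?_
    · exact (((hm n).aestronglyMeasurable.mul (Lp.aestronglyMeasurable g)).sub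
        (Lp.aestronglyMeasurable g)).norm.pow 2
    · filter_upwards with x
      have : ‖χ n x * g x - g x‖ ≤ 2 * ‖g x‖ := by
        refine (norm_sub_le _ _).trans ?_
        rw [norm_mul]
        nlinarith [h1 n x, norm_nonneg (g x)]
      rw [Real.norm_of_nonneg (by positivity)]
      calc ‖χ n x * g x - g x‖ ^ 2 ≤ (2 * ‖g x‖) ^ 2 := by gcongr
        _ = _ := by ring
    · filter_upwards with x
      have : Filter.Tendsto (fun n => ‖χ n x * g x - g x‖ ^ 2) Filter.atTop
          (nhds (‖1 * g x - g x‖ ^ 2)) :=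
        ((((hlim x).mul_const _).sub_const _).norm).pow 2
      simpa using this
  have h2 : ∀ n : ℕ, ‖bmul (χ n) g - g‖ ^ 2 = ∫ x, ‖χ n x * g x - g x‖ ^ 2 := by
    intro n
    rw [norm_sq_eq_integral]
    refine integral_congr_ae ?_
    filter_upwards [bmul_ae (hm n) (h1 n) g, Lp.coeFn_sub (bmul (χ n) g) g] with x h1 h2
    rw [h2, Pi.sub_apply, h1]
  simp_rw [← h2] at key
  have := (Real.continuous_sqrt.tendsto _).comp key
  simpa [Function.comp_def, Real.sqrt_sq] using this

theorem fourier_ae_of_integrable {f : L2} (hf : Integrable f) :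
    (𝓕 f : L2) =ᵐ[volume] 𝓕 (f : ℝ → ℂ) := by
  have := fourier_toLp_ae hf (Lp.memLp f)
  rwa [Lp.toLp_coeFn] at this

/-- The regularized evolution of an integrable function. -/
theorem integral_gaussian_mul_fourier {f : ℝ → ℂ} (hf : Integrable f) {b : ℂ} (hb : 0 < b.re)
    (x : ℝ) :
    ∫ ξ : ℝ, Complex.exp (-Real.pi * b * ξ ^ 2 + 2 * Real.pi * (Complex.I * x) * ξ) * 𝓕 f ξ
      = 1 / b ^ (1 / 2 : ℂ) * ∫ y : ℝ, Complex.exp (-Real.pi / b * ((y : ℂ) - x) ^ 2) * f y := by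
  set φ : ℝ → ℂ := fun ξ =>
    Complex.exp (-Real.pi * b * ξ ^ 2 + 2 * Real.pi * (Complex.I * x) * ξ) with hφ
  have hφi : Integrable φ := by
    have hb' : 0 < ((Real.pi : ℂ) * b).re := by
      rw [Complex.re_ofReal_mul]; positivity
    have := integrable_cexp_quadratic hb' (2 * Real.pi * (Complex.I * x)) 0
    simpa [hφ] using this
  have e0 : ∫ y, 𝓕 φ y * f y = ∫ ξ, φ ξ * 𝓕 f ξ := by
    simpa using! VectorFourier.integral_fourierIntegral_smul_eq_flip (L := innerₗ ℝ)
      Real.continuous_fourierChar continuous_inner hφi hf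
  rw [← e0, hφ, fourier_gaussian_pi' hb, ← integral_const_mul]
  refine integral_congr_ae (Filter.Eventually.of_forall fun y => ?_)
  simp only [← mul_assoc, Complex.I_mul_I]
  ring_nf

/-- Up to a unimodular factor the kernel of `T r` is `(4π|r|)^{-1/2} e^{i(x-y)²/(4r)}`. In the
expanded square the `x²` part has modulus one, the `y²` part is a chirp with `ρ = -1/(8πr)`, and the
cross term is the frequency `x/(4πr)`. The kernel itself is reached as a limit of complex Gaussians.
-/
theorem norm_T_ae_eq_chirp {f : L2} (hf : Integrable f) {r : ℝ} (hr : r ≠ 0) :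
    ∀ᵐ x, ‖T r f x‖ = (√(4 * Real.pi * |r|))⁻¹ *
      ‖chirp (-(8 * Real.pi * r)⁻¹) f ((4 * Real.pi * r)⁻¹ * x)‖ := by
  -- Gaussian regularization
  set ε : ℕ → ℝ := fun n => 1 / ((n : ℝ) + 1) with hε
  have hε0 : ∀ n, 0 < ε n := fun n => by positivity
  have hεlim : Filter.Tendsto ε Filter.atTop (nhds 0) := tendsto_one_div_add_atTop_nhds_zero_nat
  set χ : ℕ → ℝ → ℂ := fun n ξ => Complex.exp ((-(ε n * (2 * Real.pi * ξ) ^ 2) : ℝ) : ℂ) with hχ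
  have hχm : ∀ n, Measurable (χ n) := fun n => by
    refine Continuous.measurable ?_
    simp only [hχ]; fun_prop
  have hχ1 : ∀ n ξ, ‖χ n ξ‖ ≤ 1 := fun n ξ => by
    rw [hχ]
    simp only
    rw [Complex.norm_exp_ofReal, Real.exp_le_one_iff]
    have := (hε0 n).le
    have : 0 ≤ ε n * (2 * Real.pi * ξ) ^ 2 := by positivity
    linarith
  have hχlim : ∀ ξ, Filter.Tendsto (fun n => χ n ξ) Filter.atTop (nhds 1) := fun ξ => by
    have : Continuous fun t : ℝ => Complex.exp ((-(t * (2 * Real.pi * ξ) ^ 2) : ℝ) : ℂ) := by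
      fun_prop
    have h := (this.tendsto 0).comp hεlim
    simpa [Function.comp_def, hχ] using h
  obtain ⟨N, hNmono, hN⟩ := exists_subseq_norm_sub_le (tendsto_bmul hχm hχ1 hχlim (𝓕 f))
  have hF : ∀ n, ‖(𝓕⁻ (bmul (χ (N n)) (𝓕 f)) : L2) - f‖ ≤ (1 / 2 : ℝ) ^ n :=
    fun n => by rw [norm_fourierInv_sub]; exact hN n
  have hNlim : Filter.Tendsto (fun n => ε (N n)) Filter.atTop (nhds 0) :=
    hεlim.comp hNmono.tendsto_atTop
  -- For `t > 0` the real part is positive, as the Gaussian integral requires; at `t = 0` the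
  -- nonzero imaginary part keeps `b` in the slit plane, so the square root passes to the limit.
  set b : ℝ → ℂ := fun t => 4 * Real.pi * (t + Complex.I * r) with hb
  have hbre : ∀ t, (b t).re = 4 * Real.pi * t := fun t => by simp [hb]
  have hbim : ∀ t, (b t).im = 4 * Real.pi * r := fun t => by simp [hb]
  have hfou : ∀ n, (𝓕 (𝓕⁻ (bmul (χ (N n)) (𝓕 f)) : L2) : L2)
      =ᵐ[volume] fun ξ => χ (N n) ξ * 𝓕 (f : ℝ → ℂ) ξ := fun n => by
    rw [FourierTransform.fourier_fourierInv_eq]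
    filter_upwards [bmul_ae (hχm (N n)) (hχ1 (N n)) (𝓕 f), fourier_ae_of_integrable hf]
      with ξ h1 h2
    rw [h1, h2]
  have hχi : ∀ n, Integrable (χ n) := fun n => by
    have h0 : 0 < ((ε n * (2 * Real.pi) ^ 2 : ℝ) : ℂ).re := by
      rw [Complex.ofReal_re]; have := hε0 n; positivity
    have := integrable_cexp_quadratic h0 0 0
    refine this.congr (Filter.Eventually.of_forall fun ξ => ?_)
    simp only [hχ]
    congr 1
    push_cast
    ring
  have hint : ∀ n, Integrable (𝓕 (𝓕⁻ (bmul (χ (N n)) (𝓕 f)) : L2) : L2) := fun n => by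
    refine Integrable.congr ?_ (hfou n).symm
    have hbd : ∀ ξ, ‖𝓕 (f : ℝ → ℂ) ξ‖ ≤ ∫ x, ‖f x‖ := fun ξ =>
      VectorFourier.norm_fourierIntegral_le_integral_norm _ _ _ _ _
    refine (hχi (N n)).mul_bdd (c := ∫ x, ‖f x‖) ?_ (Filter.Eventually.of_forall hbd)
    exact (VectorFourier.fourierIntegral_continuous Real.continuous_fourierChar continuous_inner
      hf).aestronglyMeasurable
  have hker : ∀ n, ∀ᵐ x, T r (𝓕⁻ (bmul (χ (N n)) (𝓕 f))) x
      = 1 / b (ε (N n)) ^ (1 / 2 : ℂ) *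
        ∫ y : ℝ, Complex.exp (-Real.pi / b (ε (N n)) * ((y : ℂ) - x) ^ 2) * f y := fun n => by
    filter_upwards [T_ae_of_integrable (hint n) r] with x hx
    rw [hx, ← integral_gaussian_mul_fourier hf (by rw [hbre]; have := hε0 (N n); positivity),
      Real.fourierInv_eq']
    refine integral_congr_ae ?_
    filter_upwards [hfou n] with ξ hξ
    rw [hξ]
    simp only [smul_eq_mul, ← mul_assoc]
    congr 1
    rw [schrodingerSymbol, hχ, hb]
    simp only
    rw [← Complex.exp_add, ← Complex.exp_add]
    congr 1
    simp only [RCLike.inner_apply, conj_trivial]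
    push_cast
    ring
  have hlim1 : ∀ x : ℝ, Filter.Tendsto (fun n => 1 / b (ε (N n)) ^ (1 / 2 : ℂ) *
        ∫ y : ℝ, Complex.exp (-Real.pi / b (ε (N n)) * ((y : ℂ) - x) ^ 2) * f y) Filter.atTop
      (nhds (1 / b 0 ^ (1 / 2 : ℂ) *
        ∫ y : ℝ, Complex.exp (-Real.pi / b 0 * ((y : ℂ) - x) ^ 2) * f y)) := fun x => by
    have hbc : Continuous b := by simp only [hb]; fun_prop
    have hblim : Filter.Tendsto (fun n => b (ε (N n))) Filter.atTop (nhds (b 0)) :=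
      (hbc.tendsto 0).comp hNlim
    have him : (b 0).im ≠ 0 := by rw [hbim]; have := Real.pi_pos; positivity
    have hb0 : b 0 ≠ 0 := fun h => him (by rw [h]; rfl)
    refine Filter.Tendsto.mul ?_ ?_
    · refine Filter.Tendsto.div tendsto_const_nhds ?_ ?_
      · exact (continuousAt_cpow_const (Or.inr him)).tendsto.comp hblim
      · rw [Complex.cpow_ne_zero_iff]; exact Or.inl hb0
    · refine tendsto_integral_of_dominated_convergence (fun y => ‖f y‖) (fun n => ?_)
        hf.norm (fun n => ?_) ?_
      · refine AEStronglyMeasurable.mul ?_ hf.1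
        exact Continuous.aestronglyMeasurable (by fun_prop)
      · filter_upwards with y
        rw [norm_mul]
        refine mul_le_of_le_one_left (norm_nonneg _) ?_
        rw [Complex.norm_exp, Real.exp_le_one_iff]
        have e1 : -(Real.pi : ℂ) / b (ε (N n)) * ((y : ℂ) - x) ^ 2
            = ((-(Real.pi * (y - x) ^ 2) : ℝ) : ℂ) * (b (ε (N n)))⁻¹ := by
          push_cast; ring
        rw [e1, Complex.re_ofReal_mul, Complex.inv_re, hbre]
        have := (hε0 (N n)).le
        have h3 : 0 ≤ Real.pi * (y - x) ^ 2 := by have := Real.pi_pos; positivity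
        have h4 : 0 ≤ 4 * Real.pi * ε (N n) / Complex.normSq (b (ε (N n))) :=
          div_nonneg (by have := Real.pi_pos; positivity) (Complex.normSq_nonneg _)
        nlinarith
      · filter_upwards with y
        refine Filter.Tendsto.mul_const _ ?_
        refine (Complex.continuous_exp.tendsto _).comp ?_
        exact (tendsto_const_nhds.div hblim hb0).mul_const _
  have hall : ∀ᵐ x, ∀ n, T r (𝓕⁻ (bmul (χ (N n)) (𝓕 f))) x
      = 1 / b (ε (N n)) ^ (1 / 2 : ℂ) *
        ∫ y : ℝ, Complex.exp (-Real.pi / b (ε (N n)) * ((y : ℂ) - x) ^ 2) * f y :=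
    ae_all_iff.2 hker
  filter_upwards [hall, ae_tendsto_T hF r] with x h1 h2
  simp_rw [h1] at h2
  rw [tendsto_nhds_unique h2 (hlim1 x), norm_mul]
  have hπ := Real.pi_pos
  congr 1
  · rw [norm_div, norm_one, one_div]
    congr 1
    have : ((1 / 2 : ℂ)) = ((1 / 2 : ℝ) : ℂ) := by push_cast; rfl
    rw [this, Complex.norm_cpow_real, ← Real.sqrt_eq_rpow]
    congr 1
    simp only [hb]
    rw [Complex.ofReal_zero, zero_add]
    simp [abs_of_pos hπ]
  · have e2 : ∀ y : ℝ, Complex.exp (-Real.pi / b 0 * ((y : ℂ) - x) ^ 2) * f y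
        = phase (-(8 * Real.pi * r)⁻¹ * x ^ 2) *
          (phase ((4 * Real.pi * r)⁻¹ * x * y + -(8 * Real.pi * r)⁻¹ * y ^ 2) * f y) := by
      intro y
      rw [← mul_assoc, ← phase_add]
      congr 1
      rw [phase]
      congr 1
      simp only [hb]
      have hrc : (r : ℂ) ≠ 0 := by exact_mod_cast hr
      have hpc : (Real.pi : ℂ) ≠ 0 := by exact_mod_cast hπ.ne'
      have hI := Complex.I_ne_zero
      push_cast
      rw [zero_add]
      field_simp
      ring_nf
      simp only [Complex.I_sq]
      ring
    simp_rw [e2]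
    rw [integral_const_mul, norm_mul, norm_phase, one_mul, chirp]

/-- By the kernel formula, separation in space is again a gap of chirp data, with time variable `ρ =
-1/(8πr)`. This substitution has Jacobian `1/(8πr²)`, whereas the spatial integral leaves
`1/(4π|r|)`, which is `2|r|` times the Jacobian. The bound `|r| ≤ R` is therefore needed. -/
theorem exists_bilinear_space (R : ℝ) : ∃ C : ℝ≥0, ∀ (f g : L2) (a b : ℝ), a < b →
    (∀ᵐ x, a < x → f x = 0) → (∀ᵐ x, x < b → g x = 0) →
    ∫⁻ r in Icc (-R) R, ∫⁻ x, (‖T r f x‖ₑ * ‖T r g x‖ₑ) ^ 2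
      ≤ C * ENNReal.ofReal (b - a)⁻¹ * (‖f‖ₑ ^ 2 * ‖g‖ₑ ^ 2) := by
  obtain ⟨C, hC⟩ := exists_lintegral_chirp_mul_chirp_le
  refine ⟨Real.toNNReal (2 * R) * C, fun f g a b hab sf sg => ?_⟩
  obtain ⟨N, hN⟩ := exists_cut_approx f
  obtain ⟨M, hM⟩ := exists_cut_approx g
  refine lintegral_T_mul_T_le_of_approx hN hM 2 fun n => ?_
  set u := cut (Icc (-(N n : ℝ)) (N n)) f
  set v := cut (Icc (-(M n : ℝ)) (M n)) g
  have hu : Integrable u := integrable_cut_Icc _ _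
  have hv : Integrable v := integrable_cut_Icc _ _
  set Ψ : ℝ → ℝ≥0∞ := fun ρ => ∫⁻ ξ, (‖chirp ρ u ξ‖ₑ * ‖chirp ρ v ξ‖ₑ) ^ 2 with hΨ
  set S : Set ℝ := Icc (-R) R \ {0} with hS
  have hSm : MeasurableSet S := measurableSet_Icc.diff (measurableSet_singleton 0)
  have hπ := Real.pi_pos
  have hd : ∀ r ∈ S, HasDerivWithinAt (fun r : ℝ => -(8 * Real.pi * r)⁻¹)
      ((8 * Real.pi * r ^ 2)⁻¹) S r := by
    intro r hr
    have hr0 : r ≠ 0 := hr.2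
    have h1 : HasDerivAt (fun r : ℝ => 8 * Real.pi * r) (8 * Real.pi) r := by
      simpa using (hasDerivAt_id r).const_mul (8 * Real.pi)
    have h2 := (h1.inv (by positivity)).neg
    convert! h2.hasDerivWithinAt using 1
    field_simp
  have hinj : InjOn (fun r : ℝ => -(8 * Real.pi * r)⁻¹) S := by
    intro r _ s _ h
    simp only [neg_inj, inv_inj] at h
    exact mul_left_cancel₀ (by positivity) h
  have hr : ∀ r ∈ S, ∫⁻ x, (‖T r u x‖ₑ * ‖T r v x‖ₑ) ^ 2
      ≤ ENNReal.ofReal (2 * R) *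
        (ENNReal.ofReal |(8 * Real.pi * r ^ 2)⁻¹| * Ψ (-(8 * Real.pi * r)⁻¹)) := by
    intro r hr
    have hr0 : r ≠ 0 := hr.2
    have hrR : |r| ≤ R := abs_le.2 hr.1
    have hR0 : 0 ≤ R := (abs_nonneg r).trans hrR
    have habs : 0 < |r| := abs_pos.2 hr0
    set c : ℝ := (4 * Real.pi * r)⁻¹ with hc
    have hc0 : c ≠ 0 := inv_ne_zero (by positivity)
    set ρ : ℝ := -(8 * Real.pi * r)⁻¹
    set κ : ℝ := (4 * Real.pi * |r|)⁻¹ with hκ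
    have hκ0 : 0 ≤ κ := by positivity
    have e1 : ∫⁻ x, (‖T r u x‖ₑ * ‖T r v x‖ₑ) ^ 2
        = ∫⁻ x, ENNReal.ofReal (κ ^ 2) * (‖chirp ρ u (c * x)‖ₑ * ‖chirp ρ v (c * x)‖ₑ) ^ 2 := by
      refine lintegral_congr_ae ?_
      filter_upwards [norm_T_ae_eq_chirp hu hr0, norm_T_ae_eq_chirp hv hr0] with x h1 h2
      rw [← ofReal_norm, ← ofReal_norm (T r v x), h1, h2,
        ENNReal.ofReal_mul (by positivity), ENNReal.ofReal_mul (by positivity), ofReal_norm,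
        ofReal_norm]
      have h3 : ENNReal.ofReal (κ ^ 2) = (ENNReal.ofReal (√(4 * Real.pi * |r|))⁻¹) ^ 4 := by
        rw [← ENNReal.ofReal_pow (by positivity)]
        congr 1
        rw [hκ, inv_pow, inv_pow, show 4 = 2 * 2 by rfl, pow_mul, Real.sq_sqrt (by positivity)]
      rw [h3]
      ring
    rw [e1, lintegral_const_mul' _ _ (by finiteness),
      lintegral_comp_mul_left hc0 (fun ξ => (‖chirp ρ u ξ‖ₑ * ‖chirp ρ v ξ‖ₑ) ^ 2), ← mul_assoc,
      ← mul_assoc, ← ENNReal.ofReal_mul (by positivity), ← ENNReal.ofReal_mul (by positivity)]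
    refine mul_le_mul' (ENNReal.ofReal_le_ofReal ?_) le_rfl
    -- The amplitudes of the two waves give `κ²` after squaring, and rescaling `x` by `c` gives back
    -- one factor `1/κ`.
    have h5 : κ ^ 2 * |c⁻¹| = κ := by
      rw [hc, inv_inv, hκ, abs_mul, abs_of_pos (show (0 : ℝ) < 4 * Real.pi by positivity)]
      field_simp
    rw [h5, abs_of_pos (by positivity), hκ, ← sq_abs r]
    have h6 : (4 * Real.pi * |r|)⁻¹ = 2 * |r| * (8 * Real.pi * |r| ^ 2)⁻¹ := by
      field_simp
      norm_num
    rw [h6]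
    gcongr
  have hSae : (Icc (-R) R : Set ℝ) =ᵐ[volume] S := by
    refine (sdiff_ae_eq_self.2 ?_).symm
    exact measure_mono_null inter_subset_right (by simp)
  calc ∫⁻ r in Icc (-R) R, ∫⁻ x, (‖T r u x‖ₑ * ‖T r v x‖ₑ) ^ 2
      = ∫⁻ r in S, ∫⁻ x, (‖T r u x‖ₑ * ‖T r v x‖ₑ) ^ 2 := setLIntegral_congr hSae
    _ ≤ ∫⁻ r in S, ENNReal.ofReal (2 * R) *
        (ENNReal.ofReal |(8 * Real.pi * r ^ 2)⁻¹| * Ψ (-(8 * Real.pi * r)⁻¹)) :=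
        setLIntegral_mono' hSm hr
    _ = ENNReal.ofReal (2 * R) * ∫⁻ ρ in (fun r : ℝ => -(8 * Real.pi * r)⁻¹) '' S, Ψ ρ := by
        rw [lintegral_const_mul' _ _ (by finiteness),
          lintegral_image_eq_lintegral_abs_deriv_mul hSm hd hinj]
    _ ≤ ENNReal.ofReal (2 * R) * ∫⁻ ρ, Ψ ρ :=
        mul_le_mul' le_rfl (setLIntegral_le_lintegral _ _)
    _ ≤ ENNReal.ofReal (2 * R) * (C * ENNReal.ofReal (b - a)⁻¹ * (‖u‖ₑ ^ 2 * ‖v‖ₑ ^ 2)) := by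
        refine mul_le_mul' le_rfl (lintegral_chirp_L2_le hC hab hu hv ?_ ?_)
        · exact cut_eq_zero_of sf measurableSet_Icc
        · exact cut_eq_zero_of sg measurableSet_Icc
    _ ≤ ENNReal.ofReal (2 * R) * (C * ENNReal.ofReal (b - a)⁻¹ * (‖f‖ₑ ^ 2 * ‖g‖ₑ ^ 2)) := by
        gcongr
        · exact enorm_cut_le measurableSet_Icc _
        · exact enorm_cut_le measurableSet_Icc _
    _ = _ := by
        rw [ENNReal.coe_mul, ENNReal.ofReal]
        ring

/-! ### Pointwise bounds for the nonlinearity -/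

section Nonlinearity

variable {V : ℝ → ℝ} {γ₁ γ₂ γ₀ c : ℝ}

theorem AssumptionA1.const_nonneg (h : AssumptionA1 V γ₁ γ₂ c) : 0 ≤ c := by
  have := (abs_nonneg _).trans (h.abs_deriv_le 1 one_pos)
  simp only [Real.one_rpow] at this
  linarith

theorem AssumptionA1.abs_sub_le (h : AssumptionA1 V γ₁ γ₂ c) {a b M : ℝ} (ha : 0 ≤ a)
    (haM : a ≤ M) (hb : 0 ≤ b) (hbM : b ≤ M) :
    |V a - V b| ≤ c * (M ^ (γ₁ - 1) + M ^ (γ₂ - 1)) * |a - b| := by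
  wlog hab : b < a generalizing a b
  · rcases (not_lt.1 hab).eq_or_lt with rfl | hlt
    · simp
    · rw [abs_sub_comm, abs_sub_comm a]
      exact this hb hbM ha haM hlt
  have h2 := h.two_le
  have h3 := h.le
  have hc := h.const_nonneg
  obtain ⟨x, hx, hxe⟩ := exists_deriv_eq_slope V hab
    (h.continuousOn.mono fun y hy => hb.trans hy.1)
    (h.differentiableOn.mono fun y hy => lt_of_le_of_lt hb hy.1)
  have hx0 : 0 < x := lt_of_le_of_lt hb hx.1
  have hxM : x ≤ M := hx.2.le.trans haM
  have hne : a - b ≠ 0 := by linarith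
  have e : V a - V b = deriv V x * (a - b) := by rw [hxe]; field_simp
  rw [e, abs_mul]
  refine mul_le_mul_of_nonneg_right ((h.abs_deriv_le x hx0).trans ?_) (abs_nonneg _)
  have e1 : x ^ (γ₁ - 1) ≤ M ^ (γ₁ - 1) := Real.rpow_le_rpow hx0.le hxM (by linarith)
  have e2 : x ^ (γ₂ - 1) ≤ M ^ (γ₂ - 1) := Real.rpow_le_rpow hx0.le hxM (by linarith)
  gcongr

theorem rpow_sub_one_eq {s γ : ℝ} (hs : 0 ≤ s) (hγ : 2 ≤ γ) :
    s ^ (γ - 1) = s ^ (γ - 2) * s := by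
  have : γ - 1 = (γ - 2) + 1 := by ring
  rw [this, Real.rpow_add_of_nonneg hs (by linarith) (by norm_num), Real.rpow_one]

theorem rpow_eq_mul_mul {s γ : ℝ} (hs : 0 ≤ s) (hγ : 2 ≤ γ) :
    s ^ γ = s ^ (γ - 2) * (s * s) := by
  have : γ = (γ - 2) + 1 + 1 := by ring
  conv_lhs => rw [this]
  rw [Real.rpow_add_of_nonneg hs (by linarith) (by norm_num),
    Real.rpow_add_of_nonneg hs (by linarith) (by norm_num), Real.rpow_one, mul_assoc]

theorem AssumptionA1.abs_le (h : AssumptionA1 V γ₁ γ₂ c) {a : ℝ} (ha : 0 ≤ a) :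
    |V a| ≤ c * (a ^ γ₁ + a ^ γ₂) := by
  have h2 := h.two_le
  have h3 := h.le
  have := h.abs_sub_le ha le_rfl le_rfl ha
  rw [h.map_zero, sub_zero, sub_zero, abs_of_nonneg ha] at this
  refine this.trans (le_of_eq ?_)
  rw [rpow_sub_one_eq ha h2, rpow_sub_one_eq ha (h2.trans h3), rpow_eq_mul_mul ha h2,
    rpow_eq_mul_mul ha (h2.trans h3)]
  ring

/-- With `|z₂| ≤ |z₁|`, replacing `z₁ + z₂` by `z₁` costs `s^{γ-1}|z₂|`, and `s ≤ 2|z₁|` converts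
one power of `s`; `V|z₂|` is at most `c` times powers `|z₂|^γ ≤ s^{γ-2}|z₁||z₂|`. The constants add
up to `2 + 1 = 3`. -/
theorem AssumptionA1.abs_add_sub_sub_le (h : AssumptionA1 V γ₁ γ₂ c) (z₁ z₂ : ℂ) :
    |V ‖z₁ + z₂‖ - V ‖z₁‖ - V ‖z₂‖| ≤ 3 * c * ((‖z₁‖ + ‖z₂‖) ^ (γ₁ - 2)
      + (‖z₁‖ + ‖z₂‖) ^ (γ₂ - 2)) * (‖z₁‖ * ‖z₂‖) := by
  wlog hz : ‖z₂‖ ≤ ‖z₁‖ generalizing z₁ z₂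
  · have := this z₂ z₁ (not_le.1 hz).le
    rw [add_comm z₂, add_comm ‖z₂‖, mul_comm ‖z₂‖] at this
    rwa [sub_right_comm] at this
  have hc := h.const_nonneg
  have h2 := h.two_le
  have h3 := h.le
  set s := ‖z₁‖ + ‖z₂‖ with hs
  have n1 := norm_nonneg z₁
  have n2 := norm_nonneg z₂
  have hs0 : 0 ≤ s := by positivity
  have e1 := h.abs_sub_le (norm_nonneg (z₁ + z₂)) (norm_add_le z₁ z₂) n1 (by linarith : _ ≤ s)
  rw [← hs] at e1
  have e2 : |‖z₁ + z₂‖ - ‖z₁‖| ≤ ‖z₂‖ := by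
    have := abs_norm_sub_norm_le (z₁ + z₂) z₁
    simpa using this
  have e3 := h.abs_le n2
  rw [rpow_eq_mul_mul n2 h2, rpow_eq_mul_mul n2 (h2.trans h3)] at e3
  rw [rpow_sub_one_eq hs0 h2, rpow_sub_one_eq hs0 (h2.trans h3)] at e1
  have m1 : ‖z₂‖ ^ (γ₁ - 2) ≤ s ^ (γ₁ - 2) := Real.rpow_le_rpow n2 (by linarith) (by linarith)
  have m2 : ‖z₂‖ ^ (γ₂ - 2) ≤ s ^ (γ₂ - 2) := Real.rpow_le_rpow n2 (by linarith) (by linarith)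
  have p1 : 0 ≤ s ^ (γ₁ - 2) := Real.rpow_nonneg hs0 _
  have p2 : 0 ≤ s ^ (γ₂ - 2) := Real.rpow_nonneg hs0 _
  have q1 : 0 ≤ ‖z₂‖ ^ (γ₁ - 2) := Real.rpow_nonneg n2 _
  have q2 : 0 ≤ ‖z₂‖ ^ (γ₂ - 2) := Real.rpow_nonneg n2 _
  have f1 : |V ‖z₁ + z₂‖ - V ‖z₁‖|
      ≤ c * (s ^ (γ₁ - 2) + s ^ (γ₂ - 2)) * (2 * (‖z₁‖ * ‖z₂‖)) := by
    refine e1.trans ?_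
    have : c * (s ^ (γ₁ - 2) * s + s ^ (γ₂ - 2) * s) * |‖z₁ + z₂‖ - ‖z₁‖|
        = c * (s ^ (γ₁ - 2) + s ^ (γ₂ - 2)) * (s * |‖z₁ + z₂‖ - ‖z₁‖|) := by ring
    rw [this]
    refine mul_le_mul_of_nonneg_left ?_ (by positivity)
    calc s * |‖z₁ + z₂‖ - ‖z₁‖| ≤ (2 * ‖z₁‖) * ‖z₂‖ := by gcongr; linarith
      _ = _ := by ring
  have f2 : |V ‖z₂‖| ≤ c * (s ^ (γ₁ - 2) + s ^ (γ₂ - 2)) * (‖z₁‖ * ‖z₂‖) := by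
    refine e3.trans ?_
    calc c * (‖z₂‖ ^ (γ₁ - 2) * (‖z₂‖ * ‖z₂‖) + ‖z₂‖ ^ (γ₂ - 2) * (‖z₂‖ * ‖z₂‖))
        = c * (‖z₂‖ ^ (γ₁ - 2) + ‖z₂‖ ^ (γ₂ - 2)) * (‖z₂‖ * ‖z₂‖) := by ring
      _ ≤ _ := by gcongr
  calc |V ‖z₁ + z₂‖ - V ‖z₁‖ - V ‖z₂‖| ≤ |V ‖z₁ + z₂‖ - V ‖z₁‖| + |V ‖z₂‖| := abs_sub _ _
    _ ≤ _ := by linarith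

/-- Dropping `z₀` from the sum costs `|z₀|` times the derivative bound; what remains is the two-term
splitting. Each resulting term has a factor that will be small: `z₀`, or the product `z₁ z₂`. -/
theorem AssumptionA1.abs_split_le (h : AssumptionA1 V γ₁ γ₂ c) (z₁ z₀ z₂ : ℂ) :
    |V ‖z₁ + z₀ + z₂‖ - V ‖z₁‖ - V ‖z₂‖| ≤ 3 * c *
      ((‖z₁‖ + ‖z₀‖ + ‖z₂‖) ^ (γ₁ - 2) + (‖z₁‖ + ‖z₀‖ + ‖z₂‖) ^ (γ₂ - 2)) *
      (‖z₀‖ * (‖z₁‖ + ‖z₀‖ + ‖z₂‖) + ‖z₁‖ * ‖z₂‖) := by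
  have hc := h.const_nonneg
  have h2 := h.two_le
  have h3 := h.le
  set s := ‖z₁‖ + ‖z₀‖ + ‖z₂‖ with hs
  have n1 := norm_nonneg z₁
  have n2 := norm_nonneg z₂
  have n0 := norm_nonneg z₀
  have hs0 : 0 ≤ s := by positivity
  have b1 : ‖z₁ + z₀ + z₂‖ ≤ s :=
    (norm_add_le _ _).trans (add_le_add (norm_add_le _ _) le_rfl)
  have b2 : ‖z₁ + z₂‖ ≤ s := (norm_add_le _ _).trans (by linarith)
  have e1 := h.abs_sub_le (norm_nonneg (z₁ + z₀ + z₂)) b1 (norm_nonneg (z₁ + z₂)) b2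
  rw [rpow_sub_one_eq hs0 h2, rpow_sub_one_eq hs0 (h2.trans h3)] at e1
  have e2 : |‖z₁ + z₀ + z₂‖ - ‖z₁ + z₂‖| ≤ ‖z₀‖ := by
    have := abs_norm_sub_norm_le (z₁ + z₀ + z₂) (z₁ + z₂)
    have e : z₁ + z₀ + z₂ - (z₁ + z₂) = z₀ := by ring
    rwa [e] at this
  have p1 : 0 ≤ s ^ (γ₁ - 2) := Real.rpow_nonneg hs0 _
  have p2 : 0 ≤ s ^ (γ₂ - 2) := Real.rpow_nonneg hs0 _
  have e3 := h.abs_add_sub_sub_le z₁ z₂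
  have m1 : (‖z₁‖ + ‖z₂‖) ^ (γ₁ - 2) ≤ s ^ (γ₁ - 2) :=
    Real.rpow_le_rpow (by positivity) (by linarith) (by linarith)
  have m2 : (‖z₁‖ + ‖z₂‖) ^ (γ₂ - 2) ≤ s ^ (γ₂ - 2) :=
    Real.rpow_le_rpow (by positivity) (by linarith) (by linarith)
  have f1 : |V ‖z₁ + z₀ + z₂‖ - V ‖z₁ + z₂‖|
      ≤ 3 * c * (s ^ (γ₁ - 2) + s ^ (γ₂ - 2)) * (‖z₀‖ * s) := by
    refine e1.trans ?_
    have : c * (s ^ (γ₁ - 2) * s + s ^ (γ₂ - 2) * s) * |‖z₁ + z₀ + z₂‖ - ‖z₁ + z₂‖|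
        = c * (s ^ (γ₁ - 2) + s ^ (γ₂ - 2)) * (|‖z₁ + z₀ + z₂‖ - ‖z₁ + z₂‖| * s) := by ring
    rw [this]
    gcongr
    linarith
  have f2 : |V ‖z₁ + z₂‖ - V ‖z₁‖ - V ‖z₂‖|
      ≤ 3 * c * (s ^ (γ₁ - 2) + s ^ (γ₂ - 2)) * (‖z₁‖ * ‖z₂‖) := by
    refine e3.trans ?_
    gcongr
  have e : V ‖z₁ + z₀ + z₂‖ - V ‖z₁‖ - V ‖z₂‖
      = (V ‖z₁ + z₀ + z₂‖ - V ‖z₁ + z₂‖) + (V ‖z₁ + z₂‖ - V ‖z₁‖ - V ‖z₂‖) := by ring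
  rw [e]
  refine (abs_add_le _ _).trans ?_
  rw [mul_add]
  exact add_le_add f1 f2

/-- (A2) says precisely that `V(x) x^{-γ₀}` has nonnegative derivative. No sign of `V` is involved.
-/
theorem AssumptionA2.rpow_mul_le (h : AssumptionA2 V γ₀) {t a : ℝ} (ht : 1 ≤ t) (ha : 0 ≤ a) :
    t ^ γ₀ * V a ≤ V (t * a) := by
  rcases ha.eq_or_lt with rfl | ha
  · simp [h.map_zero]
  have hmono : MonotoneOn (fun x => V x * x ^ (-γ₀)) (Ioi 0) := by
    have hd : ∀ x ∈ Ioi (0 : ℝ), HasDerivAt (fun x => V x * x ^ (-γ₀))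
        (deriv V x * x ^ (-γ₀) + V x * (-γ₀ * x ^ (-γ₀ - 1))) x := fun x hx =>
      ((h.differentiableOn x hx).differentiableAt (Ioi_mem_nhds hx)).hasDerivAt.mul
        (Real.hasDerivAt_rpow_const (Or.inl (ne_of_gt hx)))
    refine monotoneOn_of_deriv_nonneg (convex_Ioi 0)
      (fun x hx => (hd x hx).continuousAt.continuousWithinAt) ?_ ?_
    · rw [interior_Ioi]
      exact fun x hx => (hd x hx).differentiableAt.differentiableWithinAt
    · rw [interior_Ioi]
      intro x hx
      have hx0 : (0 : ℝ) < x := hx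
      rw [(hd x hx).deriv]
      have e : x ^ (-γ₀) = x ^ (-γ₀ - 1) * x := by
        rw [← Real.rpow_add_one hx0.ne']; ring_nf
      rw [e]
      have := h.le_deriv_mul x hx0
      have hp : 0 ≤ x ^ (-γ₀ - 1) := Real.rpow_nonneg hx0.le _
      nlinarith
  have ht0 : 0 < t := by linarith
  have := hmono (mem_Ioi.2 ha) (mem_Ioi.2 (mul_pos ht0 ha)) (by nlinarith)
  simp only at this
  rw [Real.mul_rpow ht0.le ha.le, Real.rpow_neg ht0.le, Real.rpow_neg ha.le] at this
  have hta : 0 < t ^ γ₀ := Real.rpow_pos_of_pos ht0 _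
  have haa : 0 < a ^ γ₀ := Real.rpow_pos_of_pos ha _
  have e1 : V (t * a) * ((t ^ γ₀)⁻¹ * (a ^ γ₀)⁻¹) = (V (t * a) / t ^ γ₀) * (a ^ γ₀)⁻¹ := by
    field_simp
  rw [e1] at this
  have := le_of_mul_le_mul_right this (inv_pos.2 haa)
  rw [le_div_iff₀ hta] at this
  linarith

theorem AssumptionA1.continuous_comp_norm (h : AssumptionA1 V γ₁ γ₂ c) :
    Continuous fun z : ℂ => V ‖z‖ :=
  h.continuousOn.comp_continuous continuous_norm fun z => norm_nonneg z

theorem enorm_eq_ofReal_abs (x : ℝ) : ‖x‖ₑ = ENNReal.ofReal |x| := by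
  rw [← ofReal_norm, Real.norm_eq_abs]

theorem AssumptionA1.enorm_le (h : AssumptionA1 V γ₁ γ₂ c) (z : ℂ) :
    ‖V ‖z‖‖ₑ ≤ ENNReal.ofReal c * (‖z‖ₑ ^ γ₁ + ‖z‖ₑ ^ γ₂) := by
  have h2 := h.two_le
  have h3 := h.le
  rw [enorm_eq_ofReal_abs, ← ofReal_norm, ENNReal.ofReal_rpow_of_nonneg (norm_nonneg z)
    (by linarith), ENNReal.ofReal_rpow_of_nonneg (norm_nonneg z) (by linarith),
    ← ENNReal.ofReal_add (by positivity) (by positivity), ← ENNReal.ofReal_mul h.const_nonneg]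
  exact ENNReal.ofReal_le_ofReal (h.abs_le (norm_nonneg z))

theorem AssumptionA1.enorm_split_le (h : AssumptionA1 V γ₁ γ₂ c) (z₁ z₀ z₂ : ℂ) :
    ‖V ‖z₁ + z₀ + z₂‖ - V ‖z₁‖ - V ‖z₂‖‖ₑ ≤ ENNReal.ofReal (3 * c) *
      ((‖z₁‖ₑ + ‖z₀‖ₑ + ‖z₂‖ₑ) ^ (γ₁ - 2) + (‖z₁‖ₑ + ‖z₀‖ₑ + ‖z₂‖ₑ) ^ (γ₂ - 2)) *
      (‖z₀‖ₑ * (‖z₁‖ₑ + ‖z₀‖ₑ + ‖z₂‖ₑ) + ‖z₁‖ₑ * ‖z₂‖ₑ) := by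
  have h2 := h.two_le
  have h3 := h.le
  have hc := h.const_nonneg
  have n1 := norm_nonneg z₁
  have n2 := norm_nonneg z₂
  have n0 := norm_nonneg z₀
  rw [enorm_eq_ofReal_abs, ← ofReal_norm z₁, ← ofReal_norm z₀, ← ofReal_norm z₂,
    ← ENNReal.ofReal_add n1 n0, ← ENNReal.ofReal_add (by positivity) n2,
    ENNReal.ofReal_rpow_of_nonneg (by positivity) (by linarith),
    ENNReal.ofReal_rpow_of_nonneg (by positivity) (by linarith),
    ← ENNReal.ofReal_add (by positivity) (by positivity),
    ← ENNReal.ofReal_mul (by positivity), ← ENNReal.ofReal_mul (by positivity),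
    ← ENNReal.ofReal_mul (by positivity), ← ENNReal.ofReal_add (by positivity) (by positivity),
    ← ENNReal.ofReal_mul (by positivity)]
  exact ENNReal.ofReal_le_ofReal (h.abs_split_le z₁ z₀ z₂)

/-! ### Convergence and splitting of the nonlocal term -/

theorem measurable_integral_jointRep (h : AssumptionA1 V γ₁ γ₂ c) {f : L2} {u : ℝ × ℝ → ℂ}
    (hu : JointRep f u) : StronglyMeasurable fun r => ∫ x, V ‖T r f x‖ := by
  have e : (fun r => ∫ x, V ‖T r f x‖) = fun r => ∫ x, V ‖u (r, x)‖ := by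
    funext r
    refine integral_congr_ae ?_
    filter_upwards [hu.2 r] with x hx
    rw [hx]
  rw [e]
  exact StronglyMeasurable.integral_prod_right (f := fun r x => V ‖u (r, x)‖)
    (h.continuous_comp_norm.measurable.comp hu.1).stronglyMeasurable

theorem measurable_integral_abs_jointRep (h : AssumptionA1 V γ₁ γ₂ c) {f : L2} {u : ℝ × ℝ → ℂ}
    (hu : JointRep f u) : StronglyMeasurable fun r => ∫ x, |V ‖T r f x‖| := by
  have e : (fun r => ∫ x, |V ‖T r f x‖|) = fun r => ∫ x, |V ‖u (r, x)‖| := by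
    funext r
    refine integral_congr_ae ?_
    filter_upwards [hu.2 r] with x hx
    rw [hx]
  rw [e]
  exact StronglyMeasurable.integral_prod_right (f := fun r x => |V ‖u (r, x)‖|)
    (h.continuous_comp_norm.abs.measurable.comp hu.1).stronglyMeasurable

theorem nConverges_of_lintegral (h : AssumptionA1 V γ₁ γ₂ c) {ψ : ℝ → ℝ}
    (hψ : AEStronglyMeasurable ψ) {f : L2}
    (h1 : ∀ᵐ r, ∫⁻ x, (‖T r f x‖ₑ ^ γ₁ + ‖T r f x‖ₑ ^ γ₂) < ⊤)
    (h2 : ∫⁻ r, (∫⁻ x, (‖T r f x‖ₑ ^ γ₁ + ‖T r f x‖ₑ ^ γ₂)) * ‖ψ r‖ₑ < ⊤) :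
    NConverges V ψ f := by
  obtain ⟨u, hu⟩ := exists_jointRep f
  have hb : ∀ r, ∫⁻ x, ‖V ‖T r f x‖‖ₑ
      ≤ ENNReal.ofReal c * ∫⁻ x, (‖T r f x‖ₑ ^ γ₁ + ‖T r f x‖ₑ ^ γ₂) := fun r => by
    rw [← lintegral_const_mul' _ _ (by finiteness)]
    exact lintegral_mono fun x => h.enorm_le _
  have hfin : ∫⁻ r, (∫⁻ x, ‖V ‖T r f x‖‖ₑ) * ‖ψ r‖ₑ < ⊤ := by
    refine lt_of_le_of_lt (lintegral_mono fun r => mul_le_mul' (hb r) le_rfl) ?_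
    simp_rw [mul_assoc]
    rw [lintegral_const_mul' _ _ (by finiteness)]
    exact ENNReal.mul_lt_top (by finiteness) h2
  refine ⟨?_, ⟨?_, ?_⟩, ⟨?_, ?_⟩⟩
  · filter_upwards [h1] with r hr
    refine ⟨(h.continuous_comp_norm.comp_aestronglyMeasurable (Lp.aestronglyMeasurable _)), ?_⟩
    exact lt_of_le_of_lt (hb r) (ENNReal.mul_lt_top (by finiteness) hr)
  · exact (measurable_integral_jointRep h hu).aestronglyMeasurable.mul hψ
  · refine lt_of_le_of_lt (lintegral_mono fun r => ?_) hfin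
    rw [enorm_mul]
    exact mul_le_mul' (enorm_integral_le_lintegral_enorm _) le_rfl
  · exact (measurable_integral_abs_jointRep h hu).aestronglyMeasurable.mul hψ
  · refine lt_of_le_of_lt (lintegral_mono fun r => ?_) hfin
    rw [enorm_mul]
    refine mul_le_mul' ((enorm_integral_le_lintegral_enorm _).trans (le_of_eq ?_)) le_rfl
    simp

theorem N_split_le {ψ : ℝ → ℝ} {f f₁ f₂ : L2} (hf : NConverges V ψ f) (hf₁ : NConverges V ψ f₁)
    (hf₂ : NConverges V ψ f₂) :
    ENNReal.ofReal (N V ψ f - N V ψ f₁ - N V ψ f₂)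
      ≤ ∫⁻ r, (∫⁻ x, ‖V ‖T r f x‖ - V ‖T r f₁ x‖ - V ‖T r f₂ x‖‖ₑ) * ‖ψ r‖ₑ := by
  have e : N V ψ f - N V ψ f₁ - N V ψ f₂
      = ∫ r, (∫ x, (V ‖T r f x‖ - V ‖T r f₁ x‖ - V ‖T r f₂ x‖)) * ψ r := by
    have i1 : Integrable fun r => (∫ x, V ‖T r f x‖) * ψ r - (∫ x, V ‖T r f₁ x‖) * ψ r :=
      hf.2.1.sub hf₁.2.1
    rw [N, N, N, ← integral_sub hf.2.1 hf₁.2.1, ← integral_sub i1 hf₂.2.1]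
    refine integral_congr_ae ?_
    filter_upwards [hf.1, hf₁.1, hf₂.1] with r h h1 h2
    have i2 : Integrable fun x => V ‖T r f x‖ - V ‖T r f₁ x‖ := h.sub h1
    rw [integral_sub i2 h2, integral_sub h h1]
    ring
  calc ENNReal.ofReal (N V ψ f - N V ψ f₁ - N V ψ f₂) ≤ ‖N V ψ f - N V ψ f₁ - N V ψ f₂‖ₑ := by
        rw [enorm_eq_ofReal_abs]
        exact ENNReal.ofReal_le_ofReal (le_abs_self _)
    _ ≤ _ := by
        rw [e]
        refine (enorm_integral_le_lintegral_enorm _).trans (lintegral_mono fun r => ?_)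
        rw [enorm_mul]
        exact mul_le_mul' (enorm_integral_le_lintegral_enorm _) le_rfl

end Nonlinearity

/-! ### Space-time Hölder estimates -/

/-- Space-time bounds shared by (sums of absolute values of) Schrödinger waves of size `a`. -/
structure StrichartzBound (C : ℝ≥0) (W : ℝ × ℝ → ℝ≥0∞) (a : ℝ≥0∞) : Prop where
  measurable : Measurable W
  sq_le : ∀ r, ∫⁻ x, W (r, x) ^ 2 ≤ a ^ 2
  six_le : ∫⁻ p, W p ^ 6 ≤ C * a ^ 6

theorem lintegral_holder_three {α : Type*} [MeasurableSpace α] {μ : Measure α}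
    {f g h : α → ℝ≥0∞} (hf : AEMeasurable f μ) (hg : AEMeasurable g μ) (hh : AEMeasurable h μ)
    {p q s : ℝ} (hp : 0 ≤ p) (hq : 0 ≤ q) (hs : 0 ≤ s) (hpqs : p + q + s = 1) :
    ∫⁻ a, f a ^ p * g a ^ q * h a ^ s ∂μ
      ≤ (∫⁻ a, f a ∂μ) ^ p * (∫⁻ a, g a ∂μ) ^ q * (∫⁻ a, h a ∂μ) ^ s := by
  have := ENNReal.lintegral_prod_norm_pow_le (μ := μ) Finset.univ (f := ![f, g, h])
    (p := ![p, q, s])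
    (by intro i _; fin_cases i <;> simpa) (by simpa [Fin.sum_univ_three] using hpqs)
    (by intro i _; fin_cases i <;> simpa)
  simpa [Fin.prod_univ_three] using this

/-- Hölder with three factors: `Q²` to the power `θ/2`, the mass density `W² Ψ^β` to the power
`(6-γ-θ)/4`, and `W⁶` to the power `(γ-2-θ)/4`. These powers add up to `1`, and `β = 4/(6-γ-θ)` is
the exponent for which `Ψ` appears to the first power; for `θ = 2α(γ,τ)` it is `β(γ,τ)`. -/
theorem StrichartzBound.lintegral_le {C : ℝ≥0} {W : ℝ × ℝ → ℝ≥0∞} {a : ℝ≥0∞}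
    (hW : StrichartzBound C W a) {Q : ℝ × ℝ → ℝ≥0∞} (hQ : Measurable Q) {q : ℝ≥0∞}
    (hq : ∫⁻ p, Q p ^ 2 ≤ q) {Ψ : ℝ → ℝ≥0∞} (hΨ : AEMeasurable Ψ) {B : ℝ≥0} {γ θ : ℝ}
    (hθ : 0 ≤ θ) (hθγ : θ ≤ γ - 2) (hθ6 : θ < 6 - γ)
    (hB : ∫⁻ r, Ψ r ^ (4 / (6 - γ - θ)) ≤ B) :
    ∫⁻ p, Q p ^ θ * W p ^ (γ - 2 * θ) * Ψ p.1
      ≤ q ^ (θ / 2) * ((B : ℝ≥0∞) ^ ((6 - γ - θ) / 4) * (C : ℝ≥0∞) ^ ((γ - 2 - θ) / 4))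
        * a ^ (γ - 2 * θ) := by
  have h4 : 0 < 6 - γ - θ := by linarith
  set β := 4 / (6 - γ - θ) with hβ
  have hβ0 : 0 < β := by positivity
  have hβi : β * ((6 - γ - θ) / 4) = 1 := by rw [hβ]; field_simp
  have hΨ1 : AEMeasurable (fun p : ℝ × ℝ => Ψ p.1) := hΨ.comp_fst
  have hpt : ∀ p : ℝ × ℝ, Q p ^ θ * W p ^ (γ - 2 * θ) * Ψ p.1
      = (Q p ^ 2) ^ (θ / 2) * (W p ^ 2 * Ψ p.1 ^ β) ^ ((6 - γ - θ) / 4)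
        * (W p ^ 6) ^ ((γ - 2 - θ) / 4) := by
    intro p
    rw [ENNReal.mul_rpow_of_nonneg _ _ (by positivity), ← ENNReal.rpow_natCast,
      ← ENNReal.rpow_natCast, ← ENNReal.rpow_natCast, ← ENNReal.rpow_mul, ← ENNReal.rpow_mul,
      ← ENNReal.rpow_mul, ← ENNReal.rpow_mul, hβi, ENNReal.rpow_one]
    have e1 : ((2 : ℕ) : ℝ) * (θ / 2) = θ := by push_cast; ring
    have e2 : γ - 2 * θ = ((2 : ℕ) : ℝ) * ((6 - γ - θ) / 4)
      + ((6 : ℕ) : ℝ) * ((γ - 2 - θ) / 4) := by push_cast; ring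
    rw [e1, e2, ENNReal.rpow_add_of_nonneg _ _ (by positivity)
      (mul_nonneg (by positivity) (by linarith))]
    ring
  simp_rw [hpt]
  have mWΨ : AEMeasurable (fun p : ℝ × ℝ => W p ^ 2 * Ψ p.1 ^ β) :=
    (hW.measurable.pow_const 2).aemeasurable.mul (hΨ1.pow_const β)
  refine (lintegral_holder_three (hQ.pow_const 2).aemeasurable mWΨ
    (hW.measurable.pow_const 6).aemeasurable (by linarith) (by linarith) (by linarith)
    (by ring)).trans ?_
  have hmid : ∫⁻ p : ℝ × ℝ, W p ^ 2 * Ψ p.1 ^ β ≤ a ^ 2 * B := by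
    rw [Measure.volume_eq_prod, lintegral_prod _ mWΨ]
    calc ∫⁻ r, ∫⁻ x, W (r, x) ^ 2 * Ψ r ^ β = ∫⁻ r, (∫⁻ x, W (r, x) ^ 2) * Ψ r ^ β := by
          refine lintegral_congr fun r => lintegral_mul_const _ ?_
          exact (hW.measurable.comp measurable_prodMk_left).pow_const 2
      _ ≤ ∫⁻ r, a ^ 2 * Ψ r ^ β := lintegral_mono fun r => mul_le_mul' (hW.sq_le r) le_rfl
      _ = a ^ 2 * ∫⁻ r, Ψ r ^ β := lintegral_const_mul'' _ (hΨ.pow_const β)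
      _ ≤ _ := mul_le_mul' le_rfl hB
  calc _ ≤ q ^ (θ / 2) * (a ^ 2 * B) ^ ((6 - γ - θ) / 4) * (C * a ^ 6) ^ ((γ - 2 - θ) / 4) := by
        have := hW.six_le
        have h1 : 0 ≤ (γ - 2 - θ) / 4 := by linarith
        gcongr
    _ = _ := by
        have h1 : 0 ≤ (γ - 2 - θ) / 4 := by linarith
        have e2 : γ - 2 * θ = ((2 : ℕ) : ℝ) * ((6 - γ - θ) / 4)
          + ((6 : ℕ) : ℝ) * ((γ - 2 - θ) / 4) := by push_cast; ring
        rw [ENNReal.mul_rpow_of_nonneg _ _ (by positivity), ENNReal.mul_rpow_of_nonneg _ _ h1,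
          e2, ENNReal.rpow_add_of_nonneg _ _ (by positivity) (by positivity), ENNReal.rpow_mul,
          ENNReal.rpow_mul, ENNReal.rpow_natCast, ENNReal.rpow_natCast]
        ring

theorem StrichartzBound.lintegral_rpow_le {C : ℝ≥0} {W : ℝ × ℝ → ℝ≥0∞} {a : ℝ≥0∞}
    (hW : StrichartzBound C W a) {Ψ : ℝ → ℝ≥0∞} (hΨ : AEMeasurable Ψ) {B : ℝ≥0} {γ : ℝ}
    (hγ : 2 ≤ γ) (hγ6 : γ < 6) (hB : ∫⁻ r, Ψ r ^ (4 / (6 - γ)) ≤ B) :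
    ∫⁻ p, W p ^ γ * Ψ p.1
      ≤ (B : ℝ≥0∞) ^ ((6 - γ) / 4) * (C : ℝ≥0∞) ^ ((γ - 2) / 4) * a ^ γ := by
  have := hW.lintegral_le (Q := fun _ => 0) measurable_const (q := 0) (by simp) hΨ
    (B := B) (θ := 0) (γ := γ) le_rfl (by linarith) (by linarith) (by simpa using hB)
  simpa using this

/-- Hölder's inequality for one small factor. -/
theorem StrichartzBound.lintegral_mul_rpow_le {C : ℝ≥0} {U W : ℝ × ℝ → ℝ≥0∞} {a₀ a : ℝ≥0∞}
    (hU : StrichartzBound C U a₀) (hW : StrichartzBound C W a) {Ψ : ℝ → ℝ≥0∞}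
    (hΨ : AEMeasurable Ψ) {B : ℝ≥0} {γ : ℝ}
    (hγ : 2 ≤ γ) (hγ6 : γ < 6) (hB : ∫⁻ r, Ψ r ^ (4 / (6 - γ)) ≤ B) :
    ∫⁻ p, U p * W p ^ (γ - 1) * Ψ p.1
      ≤ (B : ℝ≥0∞) ^ ((6 - γ) / 4) * (C : ℝ≥0∞) ^ ((γ - 2) / 4) * (a₀ * a ^ (γ - 1)) := by
  have hγ0 : 0 < γ := by linarith
  have hΨ1 : AEMeasurable (fun p : ℝ × ℝ => Ψ p.1) := hΨ.comp_fst
  have hs : 1 / γ + (1 - 1 / γ) = 1 := by ring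
  have hq : 0 ≤ 1 - 1 / γ := by
    rw [sub_nonneg, div_le_one hγ0]; linarith
  have hp : 0 ≤ 1 / γ := by positivity
  have e1 : γ * (1 / γ) = 1 := by field_simp
  have e2 : γ * (1 - 1 / γ) = γ - 1 := by field_simp
  have one : ∀ t : ℝ≥0∞, t ^ (1 / γ) * t ^ (1 - 1 / γ) = t := fun t => by
    rw [← ENNReal.rpow_add_of_nonneg _ _ hp hq, hs, ENNReal.rpow_one]
  have hpt : ∀ p : ℝ × ℝ, U p * W p ^ (γ - 1) * Ψ p.1
      = (U p ^ γ * Ψ p.1) ^ (1 / γ) * (W p ^ γ * Ψ p.1) ^ (1 - 1 / γ) := by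
    intro p
    rw [ENNReal.mul_rpow_of_nonneg _ _ hp, ENNReal.mul_rpow_of_nonneg _ _ hq, ← ENNReal.rpow_mul,
      ← ENNReal.rpow_mul, e1, e2, ENNReal.rpow_one]
    conv_lhs => rw [← one (Ψ p.1)]
    ring
  simp_rw [hpt]
  set D : ℝ≥0∞ := (B : ℝ≥0∞) ^ ((6 - γ) / 4) * (C : ℝ≥0∞) ^ ((γ - 2) / 4) with hD
  calc _ ≤ (∫⁻ p, U p ^ γ * Ψ p.1) ^ (1 / γ) * (∫⁻ p, W p ^ γ * Ψ p.1) ^ (1 - 1 / γ) :=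
        ENNReal.lintegral_mul_norm_pow_le ((hU.measurable.pow_const γ).aemeasurable.mul hΨ1)
          ((hW.measurable.pow_const γ).aemeasurable.mul hΨ1) hp hq hs
    _ ≤ (D * a₀ ^ γ) ^ (1 / γ) * (D * a ^ γ) ^ (1 - 1 / γ) := by
        have h1 := hU.lintegral_rpow_le hΨ hγ hγ6 hB
        have h2 := hW.lintegral_rpow_le hΨ hγ hγ6 hB
        gcongr
    _ = _ := by
        rw [ENNReal.mul_rpow_of_nonneg _ _ hp, ENNReal.mul_rpow_of_nonneg _ _ hq,
          ← ENNReal.rpow_mul, ← ENNReal.rpow_mul, e1, e2, ENNReal.rpow_one]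
        conv_rhs => rw [← one D]
        ring

/-- The off-diagonal term, with the gain coming from an `L²` bilinear bound. -/
theorem StrichartzBound.lintegral_mul_mul_rpow_le {C : ℝ≥0} {U₁ U₂ W : ℝ × ℝ → ℝ≥0∞} {a : ℝ≥0∞}
    (hW : StrichartzBound C W a) (hU₁ : Measurable U₁) (hU₂ : Measurable U₂)
    (hU₁W : ∀ p, U₁ p ≤ W p) (hU₂W : ∀ p, U₂ p ≤ W p) {R : ℝ} {q : ℝ≥0∞}
    (hq : ∫⁻ r in Icc (-R) R, ∫⁻ x, (U₁ (r, x) * U₂ (r, x)) ^ 2 ≤ q) {Ψ : ℝ → ℝ≥0∞}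
    (hΨ : AEMeasurable Ψ) (hΨR : ∀ᵐ r, R < |r| → Ψ r = 0) {B : ℝ≥0} {γ θ : ℝ}
    (hθ : 0 ≤ θ) (hθ1 : θ ≤ 1) (hθγ : θ ≤ γ - 2) (hθ6 : θ < 6 - γ)
    (hB : ∫⁻ r, Ψ r ^ (4 / (6 - γ - θ)) ≤ B) :
    ∫⁻ p, U₁ p * U₂ p * W p ^ (γ - 2) * Ψ p.1
      ≤ q ^ (θ / 2) * ((B : ℝ≥0∞) ^ ((6 - γ - θ) / 4) * (C : ℝ≥0∞) ^ ((γ - 2 - θ) / 4))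
        * a ^ (γ - 2 * θ) := by
  -- The bilinear bound is known only for `|r| ≤ R`; restricting the product to that strip loses
  -- nothing because `Ψ` vanishes outside.
  set Q : ℝ × ℝ → ℝ≥0∞ := (Icc (-R) R ×ˢ univ).indicator fun p => U₁ p * U₂ p with hQ
  have hS : MeasurableSet ((Icc (-R) R : Set ℝ) ×ˢ (univ : Set ℝ)) :=
    measurableSet_Icc.prod MeasurableSet.univ
  have mU : Measurable fun p => (U₁ p * U₂ p) ^ 2 := (hU₁.mul hU₂).pow_const 2
  have mQ : Measurable Q := (hU₁.mul hU₂).indicator hS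
  have hQq : ∫⁻ p, Q p ^ 2 ≤ q := by
    refine le_trans (le_of_eq ?_) hq
    have e : (fun p => Q p ^ 2) = (Icc (-R) R ×ˢ univ).indicator fun p => (U₁ p * U₂ p) ^ 2 := by
      funext p
      by_cases hp : p ∈ (Icc (-R) R : Set ℝ) ×ˢ (univ : Set ℝ) <;> simp [hQ, hp]
    rw [e, lintegral_indicator hS, Measure.volume_eq_prod, ← Measure.prod_restrict,
      Measure.restrict_univ, lintegral_prod _ mU.aemeasurable]
  refine le_trans (lintegral_mono_ae ?_) (hW.lintegral_le mQ hQq hΨ hθ hθγ hθ6 hB)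
  have hΨR' : ∀ᵐ p : ℝ × ℝ, R < |p.1| → Ψ p.1 = 0 := by
    rw [Measure.volume_eq_prod]
    exact Measure.quasiMeasurePreserving_fst.ae hΨR
  filter_upwards [hΨR'] with p hp
  by_cases hpR : R < |p.1|
  · rw [hp hpR]; simp
  · have hmem : p ∈ (Icc (-R) R : Set ℝ) ×ˢ (univ : Set ℝ) := ⟨abs_le.1 (not_lt.1 hpR), trivial⟩
    have hQp : Q p = U₁ p * U₂ p := by rw [hQ, indicator_of_mem hmem]
    rw [hQp]
    refine mul_le_mul' ?_ le_rfl
    -- Only the power `θ` of the product uses the bilinear gain; the rest is given away to `W`,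
    -- since the full power would leave too few powers of `W` when `γ` is near `2` and too large a
    -- time exponent when `γ` is near `6`.
    have h1 : U₁ p * U₂ p = (U₁ p * U₂ p) ^ θ * (U₁ p * U₂ p) ^ (1 - θ) := by
      rw [← ENNReal.rpow_add_of_nonneg _ _ hθ (by linarith)]
      simp
    have h2 : (U₁ p * U₂ p) ^ (1 - θ) ≤ W p ^ (2 * (1 - θ)) := by
      rw [ENNReal.rpow_mul]
      refine ENNReal.rpow_le_rpow ?_ (by linarith)
      rw [ENNReal.rpow_two, sq]
      exact mul_le_mul' (hU₁W p) (hU₂W p)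
    calc U₁ p * U₂ p * W p ^ (γ - 2)
        ≤ (U₁ p * U₂ p) ^ θ * W p ^ (2 * (1 - θ)) * W p ^ (γ - 2) := by
          conv_lhs => rw [h1]
          gcongr
      _ = _ := by
          rw [mul_assoc, ← ENNReal.rpow_add_of_nonneg _ _ (by linarith) (by linarith)]
          congr 2
          ring

/-- On the support `|ψ|^{β'} ≤ 1 + |ψ|^β`, and the `1` integrates to at most `2R`. One norm bound at
the largest exponent thus controls all the exponents that occur. -/
theorem lintegral_rpow_density_le {ψ : ℝ → ℝ} {R β β' : ℝ} {K : ℝ≥0} (hβ' : 0 < β')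
    (hββ' : β' ≤ β) (h : AdmissibleDensity ψ (ENNReal.ofReal β) R K) :
    ∫⁻ r, ‖ψ r‖ₑ ^ β' ≤ (Real.toNNReal (2 * R) + K ^ β : ℝ≥0) := by
  have hβ : 0 < β := hβ'.trans_le hββ'
  have h1 : ∫⁻ r, ‖ψ r‖ₑ ^ β ≤ (K : ℝ≥0∞) ^ β := by
    have := h.norm_le
    rw [eLpNorm_eq_lintegral_rpow_enorm_toReal (by simpa using hβ) (by simp),
      ENNReal.toReal_ofReal hβ.le] at this
    rw [one_div, ENNReal.rpow_inv_le_iff hβ] at this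
    exact this
  calc ∫⁻ r, ‖ψ r‖ₑ ^ β' ≤ ∫⁻ r, ((Icc (-R) R).indicator 1 r + ‖ψ r‖ₑ ^ β) := by
        refine lintegral_mono_ae ?_
        filter_upwards [h.support] with r hr
        by_cases hR : R < |r|
        · rw [hr hR]; simp [hβ']
        · have hmem : r ∈ Icc (-R) R := abs_le.1 (not_lt.1 hR)
          rw [indicator_of_mem hmem, Pi.one_apply]
          rcases le_total ‖ψ r‖ₑ 1 with h2 | h2
          · exact (ENNReal.rpow_le_one h2 hβ'.le).trans le_self_add
          · exact (ENNReal.rpow_le_rpow_of_exponent_le h2 hββ').trans le_add_self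
    _ = volume (Icc (-R) R) + ∫⁻ r, ‖ψ r‖ₑ ^ β := by
        rw [lintegral_add_left (measurable_one.indicator measurableSet_Icc),
          lintegral_indicator_one measurableSet_Icc]
    _ ≤ _ := by
        rw [ENNReal.coe_add, ENNReal.coe_rpow_of_nonneg _ hβ.le, Real.volume_Icc, ENNReal.ofReal]
        refine add_le_add (le_of_eq ?_) h1
        congr 2; ring

/-! ### Strichartz bounds for waves and sums of waves -/

theorem strichartzBound_of_jointRep {C : ℝ≥0}
    (hC : ∀ f : L2, ∫⁻ r, ∫⁻ x, ‖T r f x‖ₑ ^ 6 ≤ C * ‖f‖ₑ ^ 6) {f : L2} {u : ℝ × ℝ → ℂ}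
    (hu : JointRep f u) {a : ℝ≥0∞} (ha : ‖f‖ₑ ≤ a) : StrichartzBound C (fun p => ‖u p‖ₑ) a := by
  have hk : ∀ r, ∀ k : ℕ, ∫⁻ x, ‖u (r, x)‖ₑ ^ k = ∫⁻ x, ‖T r f x‖ₑ ^ k := fun r k => by
    refine lintegral_congr_ae ?_
    filter_upwards [hu.2 r] with x hx
    rw [hx]
  refine ⟨hu.1.enorm, fun r => ?_, ?_⟩
  · rw [hk, ← enorm_sq_eq_lintegral, enorm_T]
    gcongr
  · rw [Measure.volume_eq_prod, lintegral_prod _ (hu.1.enorm.pow_const 6).aemeasurable]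
    simp_rw [hk]
    refine (hC f).trans ?_
    gcongr

theorem add_add_pow_le (x y z : ℝ≥0∞) (k : ℕ) :
    (x + y + z) ^ k ≤ 3 ^ k * (x ^ k + y ^ k + z ^ k) := by
  have key : ∀ m : ℝ≥0∞, x ≤ m → y ≤ m → z ≤ m → m ^ k ≤ x ^ k + y ^ k + z ^ k →
      (x + y + z) ^ k ≤ 3 ^ k * (x ^ k + y ^ k + z ^ k) := by
    intro m hx hy hz hm
    calc (x + y + z) ^ k ≤ (3 * m) ^ k := by
          refine pow_le_pow_left' ((add_le_add (add_le_add hx hy) hz).trans (le_of_eq ?_)) k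
          ring
      _ = 3 ^ k * m ^ k := mul_pow _ _ _
      _ ≤ _ := by gcongr
  rcases le_total x y with h1 | h1
  · rcases le_total y z with h2 | h2
    · exact key z (h1.trans h2) h2 le_rfl le_add_self
    · exact key y h1 le_rfl h2 (le_add_self.trans le_self_add)
  · rcases le_total x z with h2 | h2
    · exact key z h2 (h1.trans h2) le_rfl le_add_self
    · exact key x le_rfl h1 h2 (le_self_add.trans le_self_add)

/-- The factor `9` is generous: the crude power inequality gives `27 ≤ 9²` and `2187 ≤ 9⁶`, so both
bounds keep their form with the same `C`. -/
theorem StrichartzBound.add_add {C : ℝ≥0} {U₁ U₀ U₂ : ℝ × ℝ → ℝ≥0∞} {a : ℝ≥0∞}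
    (h₁ : StrichartzBound C U₁ a) (h₀ : StrichartzBound C U₀ a) (h₂ : StrichartzBound C U₂ a) :
    StrichartzBound C (fun p => U₁ p + U₀ p + U₂ p) (9 * a) := by
  have m₁ := h₁.measurable
  have m₀ := h₀.measurable
  have m₂ := h₂.measurable
  refine ⟨by fun_prop, fun r => ?_, ?_⟩
  · have n₁ : Measurable fun x => U₁ (r, x) := m₁.comp measurable_prodMk_left
    have n₀ : Measurable fun x => U₀ (r, x) := m₀.comp measurable_prodMk_left
    have n₂ : Measurable fun x => U₂ (r, x) := m₂.comp measurable_prodMk_left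
    calc ∫⁻ x, (U₁ (r, x) + U₀ (r, x) + U₂ (r, x)) ^ 2
        ≤ ∫⁻ x, 3 ^ 2 * (U₁ (r, x) ^ 2 + U₀ (r, x) ^ 2 + U₂ (r, x) ^ 2) :=
          lintegral_mono fun x => add_add_pow_le _ _ _ 2
      _ ≤ 3 ^ 2 * (a ^ 2 + a ^ 2 + a ^ 2) := by
          rw [lintegral_const_mul' _ _ (by finiteness), lintegral_add_left (by fun_prop),
            lintegral_add_left (by fun_prop)]
          gcongr
          exacts [h₁.sq_le r, h₀.sq_le r, h₂.sq_le r]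
      _ = 27 * a ^ 2 := by ring
      _ ≤ 81 * a ^ 2 := by gcongr; norm_num
      _ = _ := by ring
  · calc ∫⁻ p, (U₁ p + U₀ p + U₂ p) ^ 6
        ≤ ∫⁻ p, 3 ^ 6 * (U₁ p ^ 6 + U₀ p ^ 6 + U₂ p ^ 6) :=
          lintegral_mono fun x => add_add_pow_le _ _ _ 6
      _ ≤ 3 ^ 6 * (C * a ^ 6 + C * a ^ 6 + C * a ^ 6) := by
          rw [lintegral_const_mul' _ _ (by finiteness), lintegral_add_left (by fun_prop),
            lintegral_add_left (by fun_prop)]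
          gcongr
          exacts [h₁.six_le, h₀.six_le, h₂.six_le]
      _ = 2187 * (C * a ^ 6) := by ring
      _ ≤ 531441 * (C * a ^ 6) := by gcongr; norm_num
      _ = _ := by ring

/-! ### Weak derivatives on the Fourier side -/

theorem derivCLM_eq_lineDerivOp (F : TemperedDistribution ℝ ℂ) :
    TemperedDistribution.derivCLM ℂ F = LineDeriv.lineDerivOp (1 : ℝ) F := by
  ext φ
  rw [TemperedDistribution.derivCLM_apply_apply, TemperedDistribution.lineDerivOp_apply_apply]
  congr 1

theorem toTemperedDistribution_injective {f g : L2}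
    (h : Lp.toTemperedDistribution f = Lp.toTemperedDistribution g) : f = g := by
  have hk := Lp.ker_toTemperedDistributionCLM_eq_bot (F := ℂ) (μ := (volume : Measure ℝ)) (p := 2)
  exact LinearMap.ker_eq_bot.1 hk h

theorem isWeakDeriv_iff_forall_integral {f g : L2} : IsWeakDeriv f g ↔
    ∀ φ : SchwartzMap ℝ ℂ, ∫ ξ, (2 * Real.pi * Complex.I * ξ) * φ ξ * (𝓕 f : L2) ξ
      = ∫ ξ, φ ξ * (𝓕 g : L2) ξ := by
  have e1 : ∀ φ : SchwartzMap ℝ ℂ,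
      𝓕 (TemperedDistribution.derivCLM ℂ (Lp.toTemperedDistribution f)) φ
        = ∫ ξ, (2 * Real.pi * Complex.I * ξ) * φ ξ * (𝓕 f : L2) ξ := by
    intro φ
    rw [derivCLM_eq_lineDerivOp, TemperedDistribution.fourier_lineDerivOp_eq,
      Lp.fourier_toTemperedDistribution_eq, smul_apply,
      TemperedDistribution.smulLeftCLM_apply_apply, Lp.toTemperedDistribution_apply]
    rw [smul_eq_mul, ← integral_const_mul]
    refine integral_congr_ae (Filter.Eventually.of_forall fun ξ => ?_)
    simp only [smul_eq_mul]
    rw [SchwartzMap.smulLeftCLM_apply_apply (by fun_prop)]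
    simp
    ring
  have e2 : ∀ φ : SchwartzMap ℝ ℂ, 𝓕 (Lp.toTemperedDistribution g) φ
      = ∫ ξ, φ ξ * (𝓕 g : L2) ξ := by
    intro φ
    rw [Lp.fourier_toTemperedDistribution_eq, Lp.toTemperedDistribution_apply]
    rfl
  constructor
  · intro h φ
    rw [← e1, ← e2, h]
  · intro h
    have : 𝓕 (TemperedDistribution.derivCLM ℂ (Lp.toTemperedDistribution f))
        = 𝓕 (Lp.toTemperedDistribution g) := by
      ext φ
      rw [e1, e2, h]
    have h2 := congrArg (fun F : TemperedDistribution ℝ ℂ => 𝓕⁻ F) this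
    simp only [FourierTransform.fourierInv_fourier_eq] at h2
    exact h2

/-- In this form the derivative visibly commutes with `T r` and with frequency truncation, and weak
derivatives can be exhibited by giving their Fourier transform. -/
theorem isWeakDeriv_iff {f g : L2} : IsWeakDeriv f g ↔
    (𝓕 g : L2) =ᵐ[volume] fun ξ => (2 * Real.pi * Complex.I * ξ) * (𝓕 f : L2) ξ := by
  rw [isWeakDeriv_iff_forall_integral]
  constructor
  · intro h
    refine ae_eq_of_integral_contDiff_smul_eq ((Lp.memLp _).locallyIntegrable (by norm_num))
      ?_ ?_
    · have : Continuous fun ξ : ℝ => 2 * (Real.pi : ℂ) * Complex.I * ξ := by fun_prop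
      exact LocallyIntegrable.continuous_mul this
        ((Lp.memLp (𝓕 f : L2)).locallyIntegrable (by norm_num))
    · intro φ hφ hc
      have hg₁ : HasCompactSupport (Complex.ofRealCLM ∘ φ) := hc.comp_left rfl
      have hg₂ : ContDiff ℝ _ (Complex.ofRealCLM ∘ φ) := Complex.ofRealCLM.contDiff.comp hφ
      have := h (hg₁.toSchwartzMap hg₂)
      simp only [Complex.real_smul]
      refine Eq.trans ?_ (this.symm.trans ?_)
      · rfl
      · refine integral_congr_ae (Filter.Eventually.of_forall fun ξ => ?_)
        simp
        ring
  · intro h φ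
    refine integral_congr_ae ?_
    filter_upwards [h] with ξ hξ
    rw [hξ]
    ring

theorem IsWeakDeriv.unique {f g g' : L2} (h : IsWeakDeriv f g) (h' : IsWeakDeriv f g') :
    g = g' :=
  toTemperedDistribution_injective (Eq.trans (Eq.symm h) h')

theorem derivNorm_eq {f g : L2} (h : IsWeakDeriv f g) : derivNorm f = ‖g‖ₑ := by
  refine le_antisymm (iInf₂_le g h) (le_iInf₂ fun g' hg' => ?_)
  rw [h.unique hg']

theorem IsWeakDeriv.smul {f g : L2} (h : IsWeakDeriv f g) (c : ℂ) :
    IsWeakDeriv (c • f) (c • g) := by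
  rw [isWeakDeriv_iff] at h ⊢
  rw [FourierTransform.fourier_smul, FourierTransform.fourier_smul]
  filter_upwards [h, Lp.coeFn_smul c (𝓕 f : L2), Lp.coeFn_smul c (𝓕 g : L2)] with ξ h1 h2 h3
  simp only [h2, h3, Pi.smul_apply, h1, smul_eq_mul]
  ring

theorem IsWeakDeriv.sub {f g f' g' : L2} (h : IsWeakDeriv f g) (h' : IsWeakDeriv f' g') :
    IsWeakDeriv (f - f') (g - g') := by
  rw [isWeakDeriv_iff] at h h' ⊢
  rw [fourier_sub, fourier_sub]
  filter_upwards [h, h', Lp.coeFn_sub (𝓕 f : L2) (𝓕 f'), Lp.coeFn_sub (𝓕 g : L2) (𝓕 g')]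
    with ξ h1 h2 h3 h4
  simp only [h3, h4, Pi.sub_apply, h1, h2]
  ring

theorem h1Norm_sq (f : L2) : h1Norm f ^ 2 = ‖f‖ₑ ^ 2 + derivNorm f ^ 2 := by
  rw [h1Norm, ← ENNReal.rpow_natCast, ← ENNReal.rpow_mul]
  norm_num

theorem enorm_le_h1Norm (f : L2) : ‖f‖ₑ ≤ h1Norm f := by
  refine (ENNReal.pow_le_pow_left_iff (n := 2) two_ne_zero).1 ?_
  rw [h1Norm_sq]
  exact le_self_add

theorem derivNorm_le_h1Norm (f : L2) : derivNorm f ≤ h1Norm f := by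
  refine (ENNReal.pow_le_pow_left_iff (n := 2) two_ne_zero).1 ?_
  rw [h1Norm_sq]
  exact le_add_self

theorem h1Norm_ne_top {f : L2} (h : MemH1 f) : h1Norm f ≠ ⊤ := by
  obtain ⟨g, hg⟩ := h
  have : h1Norm f ^ 2 ≠ ⊤ := by
    rw [h1Norm_sq, derivNorm_eq hg]
    finiteness
  intro h'
  simp [h'] at this

/-! ### Pointwise bounds -/

theorem enorm_two_pi_I_mul (ξ : ℝ) :
    ‖2 * (Real.pi : ℂ) * Complex.I * ξ‖ₑ = ENNReal.ofReal (2 * Real.pi * |ξ|) := by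
  rw [← ofReal_norm]
  simp [abs_of_pos Real.pi_pos]

/-- Cauchy–Schwarz with the weight `1 + ξ²`, which is below `1 + 4π²ξ²`. Since `T r` does not change
`|𝓕 f|`, this bounds the waves in sup norm uniformly in time. -/
theorem exists_lintegral_fourier_le :
    ∃ C : ℝ≥0, ∀ f : L2, MemH1 f → ∫⁻ ξ, ‖(𝓕 f : L2) ξ‖ₑ ≤ C * h1Norm f := by
  have hfin : ∫⁻ ξ : ℝ, ENNReal.ofReal (1 + ξ ^ 2)⁻¹ < ⊤ := by
    have := integrable_inv_one_add_sq.hasFiniteIntegral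
    rw [hasFiniteIntegral_iff_ofReal (Filter.Eventually.of_forall fun ξ => by positivity)] at this
    exact this
  refine ⟨((∫⁻ ξ : ℝ, ENNReal.ofReal (1 + ξ ^ 2)⁻¹) ^ (1 / 2 : ℝ)).toNNReal, ?_⟩
  rintro f ⟨g, hg⟩
  rw [ENNReal.coe_toNNReal (by finiteness)]
  have hm : AEMeasurable (fun ξ => ‖(𝓕 f : L2) ξ‖ₑ) := (Lp.aestronglyMeasurable _).enorm
  have hsq : ∀ ξ : ℝ, ENNReal.ofReal (1 + ξ ^ 2) ≠ 0 := fun ξ => by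
    simp; positivity
  have h1 : ∫⁻ ξ, ‖(𝓕 f : L2) ξ‖ₑ = ∫⁻ ξ, ((fun ξ : ℝ => ENNReal.ofReal (1 + ξ ^ 2)⁻¹ ^ (1 / 2 : ℝ))
      * fun ξ => ENNReal.ofReal (1 + ξ ^ 2) ^ (1 / 2 : ℝ) * ‖(𝓕 f : L2) ξ‖ₑ) ξ := by
    refine lintegral_congr fun ξ => ?_
    rw [Pi.mul_apply, ← mul_assoc, ← ENNReal.mul_rpow_of_nonneg _ _ (by norm_num),
      ENNReal.ofReal_inv_of_pos (by positivity), ENNReal.inv_mul_cancel (hsq ξ) (by simp)]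
    simp
  rw [h1]
  refine (ENNReal.lintegral_mul_le_Lp_mul_Lq volume Real.HolderConjugate.two_two
    (by fun_prop) (by fun_prop)).trans ?_
  refine mul_le_mul' (le_of_eq ?_) ?_
  · congr 1
    refine lintegral_congr fun ξ => ?_
    rw [← ENNReal.rpow_mul]
    norm_num
  · rw [h1Norm]
    refine ENNReal.rpow_le_rpow ?_ (by norm_num)
    rw [derivNorm_eq hg, ← enorm_fourier f, ← enorm_fourier g, enorm_sq_eq_lintegral,
      enorm_sq_eq_lintegral, ← lintegral_add_left' (by fun_prop)]
    refine lintegral_mono_ae ?_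
    filter_upwards [isWeakDeriv_iff.1 hg] with ξ hξ
    rw [hξ, ENNReal.mul_rpow_of_nonneg _ _ (by norm_num), ← ENNReal.rpow_mul, enorm_mul, mul_pow,
      enorm_two_pi_I_mul, ← ENNReal.ofReal_pow (by positivity)]
    norm_num
    rw [ENNReal.ofReal_add (by norm_num) (by positivity), add_mul, ENNReal.ofReal_one, one_mul]
    refine add_le_add le_rfl (mul_le_mul' (ENNReal.ofReal_le_ofReal ?_) le_rfl)
    rw [mul_pow, sq_abs]
    have := Real.pi_gt_three
    nlinarith [sq_nonneg ξ, mul_nonneg (sq_nonneg ξ) (show 0 ≤ Real.pi ^ 2 * 4 - 1 by nlinarith)]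

theorem enorm_T_le_of_integrable {f : L2} (hf : Integrable (𝓕 f : L2)) (r : ℝ) :
    ∀ᵐ x, ‖T r f x‖ₑ ≤ ∫⁻ ξ, ‖(𝓕 f : L2) ξ‖ₑ := by
  filter_upwards [T_ae_of_integrable hf r] with x hx
  rw [hx, Real.fourierInv_eq]
  refine (enorm_integral_le_lintegral_enorm _).trans (le_of_eq (lintegral_congr fun ξ => ?_))
  rw [Circle.smul_def, enorm_smul, enorm_mul, enorm_schrodingerSymbol]
  rw [← ofReal_norm ((Real.fourierChar _ : Circle) : ℂ), Circle.norm_coe]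
  simp

theorem exists_enorm_T_le :
    ∃ C : ℝ≥0, ∀ f : L2, MemH1 f → ∀ r, ∀ᵐ x, ‖T r f x‖ₑ ≤ C * h1Norm f := by
  obtain ⟨C, hC⟩ := exists_lintegral_fourier_le
  refine ⟨C, fun f hf r => ?_⟩
  have h1 := hC f hf
  have hi : Integrable (𝓕 f : L2) :=
    ⟨Lp.aestronglyMeasurable _, h1.trans_lt (ENNReal.mul_lt_top (by simp)
      (h1Norm_ne_top hf).lt_top)⟩
  filter_upwards [enorm_T_le_of_integrable hi r] with x hx
  exact hx.trans h1

theorem lintegral_enorm_rpow_le {h : L2} {M : ℝ≥0∞} (hM : ∀ᵐ x, ‖h x‖ₑ ≤ M) {γ : ℝ}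
    (hγ : 2 ≤ γ) : ∫⁻ x, ‖h x‖ₑ ^ γ ≤ M ^ (γ - 2) * ‖h‖ₑ ^ 2 := by
  have hm : AEMeasurable (fun x => ‖h x‖ₑ) := (Lp.aestronglyMeasurable _).enorm
  rw [enorm_sq_eq_lintegral, ← lintegral_const_mul'' _ (by fun_prop)]
  refine lintegral_mono_ae ?_
  filter_upwards [hM] with x hx
  have : ‖h x‖ₑ ^ γ = ‖h x‖ₑ ^ (γ - 2) * ‖h x‖ₑ ^ (2 : ℝ) := by
    rw [← ENNReal.rpow_add_of_nonneg _ _ (by linarith) (by norm_num)]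
    ring_nf
  rw [this, ENNReal.rpow_two]
  gcongr

theorem AssumptionA1.lintegral_comp_norm_le {V : ℝ → ℝ} {γ₁ γ₂ c : ℝ}
    (hV : AssumptionA1 V γ₁ γ₂ c) {h : L2} {M : ℝ≥0∞} (hM : ∀ᵐ x, ‖h x‖ₑ ≤ M) :
    ∫⁻ x, ‖V ‖h x‖‖ₑ
      ≤ ENNReal.ofReal c * ((M ^ (γ₁ - 2) + M ^ (γ₂ - 2)) * ‖h‖ₑ ^ 2) := by
  have hm : AEMeasurable (fun x => ‖h x‖ₑ) := (Lp.aestronglyMeasurable _).enorm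
  calc ∫⁻ x, ‖V ‖h x‖‖ₑ ≤ ∫⁻ x, ENNReal.ofReal c * (‖h x‖ₑ ^ γ₁ + ‖h x‖ₑ ^ γ₂) :=
        lintegral_mono fun x => hV.enorm_le _
    _ = ENNReal.ofReal c * ((∫⁻ x, ‖h x‖ₑ ^ γ₁) + ∫⁻ x, ‖h x‖ₑ ^ γ₂) := by
        rw [lintegral_const_mul'' _ (by fun_prop), lintegral_add_left' (by fun_prop)]
    _ ≤ _ := by
        rw [add_mul]
        gcongr
        · exact lintegral_enorm_rpow_le hM hV.two_le
        · exact lintegral_enorm_rpow_le hM (hV.two_le.trans hV.le)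

theorem enorm_N_le (V ψ : ℝ → ℝ) (f : L2) :
    ‖N V ψ f‖ₑ ≤ ∫⁻ r, (∫⁻ x, ‖V ‖T r f x‖‖ₑ) * ‖ψ r‖ₑ := by
  refine (enorm_integral_le_lintegral_enorm _).trans (lintegral_mono fun r => ?_)
  rw [enorm_mul]
  exact mul_le_mul' (enorm_integral_le_lintegral_enorm _) le_rfl

/-! ### The ground state energy -/

theorem tendsto_rpow_nhds_zero {γ : ℝ} (hγ : 0 < γ) :
    Filter.Tendsto (fun x : ℝ≥0∞ => x ^ γ) (nhds 0) (nhds 0) := by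
  have := (ENNReal.continuous_rpow_const (y := γ)).tendsto 0
  rwa [ENNReal.zero_rpow_of_pos hγ] at this

/-- The trial function has Fourier transform constant `√(lam/ε)` on `[0, ε]`. Its mass is `lam`, its
frequencies are at most `ε`, and its Fourier transform has `L¹` norm `√(lam·ε)`, which bounds all
its evolutions pointwise. -/
theorem E_le_of_fourier_eq {V ψ : ℝ → ℝ} {γ₁ γ₂ c d lam ε : ℝ}
    (hV : AssumptionA1 V γ₁ γ₂ c) (hlam : 0 < lam) (hε : 0 < ε) :
    E d V ψ lam ≤ ((ENNReal.ofReal (d / 2) * (ENNReal.ofReal (2 * Real.pi * ε) ^ 2 * ENNReal.ofReal lam)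
      + ENNReal.ofReal c * ((ENNReal.ofReal √(lam * ε) ^ (γ₁ - 2)
        + ENNReal.ofReal √(lam * ε) ^ (γ₂ - 2)) * ENNReal.ofReal lam) * ∫⁻ r, ‖ψ r‖ₑ : ℝ≥0∞) : EReal) := by
  have hvol : volume (Icc 0 ε) = ENNReal.ofReal ε := by simp
  have hfin : volume (Icc 0 ε) ≠ ⊤ := by simp
  have hs : MeasurableSet (Icc 0 ε) := measurableSet_Icc
  set h : L2 := indicatorConstLp 2 hs hfin ((√(lam / ε) : ℝ) : ℂ) with hh
  have hae : h =ᵐ[volume] (Icc 0 ε).indicator fun _ => ((√(lam / ε) : ℝ) : ℂ) :=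
    indicatorConstLp_coeFn
  set f : L2 := 𝓕⁻ h with hf
  have hF : (𝓕 f : L2) = h := by simp [hf, FourierTransform.fourier_fourierInv_eq]
  have hn : ‖f‖ₑ ^ 2 = ENNReal.ofReal lam := by
    rw [← enorm_fourier, hF, enorm_sq_eq_lintegral]
    calc ∫⁻ ξ, ‖h ξ‖ₑ ^ 2 = ∫⁻ ξ, (Icc 0 ε).indicator (fun _ => ENNReal.ofReal (lam / ε)) ξ := by
          refine lintegral_congr_ae ?_
          filter_upwards [hae] with ξ hξ
          rw [hξ]
          by_cases hm : ξ ∈ Icc 0 ε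
          · rw [indicator_of_mem hm, indicator_of_mem hm, ← ofReal_norm, Complex.norm_real,
              Real.norm_of_nonneg (by positivity), ← ENNReal.ofReal_pow (by positivity),
              Real.sq_sqrt (by positivity)]
          · simp [indicator_of_notMem hm]
      _ = ENNReal.ofReal lam := by
          rw [lintegral_indicator hs, setLIntegral_const, hvol, ← ENNReal.ofReal_mul (by positivity)]
          congr 1
          field_simp
  have hL1 : ∫⁻ ξ, ‖(𝓕 f : L2) ξ‖ₑ = ENNReal.ofReal √(lam * ε) := by
    rw [hF]
    calc ∫⁻ ξ, ‖h ξ‖ₑ = ∫⁻ ξ, (Icc 0 ε).indicator (fun _ => ENNReal.ofReal √(lam / ε)) ξ := by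
          refine lintegral_congr_ae ?_
          filter_upwards [hae] with ξ hξ
          rw [hξ]
          by_cases hm : ξ ∈ Icc 0 ε
          · rw [indicator_of_mem hm, indicator_of_mem hm, ← ofReal_norm, Complex.norm_real,
              Real.norm_of_nonneg (by positivity)]
          · simp [indicator_of_notMem hm]
      _ = ENNReal.ofReal √(lam * ε) := by
          rw [lintegral_indicator hs, setLIntegral_const, hvol, ← ENNReal.ofReal_mul (by positivity)]
          congr 1
          have : lam * ε = lam / ε * ε ^ 2 := by field_simp
          rw [this, Real.sqrt_mul (by positivity), Real.sqrt_sq hε.le]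
  have hint : Integrable (𝓕 f : L2) :=
    ⟨Lp.aestronglyMeasurable _, by rw [hasFiniteIntegral_iff_enorm, hL1]; simp⟩
  have hmem : MemLp (fun ξ : ℝ => (2 * Real.pi * Complex.I * ξ) * h ξ) 2 volume := by
    refine (Lp.memLp ((2 * Real.pi * ε : ℝ) • h)).of_le
      (Continuous.aestronglyMeasurable (by fun_prop) |>.mul (Lp.aestronglyMeasurable h)) ?_
    filter_upwards [Lp.coeFn_smul (2 * Real.pi * ε : ℝ) h, hae] with ξ h1 h2
    rw [h1, Pi.smul_apply, h2]
    by_cases hm : ξ ∈ Icc 0 ε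
    · rw [indicator_of_mem hm, norm_mul, norm_smul]
      refine mul_le_mul_of_nonneg_right ?_ (norm_nonneg _)
      simp only [norm_mul, Complex.norm_real, Real.norm_eq_abs, Complex.norm_I,
        Complex.norm_ofNat, abs_of_nonneg hm.1, abs_of_pos hε, abs_two, mul_one]
      gcongr
      exact hm.2
    · simp [indicator_of_notMem hm]
  have hderiv : IsWeakDeriv f (𝓕⁻ hmem.toLp) := by
    rw [isWeakDeriv_iff, FourierTransform.fourier_fourierInv_eq, hF]
    exact hmem.coeFn_toLp
  have hk : derivNorm f ^ 2 ≤ ENNReal.ofReal (2 * Real.pi * ε) ^ 2 * ENNReal.ofReal lam := by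
    rw [derivNorm_eq hderiv, enorm_fourierInv, ← hn, ← mul_pow, ← enorm_fourier f, hF]
    gcongr
    have : ENNReal.ofReal (2 * Real.pi * ε) * ‖h‖ₑ = ‖(2 * Real.pi * ε : ℝ) • h‖ₑ := by
      rw [enorm_smul, ← ofReal_norm (2 * Real.pi * ε), Real.norm_of_nonneg (by positivity)]
    rw [this]
    refine enorm_le_iff_norm_le.2 (Lp.norm_le_norm_of_ae_le ?_)
    filter_upwards [Lp.coeFn_smul (2 * Real.pi * ε : ℝ) h, hae, hmem.coeFn_toLp] with ξ h1 h2 h3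
    rw [h1, h3, Pi.smul_apply, h2]
    by_cases hm : ξ ∈ Icc 0 ε
    · rw [indicator_of_mem hm, norm_mul, norm_smul]
      refine mul_le_mul_of_nonneg_right ?_ (norm_nonneg _)
      simp only [norm_mul, Complex.norm_real, Real.norm_eq_abs, Complex.norm_I,
        Complex.norm_ofNat, abs_of_nonneg hm.1, abs_of_pos hε, abs_two, mul_one]
      gcongr
      exact hm.2
    · simp [indicator_of_notMem hm]
  have hN : ‖N V ψ f‖ₑ ≤ ENNReal.ofReal c * ((ENNReal.ofReal √(lam * ε) ^ (γ₁ - 2)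
        + ENNReal.ofReal √(lam * ε) ^ (γ₂ - 2)) * ENNReal.ofReal lam) * ∫⁻ r, ‖ψ r‖ₑ := by
    refine (enorm_N_le V ψ f).trans ?_
    refine (lintegral_mono fun r => mul_le_mul' (hV.lintegral_comp_norm_le
      (enorm_T_le_of_integrable hint r)) le_rfl).trans (le_of_eq ?_)
    simp only [enorm_T, hn, hL1]
    exact lintegral_const_mul' _ _ (by have := hV.two_le; have := hV.le; finiteness)
  have hnorm : ‖f‖ ^ 2 = lam := by
    have : ENNReal.ofReal (‖f‖ ^ 2) = ENNReal.ofReal lam := by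
      rw [← hn, ENNReal.ofReal_pow (norm_nonneg _), ofReal_norm]
    exact (ENNReal.ofReal_eq_ofReal_iff (by positivity) hlam.le).1 this
  refine (iInf₂_le f hnorm).trans ?_
  rw [H, EReal.coe_ennreal_add, sub_eq_add_neg]
  refine add_le_add (EReal.coe_ennreal_le_coe_ennreal_iff.2 (mul_le_mul' le_rfl hk)) ?_
  refine le_trans ?_ (EReal.coe_ennreal_le_coe_ennreal_iff.2 hN)
  rw [← EReal.coe_neg, ← ofReal_norm, EReal.coe_ennreal_ofReal, max_eq_left (norm_nonneg _)]
  exact EReal.coe_le_coe_iff.2 (neg_le_abs _)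

/-- Let `ε → 0` for the spread-out trial functions. The strict inequality `2 < γ₁` is what makes the
nonlinear term vanish in the limit. -/
theorem E_nonpos {V ψ : ℝ → ℝ} {γ₁ γ₂ c d lam : ℝ} (hV : AssumptionA1 V γ₁ γ₂ c) (hγ : 2 < γ₁)
    (hψ : Integrable ψ) (hlam : 0 < lam) : E d V ψ lam ≤ 0 := by
  have hγ' := hV.le
  have key : Filter.Tendsto (fun ε : ℝ =>
      (ENNReal.ofReal (d / 2) * (ENNReal.ofReal (2 * Real.pi * ε) ^ 2 * ENNReal.ofReal lam)
      + ENNReal.ofReal c * ((ENNReal.ofReal √(lam * ε) ^ (γ₁ - 2)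
        + ENNReal.ofReal √(lam * ε) ^ (γ₂ - 2)) * ENNReal.ofReal lam) * ∫⁻ r, ‖ψ r‖ₑ : ℝ≥0∞))
      (nhds 0) (nhds 0) := by
    have h0 : Filter.Tendsto (fun ε : ℝ => ENNReal.ofReal √(lam * ε)) (nhds 0) (nhds 0) := by
      have : Continuous fun ε : ℝ => ENNReal.ofReal √(lam * ε) :=
        ENNReal.continuous_ofReal.comp (by fun_prop)
      simpa using this.tendsto 0
    have h1 := (tendsto_rpow_nhds_zero (γ := γ₁ - 2) (by linarith)).comp h0
    have h2 := (tendsto_rpow_nhds_zero (γ := γ₂ - 2) (by linarith)).comp h0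
    have h3 : Filter.Tendsto (fun ε : ℝ => ENNReal.ofReal (2 * Real.pi * ε) ^ 2 * ENNReal.ofReal lam)
        (nhds 0) (nhds 0) := by
      have h4 : Filter.Tendsto (fun ε : ℝ => ENNReal.ofReal (2 * Real.pi * ε) ^ 2) (nhds 0)
          (nhds 0) := by
        have : Continuous fun ε : ℝ => ENNReal.ofReal (2 * Real.pi * ε) ^ 2 :=
          (ENNReal.continuous_pow 2).comp (ENNReal.continuous_ofReal.comp (by fun_prop))
        simpa using this.tendsto 0
      simpa using ENNReal.Tendsto.mul_const (b := ENNReal.ofReal lam) h4 (by simp)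
    have h5 := ENNReal.Tendsto.const_mul (a := ENNReal.ofReal (d / 2)) h3 (by simp)
    have h6 := ENNReal.Tendsto.mul_const (b := ∫⁻ r, ‖ψ r‖ₑ)
      (ENNReal.Tendsto.const_mul (a := ENNReal.ofReal c)
        (ENNReal.Tendsto.mul_const (b := ENNReal.ofReal lam) (h1.add h2) (by simp)) (by simp))
      (Or.inr hψ.hasFiniteIntegral.ne)
    simpa using h5.add h6
  have h2 : Filter.Tendsto (fun ε : ℝ => (ε : ℝ)) (nhdsWithin 0 (Ioi 0)) (nhds 0) :=
    tendsto_nhdsWithin_of_tendsto_nhds Filter.tendsto_id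
  have h3 := (continuous_coe_ennreal_ereal.tendsto 0).comp (key.comp h2)
  refine ge_of_tendsto h3 ?_
  filter_upwards [self_mem_nhdsWithin] with ε hε
  exact E_le_of_fourier_eq hV hlam hε

/-! ### Splitting the energy -/

/-- The points `2x` and `y` lie between `x` and `x + y` and have the same sum as these endpoints, so
convexity gives `(2x)^p + y^p ≤ x^p + (x+y)^p`. Rearranged, the deficit is `(2^p - 2) x^p`. -/
theorem rpow_add_rpow_le_of_le {p δ x y : ℝ} (hp : 1 ≤ p) (hδ : 0 < δ) (hx : δ ≤ x) (hy : x ≤ y)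
    (hxy : x + y ≤ 1) : x ^ p + y ^ p ≤ 1 - (2 ^ p - 2) * δ ^ p := by
  have hx0 : 0 < x := hδ.trans_le hx
  have hy0 : 0 < y := hx0.trans_le hy
  have hc := convexOn_rpow hp
  have hx1 : x ∈ Ici (0 : ℝ) := hx0.le
  have hy1 : x + y ∈ Ici (0 : ℝ) := (by positivity : 0 ≤ x + y)
  have ha : 0 ≤ (y - x) / y := div_nonneg (by linarith) hy0.le
  have hb : 0 ≤ x / y := by positivity
  have hab : (y - x) / y + x / y = 1 := by field_simp; ring
  have h1 := hc.2 hx1 hy1 ha hb hab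
  have h2 := hc.2 hx1 hy1 hb ha ((add_comm _ _).trans hab)
  simp only [smul_eq_mul] at h1 h2
  have e1 : (y - x) / y * x + x / y * (x + y) = 2 * x := by field_simp; ring
  have e2 : x / y * x + (y - x) / y * (x + y) = y := by field_simp; ring
  rw [e1, Real.mul_rpow (by norm_num) hx0.le] at h1
  rw [e2] at h2
  have h3 : (y - x) / y * x ^ p + x / y * (x + y) ^ p
      + (x / y * x ^ p + (y - x) / y * (x + y) ^ p) = x ^ p + (x + y) ^ p := by
    field_simp; ring
  have h4 : (x + y) ^ p ≤ 1 := Real.rpow_le_one (by positivity) hxy (by linarith)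
  have h5 : δ ^ p ≤ x ^ p := Real.rpow_le_rpow hδ.le hx (by linarith)
  have h6 : (2 : ℝ) ≤ 2 ^ p := by simpa using Real.rpow_le_rpow_of_exponent_le (x := 2) (by norm_num) hp
  nlinarith

theorem rpow_add_rpow_le {p δ x y : ℝ} (hp : 1 ≤ p) (hδ : 0 < δ) (hx : δ ≤ x) (hy : δ ≤ y)
    (hxy : x + y ≤ 1) : x ^ p + y ^ p ≤ 1 - (2 ^ p - 2) * δ ^ p := by
  rcases le_total x y with h | h
  · exact rpow_add_rpow_le_of_le hp hδ hx h hxy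
  · rw [add_comm]
    exact rpow_add_rpow_le_of_le hp hδ hy h (by linarith)

/-- Here `δ/lam` is below `1/2`, so the subtracted term is at most `1 - 2·2^{-γ₀/2} < 1`. Positivity
matters when the ground state energy is `-∞`: only then is the product `-∞` as well. -/
theorem factor_pos {γ₀ δ lam : ℝ} (hγ : 2 < γ₀) (hδ : 0 < δ) (hlam : δ < lam / 2) :
    0 < factor γ₀ δ lam := by
  have hl : 0 < lam := by linarith
  have h1 : (δ / lam) ^ (γ₀ / 2) ≤ (1 / 2) ^ (γ₀ / 2) :=
    Real.rpow_le_rpow (by positivity) (by rw [div_le_div_iff₀ hl (by norm_num)]; linarith)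
      (by linarith)
  have h2 : (1 / 2 : ℝ) ^ (γ₀ / 2) * 2 ^ (γ₀ / 2) = 1 := by
    rw [← Real.mul_rpow (by norm_num) (by norm_num)]; norm_num
  have h3 : 0 < (1 / 2 : ℝ) ^ (γ₀ / 2) := by positivity
  have h4 : (2 : ℝ) < 2 ^ (γ₀ / 2) := by
    simpa using Real.rpow_lt_rpow_of_exponent_lt (x := 2) (by norm_num)
      (show 1 < γ₀ / 2 by linarith)
  unfold factor
  nlinarith

/-- Superhomogeneity: the energy of a function of smaller mass is controlled from below by the
energy of its multiple of mass `lam`. -/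
theorem le_energy_of_le_E {V ψ : ℝ → ℝ} {γ₀ d lam e k : ℝ} {f : L2} (hV : AssumptionA2 V γ₀)
    (hψ : ∀ᵐ r, 0 ≤ ψ r) (he : (e : EReal) ≤ E d V ψ lam) (hf0 : 0 < ‖f‖) (hf : ‖f‖ ^ 2 ≤ lam)
    (hk : 0 ≤ k) (hkin : ∀ t : ℝ, 1 ≤ t → ENNReal.ofReal (d / 2) * derivNorm ((t : ℂ) • f) ^ 2
      ≤ ENNReal.ofReal (t ^ 2 * k))
    (hN : ∀ t : ℝ, 1 ≤ t → NConverges V ψ ((t : ℂ) • f)) :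
    (‖f‖ ^ 2 / lam) ^ (γ₀ / 2) * e ≤ k - N V ψ f := by
  have hγ := hV.two_lt
  have hsq : 0 < ‖f‖ ^ 2 := by positivity
  have hlam : 0 < lam := hsq.trans_le hf
  set t : ℝ := √(lam / ‖f‖ ^ 2) with ht
  have ht2 : t ^ 2 = lam / ‖f‖ ^ 2 := Real.sq_sqrt (by positivity)
  have ht1 : 1 ≤ t := by
    rw [ht, Real.one_le_sqrt, one_le_div hsq]
    exact hf
  have ht0 : 0 < t := by linarith
  have hnorm : ‖(t : ℂ) • f‖ ^ 2 = lam := by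
    rw [norm_smul, Complex.norm_real, Real.norm_of_nonneg ht0.le, mul_pow, ht2]
    field_simp
  have h1 : (e : EReal) ≤ H d V ψ ((t : ℂ) • f) := 
    he.trans (iInf₂_le (f := fun (g : L2) (_ : ‖g‖ ^ 2 = lam) => H d V ψ g) _ hnorm)
  have h2 : (e : EReal) ≤ ((t ^ 2 * k - N V ψ ((t : ℂ) • f) : ℝ) : EReal) := by
    refine h1.trans ?_
    rw [H, EReal.coe_sub]
    refine EReal.sub_le_sub ?_ le_rfl
    refine (EReal.coe_ennreal_le_coe_ennreal_iff.2 (hkin t ht1)).trans (le_of_eq ?_)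
    rw [EReal.coe_ennreal_ofReal, max_eq_left (by positivity)]
  have h3 : e ≤ t ^ 2 * k - N V ψ ((t : ℂ) • f) := EReal.coe_le_coe_iff.1 h2
  have hN1 : NConverges V ψ f := by simpa using hN 1 le_rfl
  have hNt := hN t ht1
  have h4 : t ^ γ₀ * N V ψ f ≤ N V ψ ((t : ℂ) • f) := by
    rw [N, N, ← integral_const_mul]
    refine integral_mono_ae (hN1.2.1.const_mul _) hNt.2.1 ?_
    filter_upwards [hψ, hN1.1, hNt.1] with r hr h5 h6
    rw [← mul_assoc, ← integral_const_mul]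
    refine mul_le_mul_of_nonneg_right (integral_mono_ae (h5.const_mul _) h6 ?_) hr
    rw [T_smul]
    filter_upwards [Lp.coeFn_smul (t : ℂ) (T r f)] with x hx
    rw [hx, Pi.smul_apply, norm_smul, Complex.norm_real, Real.norm_of_nonneg ht0.le]
    exact hV.rpow_mul_le ht1 (norm_nonneg _)
  have h5 : t ^ 2 ≤ t ^ γ₀ := by
    rw [← Real.rpow_two]
    exact Real.rpow_le_rpow_of_exponent_le ht1 hγ.le
  have h6 : (‖f‖ ^ 2 / lam) ^ (γ₀ / 2) * t ^ γ₀ = 1 := by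
    have : t ^ γ₀ = (lam / ‖f‖ ^ 2) ^ (γ₀ / 2) := by
      rw [← ht2, ← Real.rpow_two, ← Real.rpow_mul ht0.le]
      congr 1
      ring
    rw [this, ← Real.mul_rpow (by positivity) (by positivity)]
    have : ‖f‖ ^ 2 / lam * (lam / ‖f‖ ^ 2) = 1 := by field_simp
    rw [this, Real.one_rpow]
  -- The kinetic part scales only like `t²`; as `k ≥ 0` and `t ≥ 1` it may be enlarged to `t^{γ₀}
  -- k`, which gives both parts the same homogeneity.
  have h7 : e ≤ t ^ γ₀ * (k - N V ψ f) := by nlinarith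
  calc (‖f‖ ^ 2 / lam) ^ (γ₀ / 2) * e
      ≤ (‖f‖ ^ 2 / lam) ^ (γ₀ / 2) * (t ^ γ₀ * (k - N V ψ f)) := by gcongr
    _ = k - N V ψ f := by rw [← mul_assoc, h6, one_mul]

/-- If the ground state energy is a real number `e ≤ 0`, the convexity bound on `(μ₁/lam)^{γ₀/2} +
(μ₂/lam)^{γ₀/2}` reverses upon multiplication by `e`. Quantifying over real lower bounds `e` avoids
sums of extended reals; the value `-∞` is trivial and `+∞` is excluded by the sign. -/
theorem factor_mul_E_sub_le {V ψ : ℝ → ℝ} {γ₀ d lam δ h h₁ h₂ μ₁ μ₂ err : ℝ} {x : EReal}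
    (hγ : 2 < γ₀) (hE : E d V ψ lam ≤ 0) (hδ : 0 < δ) (hlam : δ < lam / 2)
    (hμ₁ : δ ≤ μ₁) (hμ₂ : δ ≤ μ₂) (hμ : μ₁ + μ₂ ≤ lam)
    (h1 : ∀ e : ℝ, (e : EReal) ≤ E d V ψ lam → (μ₁ / lam) ^ (γ₀ / 2) * e ≤ h₁)
    (h2 : ∀ e : ℝ, (e : EReal) ≤ E d V ψ lam → (μ₂ / lam) ^ (γ₀ / 2) * e ≤ h₂)
    (hh : h₁ + h₂ ≤ h + err) (hx : (h : EReal) ≤ x) :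
    (factor γ₀ δ lam : EReal) * E d V ψ lam - ((err : ℝ) : EReal) ≤ x := by
  have hl : 0 < lam := by linarith
  refine le_trans ?_ hx
  induction hE' : E d V ψ lam with
  | bot =>
    rw [EReal.coe_mul_bot_of_pos (factor_pos hγ hδ hlam)]
    simp
  | top => simp [hE'] at hE
  | coe e =>
    rw [hE'] at h1 h2 hE
    have he : e ≤ 0 := by exact_mod_cast hE
    have h3 := h1 e le_rfl
    have h4 := h2 e le_rfl
    have h5 := rpow_add_rpow_le (p := γ₀ / 2) (δ := δ / lam) (x := μ₁ / lam) (y := μ₂ / lam)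
      (by linarith) (by positivity) (by gcongr) (by gcongr)
      (by rw [← add_div, div_le_one hl]; exact hμ)
    have h6 : factor γ₀ δ lam * e - err ≤ h := by
      unfold factor
      nlinarith
    exact_mod_cast h6

/-! ### The error function and the choice of a window -/

theorem antitoneOn_G {α : ℝ} (hα : 0 < α) : AntitoneOn (G α) (Ici 0) := by
  intro s hs t ht hst
  have hs' : (0 : ℝ) ≤ s := hs
  unfold G
  rw [ENNReal.rpow_neg, ENNReal.rpow_neg]
  refine ENNReal.inv_le_inv.2 (ENNReal.rpow_le_rpow (ENNReal.ofReal_le_ofReal ?_) (by norm_num))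
  gcongr

theorem tendsto_G {α : ℝ} (hα : 0 < α) : Filter.Tendsto (G α) Filter.atTop (nhds 0) := by
  have h1 : Filter.Tendsto (fun s : ℝ => (s + 1) ^ (2 * α / (1 + 2 * α)) - 1) Filter.atTop
      Filter.atTop :=
    Filter.tendsto_atTop_add_const_right _ _
      ((tendsto_rpow_atTop (by positivity)).comp
        (Filter.tendsto_atTop_add_const_right _ _ Filter.tendsto_id))
  have h2 := ENNReal.tendsto_ofReal_atTop.comp h1
  have h3 := ((ENNReal.continuous_rpow_const (y := -(1 / 2 : ℝ))).tendsto ⊤).comp h2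
  rw [ENNReal.top_rpow_of_neg (by norm_num)] at h3
  exact h3

theorem G_zero (α : ℝ) : G α 0 = ⊤ := by
  simp [G, ENNReal.zero_rpow_of_neg]

/-- Pigeonhole: `⌊(b-a)/ℓ⌋` adjacent disjoint windows fit, and the lightest carries at most the
average. The scale `κ` allows the same count in Mathlib's frequency variable `ξ = η/(2π)` while
lengths are measured in `η`. -/
theorem exists_window (g : L2) {a b κ ℓ : ℝ} (hκ : 0 < κ) (hℓ : 0 < ℓ) (hab : ℓ ≤ b - a) :
    ∃ a', a ≤ a' ∧ a' + ℓ ≤ b ∧ ∫⁻ x in Ico (κ * a') (κ * (a' + ℓ)), ‖g x‖ₑ ^ 2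
      ≤ (ENNReal.ofReal ((b - a) / ℓ - 1))⁻¹ * ‖g‖ₑ ^ 2 := by
  set n : ℕ := ⌊(b - a) / ℓ⌋₊ with hn
  have h1 : 1 ≤ (b - a) / ℓ := (one_le_div hℓ).2 hab
  have hn1 : 1 ≤ n := Nat.le_floor (by simpa using h1)
  have hn2 : (n : ℝ) ≤ (b - a) / ℓ := Nat.floor_le (by linarith)
  have hn3 : (b - a) / ℓ - 1 ≤ n := by
    have := Nat.lt_floor_add_one ((b - a) / ℓ)
    linarith
  set μ : Measure ℝ := volume.withDensity fun x => ‖g x‖ₑ ^ 2 with hμ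
  have hW : ∀ i : ℕ, MeasurableSet (Ico (κ * (a + i * ℓ)) (κ * (a + i * ℓ + ℓ))) :=
    fun i => measurableSet_Ico
  have hsum : ∑ i ∈ Finset.range n, μ (Ico (κ * (a + i * ℓ)) (κ * (a + i * ℓ + ℓ)))
      ≤ ∑ _i ∈ Finset.range n, (n : ℝ≥0∞)⁻¹ * ‖g‖ₑ ^ 2 := by
    rw [Finset.sum_const, Finset.card_range, nsmul_eq_mul, ← mul_assoc,
      ENNReal.mul_inv_cancel (by simp; omega) (by simp), one_mul, enorm_sq_eq_lintegral]
    have hu : μ univ = ∫⁻ x, ‖g x‖ₑ ^ 2 := by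
      rw [hμ, withDensity_apply _ MeasurableSet.univ, Measure.restrict_univ]
    rw [← hu]
    refine sum_measure_le_measure_univ (fun i _ => (hW i).nullMeasurableSet) ?_
    intro i _ j _ hij
    refine Disjoint.aedisjoint ?_
    have key : ∀ i j : ℕ, i < j → Disjoint (Ico (κ * (a + i * ℓ)) (κ * (a + i * ℓ + ℓ)))
        (Ico (κ * (a + j * ℓ)) (κ * (a + j * ℓ + ℓ))) := by
      intro i j h
      rw [Set.disjoint_left]
      intro x hx hx'
      have : (i : ℝ) + 1 ≤ j := by exact_mod_cast h
      have : κ * (a + i * ℓ + ℓ) ≤ κ * (a + j * ℓ) :=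
        mul_le_mul_of_nonneg_left (by nlinarith) hκ.le
      linarith [hx.2, hx'.1]
    rcases lt_or_gt_of_ne hij with h | h
    · exact key i j h
    · exact (key j i h).symm
  obtain ⟨i, hi, hle⟩ : ∃ i ∈ Finset.range n,
      μ (Ico (κ * (a + i * ℓ)) (κ * (a + i * ℓ + ℓ))) ≤ (n : ℝ≥0∞)⁻¹ * ‖g‖ₑ ^ 2 := by
    by_contra! h
    exact (ENNReal.sum_lt_sum_of_nonempty (by simp; omega) h).not_ge hsum
  have hi' : (i : ℝ) + 1 ≤ n := by exact_mod_cast Finset.mem_range.1 hi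
  have hnl : n * ℓ ≤ b - a := (le_div_iff₀ hℓ).1 hn2
  refine ⟨a + i * ℓ, le_add_of_nonneg_right (by positivity), by nlinarith, ?_⟩
  rw [hμ, withDensity_apply _ (hW i)] at hle
  refine hle.trans (mul_le_mul' (ENNReal.inv_le_inv.2 ?_) le_rfl)
  rw [← ENNReal.ofReal_natCast]
  exact ENNReal.ofReal_le_ofReal hn3

/-- In an interval of length `s + 1` there is a long window which carries little mass. -/
theorem exists_window_G (g : L2) {a b κ α : ℝ} (hκ : 0 < κ) (hα : 0 < α) (hab : 1 < b - a) :
    ∃ a' ℓ, 1 ≤ ℓ ∧ a ≤ a' ∧ a' + ℓ ≤ b ∧ ENNReal.ofReal ℓ⁻¹ ^ α ≤ G α (b - a - 1) ∧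
      ‖cut (Ico (κ * a') (κ * (a' + ℓ))) g‖ₑ ≤ G α (b - a - 1) * ‖g‖ₑ := by
  have hL : 0 < b - a := by linarith
  -- This length balances the two errors: `ℓ^{-α}` is the power `-1/2` of `(b-a)/ℓ`, while the
  -- relative norm of the window is at most the power `-1/2` of `(b-a)/ℓ - 1`, which is `G α (b - a
  -- - 1)`.
  set ℓ : ℝ := (b - a) ^ (1 / (1 + 2 * α)) with hℓ
  have hℓ1 : 1 ≤ ℓ := Real.one_le_rpow hab.le (by positivity)
  have hexp : 1 / (1 + 2 * α) ≤ 1 := by rw [div_le_one (by positivity)]; linarith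
  have hℓL : ℓ ≤ b - a := by
    calc ℓ ≤ (b - a) ^ (1 : ℝ) := Real.rpow_le_rpow_of_exponent_le hab.le hexp
      _ = b - a := Real.rpow_one _
  have hdiv : (b - a) / ℓ = (b - a) ^ (2 * α / (1 + 2 * α)) := by
    rw [hℓ]
    nth_rewrite 1 [← Real.rpow_one (b - a)]
    rw [← Real.rpow_sub hL]
    congr 1
    field_simp
    ring
  obtain ⟨a', h1, h2, h3⟩ := exists_window g hκ (by linarith) hℓL
  refine ⟨a', ℓ, hℓ1, h1, h2, ?_, ?_⟩
  · have e : ENNReal.ofReal ℓ⁻¹ ^ α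
        = ENNReal.ofReal ((b - a) ^ (2 * α / (1 + 2 * α))) ^ (-(1 / 2) : ℝ) := by
      have hp : 0 < (b - a) ^ (2 * α / (1 + 2 * α)) := by positivity
      rw [ENNReal.ofReal_rpow_of_pos (by positivity), ENNReal.ofReal_rpow_of_pos hp, hℓ,
        ← Real.rpow_neg hL.le, ← Real.rpow_mul hL.le, ← Real.rpow_mul hL.le]
      congr 2
      field_simp
    rw [e, G, sub_add_cancel, ENNReal.rpow_neg, ENNReal.rpow_neg]
    refine ENNReal.inv_le_inv.2 (ENNReal.rpow_le_rpow (ENNReal.ofReal_le_ofReal ?_) (by norm_num))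
    linarith
  · refine (ENNReal.pow_le_pow_left_iff (n := 2) two_ne_zero).1 ?_
    rw [enorm_cut_sq measurableSet_Ico, mul_pow]
    refine h3.trans (mul_le_mul' (le_of_eq ?_) le_rfl)
    rw [hdiv, G, sub_add_cancel, ← ENNReal.rpow_natCast, ← ENNReal.rpow_mul, ← ENNReal.rpow_neg_one]
    norm_num

/-- The substitution `η = 2πξ`; the factor `(2π)^{-1/2}` of the unitary normalization cancels its
Jacobian, so the masses of the tails agree. -/
theorem HasFatTails.hat {f : L2} {δ a b : ℝ} (h : HasFatTails (hat f) δ a b) :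
    HasFatTails (𝓕 f : L2) δ ((2 * Real.pi)⁻¹ * a) ((2 * Real.pi)⁻¹ * b) := by
  have hp : (0 : ℝ) < 2 * Real.pi := by positivity
  have hc : ∀ η, ‖FatTail.hat f η‖ ^ 2
      = (2 * Real.pi)⁻¹ * ‖(𝓕 f : L2) ((2 * Real.pi)⁻¹ * η)‖ ^ 2 := fun η => by
    rw [FatTail.hat, norm_mul, mul_pow, Complex.norm_real, Real.norm_of_nonneg (by positivity),
      ← Real.rpow_natCast, ← Real.rpow_mul hp.le, div_eq_inv_mul η (2 * Real.pi),
      show -(1 / 2 : ℝ) * (2 : ℕ) = -1 by norm_num, Real.rpow_neg_one]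
  have key : ∀ S S' : Set ℝ, MeasurableSet S → MeasurableSet S' →
      (∀ η, (2 * Real.pi)⁻¹ * η ∈ S' ↔ η ∈ S) →
      ∫ η in S, ‖FatTail.hat f η‖ ^ 2 = ∫ ξ in S', ‖(𝓕 f : L2) ξ‖ ^ 2 := by
    intro S S' hS hS' h
    rw [← integral_indicator hS, ← integral_indicator hS']
    have := Measure.integral_comp_mul_left
      (S'.indicator fun ξ => ‖(𝓕 f : L2) ξ‖ ^ 2) ((2 * Real.pi)⁻¹)
    rw [inv_inv, abs_of_pos hp, smul_eq_mul] at this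
    rw [← inv_mul_cancel_left₀ hp.ne' (∫ ξ, S'.indicator (fun ξ => ‖(𝓕 f : L2) ξ‖ ^ 2) ξ), ← this,
      ← integral_const_mul]
    congr 1
    funext η
    by_cases hη : η ∈ S
    · rw [indicator_of_mem hη, indicator_of_mem ((h η).2 hη), hc]
    · rw [indicator_of_notMem hη, indicator_of_notMem (fun h' => hη ((h η).1 h')), mul_zero]
  refine ⟨h.1.trans (le_of_eq (key _ _ measurableSet_Iic measurableSet_Iic fun η => ?_)),
    h.2.trans (le_of_eq (key _ _ measurableSet_Ici measurableSet_Ici fun η => ?_))⟩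
  · rw [mem_Iic, mem_Iic, mul_le_mul_iff_right₀ (by positivity)]
  · rw [mem_Ici, mem_Ici, mul_le_mul_iff_right₀ (by positivity)]

/-! ### Zero average dispersion -/

theorem rpow_le_sq_add_pow {γ : ℝ} (h2 : 2 ≤ γ) {n : ℕ} (hn : γ ≤ n) (A : ℝ≥0∞) :
    A ^ γ ≤ A ^ 2 + A ^ n := by
  rcases le_total A 1 with h | h
  · refine le_add_right ?_
    rw [← ENNReal.rpow_two]
    exact ENNReal.rpow_le_rpow_of_exponent_ge h h2
  · refine le_add_left ?_
    rw [← ENNReal.rpow_natCast]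
    exact ENNReal.rpow_le_rpow_of_exponent_le h hn

section Exponents

variable {γ τ : ℝ}

theorem alphaExp_pos (h2 : 2 < γ) (h6 : γ < 6) (hτ : 1 < τ) : 0 < alphaExp γ τ :=
  lt_min (div_pos (by linarith) (by linarith)) (div_pos (by linarith) (by linarith))

theorem two_mul_alphaExp_le_sub_two (h2 : 2 < γ) (hτ : 1 < τ) : 2 * alphaExp γ τ ≤ γ - 2 := by
  have : alphaExp γ τ ≤ (γ - 2) / (6 * τ) := min_le_left _ _
  have h : (γ - 2) / (6 * τ) ≤ (γ - 2) / 6 := by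
    apply div_le_div_of_nonneg_left <;> linarith
  linarith

theorem two_mul_alphaExp_lt_six_sub (h6 : γ < 6) (hτ : 1 < τ) : 2 * alphaExp γ τ < 6 - γ := by
  have : alphaExp γ τ ≤ (6 - γ) / (2 * τ) := min_le_right _ _
  have h : (6 - γ) / (2 * τ) < (6 - γ) / 2 := by
    apply div_lt_div_of_pos_left <;> linarith
  linarith

/-- Adding `6α ≤ γ - 2` and `2α < 6 - γ` gives `8α < 4`. This is why the first branch has the
denominator `6τ`: the exponent `θ = 2α` must not exceed `1`. -/
theorem two_mul_alphaExp_le_one (h2 : 2 < γ) (h6 : γ < 6) (hτ : 1 < τ) :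
    2 * alphaExp γ τ ≤ 1 := by
  have h3 : alphaExp γ τ ≤ (γ - 2) / (6 * τ) := min_le_left _ _
  have h4 : (γ - 2) / (6 * τ) ≤ (γ - 2) / 6 := by
    apply div_le_div_of_nonneg_left <;> linarith
  have h5 := two_mul_alphaExp_lt_six_sub h6 hτ
  linarith

/-- The only decreasing branch of `α` has slope `-1/(2τ) > -1/2`, so `γ + 2α(γ,τ)` does not
decrease. Hence the integrability assumed at `γ₂` also covers `γ₁`. -/
theorem betaExp_mono {γ' : ℝ} (h : γ ≤ γ') (h6 : γ' < 6) (hτ : 1 < τ) :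
    betaExp γ τ ≤ betaExp γ' τ := by
  have h5 := two_mul_alphaExp_lt_six_sub h6 hτ
  refine div_le_div_of_nonneg_left (by norm_num) (by linarith) ?_
  have h1 : alphaExp γ τ ≤ alphaExp γ' τ + (γ' - γ) / 2 := by
    unfold alphaExp
    rw [min_add]
    refine min_le_min ?_ ?_
    · have : (γ - 2) / (6 * τ) ≤ (γ' - 2) / (6 * τ) := by gcongr
      linarith
    · have : (6 - γ) / (2 * τ) = (6 - γ') / (2 * τ) + (γ' - γ) / (2 * τ) := by ring
      have : (γ' - γ) / (2 * τ) ≤ (γ' - γ) / 2 := by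
        apply div_le_div_of_nonneg_left <;> linarith
      linarith
  linarith

theorem le_betaExp (h2 : 2 < γ) (h6 : γ < 6) (hτ : 1 < τ) : 4 / (6 - γ) ≤ betaExp γ τ := by
  have h5 := two_mul_alphaExp_lt_six_sub h6 hτ
  have h3 := alphaExp_pos h2 h6 hτ
  exact div_le_div_of_nonneg_left (by norm_num) (by linarith) (by linarith)

end Exponents

/-- The constant in `StrichartzBound.lintegral_split_le`. -/
def splitConst (γ τ : ℝ) (B C C' : ℝ≥0) : ℝ≥0∞ :=
  (B : ℝ≥0∞) ^ ((6 - γ) / 4) * (C : ℝ≥0∞) ^ ((γ - 2) / 4) * 9 ^ (γ - 1)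
    + (C' : ℝ≥0∞) ^ alphaExp γ τ * ((B : ℝ≥0∞) ^ ((6 - γ - 2 * alphaExp γ τ) / 4)
      * (C : ℝ≥0∞) ^ ((γ - 2 - 2 * alphaExp γ τ) / 4)) * 9 ^ (γ - 2 * (2 * alphaExp γ τ))

theorem splitConst_ne_top {γ τ : ℝ} (h2 : 2 < γ) (h6 : γ < 6) (hτ : 1 < τ) (B C C' : ℝ≥0) :
    splitConst γ τ B C C' ≠ ⊤ := by
  have h3 := (alphaExp_pos h2 h6 hτ).le
  have h4 := two_mul_alphaExp_le_sub_two h2 hτ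
  have h5 := two_mul_alphaExp_lt_six_sub h6 hτ
  have h7 := two_mul_alphaExp_le_one h2 h6 hτ
  have e1 : 0 ≤ (6 - γ) / 4 := by linarith
  have e2 : 0 ≤ (γ - 2) / 4 := by linarith
  have e3 : 0 ≤ γ - 1 := by linarith
  have e4 : 0 ≤ (6 - γ - 2 * alphaExp γ τ) / 4 := by linarith
  have e5 : 0 ≤ (γ - 2 - 2 * alphaExp γ τ) / 4 := by linarith
  have e6 : 0 ≤ γ - 2 * (2 * alphaExp γ τ) := by linarith
  unfold splitConst
  finiteness

/-- The term with `U₀` gains `g` because the middle piece is small. The term with `U₁ U₂` is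
estimated with `θ = 2α(γ,τ)` and gains `L^{α(γ,τ)}`, which is at most `L^α ≤ g` since `L ≤ 1`. In
both terms the powers of `A` add up to `γ`. -/
theorem StrichartzBound.lintegral_split_le {C C' B : ℝ≥0} {U₁ U₀ U₂ : ℝ × ℝ → ℝ≥0∞}
    {A a₀ L g : ℝ≥0∞} {R γ τ α : ℝ} 
    (h₁ : StrichartzBound C U₁ A) (h₀ : StrichartzBound C U₀ A) (h₀' : StrichartzBound C U₀ a₀)
    (h₂ : StrichartzBound C U₂ A) (ha₀ : a₀ ≤ g * A) (hL : L ≤ 1) (hLg : L ^ α ≤ g)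
    (hα : α ≤ alphaExp γ τ)
    (hq : ∫⁻ r in Icc (-R) R, ∫⁻ x, (U₁ (r, x) * U₂ (r, x)) ^ 2 ≤ C' * L * (A ^ 2 * A ^ 2))
    {Ψ : ℝ → ℝ≥0∞} (hΨ : AEMeasurable Ψ) (hΨR : ∀ᵐ r, R < |r| → Ψ r = 0)
    (h2 : 2 < γ) (h6 : γ < 6) (hτ : 1 < τ)
    (hB : ∫⁻ r, Ψ r ^ (4 / (6 - γ)) ≤ B) (hB' : ∫⁻ r, Ψ r ^ betaExp γ τ ≤ B) :
    ∫⁻ p, (U₁ p + U₀ p + U₂ p) ^ (γ - 2) * (U₀ p * (U₁ p + U₀ p + U₂ p) + U₁ p * U₂ p) * Ψ p.1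
      ≤ splitConst γ τ B C C' * A ^ γ * g := by
  have h3 := (alphaExp_pos h2 h6 hτ).le
  have h4 := two_mul_alphaExp_le_sub_two h2 hτ
  have h5 := two_mul_alphaExp_lt_six_sub h6 hτ
  have h7 := two_mul_alphaExp_le_one h2 h6 hτ
  have hW := h₁.add_add h₀ h₂
  have m₁ := h₁.measurable
  have m₀ := h₀.measurable
  have m₂ := h₂.measurable
  have t1 := h₀'.lintegral_mul_rpow_le hW hΨ h2.le h6 hB
  have t2 := hW.lintegral_mul_mul_rpow_le m₁ m₂
    (fun p => by rw [add_assoc]; exact le_self_add) (fun p => le_add_self) hq hΨ hΨR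
    (by linarith) h7 h4 h5 hB'
  have hm : AEMeasurable (fun p : ℝ × ℝ => Ψ p.1) := by
    exact hΨ.comp_quasiMeasurePreserving Measure.quasiMeasurePreserving_fst
  calc ∫⁻ p, (U₁ p + U₀ p + U₂ p) ^ (γ - 2) * (U₀ p * (U₁ p + U₀ p + U₂ p) + U₁ p * U₂ p) * Ψ p.1
      = ∫⁻ p, (U₀ p * (U₁ p + U₀ p + U₂ p) ^ (γ - 1) * Ψ p.1
          + U₁ p * U₂ p * (U₁ p + U₀ p + U₂ p) ^ (γ - 2) * Ψ p.1) := by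
        refine lintegral_congr fun p => ?_
        have : (U₁ p + U₀ p + U₂ p) ^ (γ - 1)
            = (U₁ p + U₀ p + U₂ p) ^ (γ - 2) * (U₁ p + U₀ p + U₂ p) := by
          nth_rewrite 3 [← ENNReal.rpow_one (U₁ p + U₀ p + U₂ p)]
          rw [← ENNReal.rpow_add_of_nonneg _ _ (by linarith) (by norm_num)]
          congr 1; ring
        rw [this]
        ring
    _ = (∫⁻ p, U₀ p * (U₁ p + U₀ p + U₂ p) ^ (γ - 1) * Ψ p.1)
          + ∫⁻ p, U₁ p * U₂ p * (U₁ p + U₀ p + U₂ p) ^ (γ - 2) * Ψ p.1 :=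
        lintegral_add_left' (by fun_prop) _
    _ ≤ _ := add_le_add t1 t2
    _ ≤ splitConst γ τ B C C' * A ^ γ * g := by
        rw [splitConst, add_mul, add_mul]
        refine add_le_add ?_ ?_
        · have e : A ^ γ = A * A ^ (γ - 1) := by
            nth_rewrite 2 [← ENNReal.rpow_one A]
            rw [← ENNReal.rpow_add_of_nonneg _ _ (by norm_num) (by linarith)]
            congr 1; ring
          rw [ENNReal.mul_rpow_of_nonneg _ _ (by linarith : 0 ≤ γ - 1), e]
          calc _ ≤ (B : ℝ≥0∞) ^ ((6 - γ) / 4) * (C : ℝ≥0∞) ^ ((γ - 2) / 4)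
                * ((g * A) * (9 ^ (γ - 1) * A ^ (γ - 1))) := by gcongr
            _ = _ := by ring
        · have e : A ^ γ = A ^ (4 * alphaExp γ τ) * A ^ (γ - 2 * (2 * alphaExp γ τ)) := by
            rw [← ENNReal.rpow_add_of_nonneg _ _ (by linarith) (by linarith)]
            congr 1; ring
          have e2 : (↑C' * L * (A ^ 2 * A ^ 2)) ^ (2 * alphaExp γ τ / 2)
              ≤ (C' : ℝ≥0∞) ^ alphaExp γ τ * g * A ^ (4 * alphaExp γ τ) := by
            rw [show 2 * alphaExp γ τ / 2 = alphaExp γ τ by ring,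
              ENNReal.mul_rpow_of_nonneg _ _ h3, ENNReal.mul_rpow_of_nonneg _ _ h3, ← pow_add,
              ← ENNReal.rpow_natCast A, ← ENNReal.rpow_mul]
            norm_num
            refine mul_le_mul' (mul_le_mul' le_rfl ?_) le_rfl
            exact (ENNReal.rpow_le_rpow_of_exponent_ge hL hα).trans hLg
          rw [ENNReal.mul_rpow_of_nonneg _ _ (by linarith : 0 ≤ γ - 2 * (2 * alphaExp γ τ)), e]
          calc _ ≤ (C' : ℝ≥0∞) ^ alphaExp γ τ * g * A ^ (4 * alphaExp γ τ)
                * ((B : ℝ≥0∞) ^ ((6 - γ - 2 * alphaExp γ τ) / 4)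
                * (C : ℝ≥0∞) ^ ((γ - 2 - 2 * alphaExp γ τ) / 4))
                * (9 ^ (γ - 2 * (2 * alphaExp γ τ)) * A ^ (γ - 2 * (2 * alphaExp γ τ))) := by
                  gcongr
            _ = _ := by ring

theorem lintegral_lintegral_mul_eq {F : ℝ × ℝ → ℝ≥0∞} (hF : Measurable F) {Ψ : ℝ → ℝ≥0∞}
    (hΨ : AEMeasurable Ψ) : ∫⁻ r, (∫⁻ x, F (r, x)) * Ψ r = ∫⁻ p, F p * Ψ p.1 := by
  have hm : AEMeasurable (fun p : ℝ × ℝ => Ψ p.1) (volume.prod volume) :=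
    hΨ.comp_quasiMeasurePreserving Measure.quasiMeasurePreserving_fst
  have hm' : AEMeasurable (fun p : ℝ × ℝ => F p * Ψ p.1) (volume.prod volume) :=
    hF.aemeasurable.mul hm
  rw [Measure.volume_eq_prod, lintegral_prod _ hm']
  exact lintegral_congr fun r => (lintegral_mul_const _ (by fun_prop)).symm

section ZeroDispersion

variable {γ₁ γ₂ τ c R : ℝ} {K : ℝ≥0}

theorem AdmissibleDensity.lintegral_rpow_betaExp_le {ψ : ℝ → ℝ} {γ : ℝ}
    (hψ : AdmissibleDensity ψ (ENNReal.ofReal (betaExp γ₂ τ)) R K)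
    (h2 : 2 < γ) (hγ : γ ≤ γ₂) (h6 : γ₂ < 6) (hτ : 1 < τ) :
    ∫⁻ r, ‖ψ r‖ₑ ^ (4 / (6 - γ)) ≤ (Real.toNNReal (2 * R) + K ^ betaExp γ₂ τ : ℝ≥0) ∧
      ∫⁻ r, ‖ψ r‖ₑ ^ betaExp γ τ ≤ (Real.toNNReal (2 * R) + K ^ betaExp γ₂ τ : ℝ≥0) := by
  have h1 := le_betaExp h2 (hγ.trans_lt h6) hτ
  have h3 := betaExp_mono hγ h6 hτ
  have h4 : 0 < 4 / (6 - γ) := div_pos (by norm_num) (by linarith)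
  exact ⟨lintegral_rpow_density_le h4 (h1.trans h3) hψ,
    lintegral_rpow_density_le (h4.trans_le h1) h3 hψ⟩

theorem AdmissibleDensity.integrable_of_betaExp {ψ : ℝ → ℝ}
    (hψ : AdmissibleDensity ψ (ENNReal.ofReal (betaExp γ₂ τ)) R K)
    (h2 : 2 < γ₂) (h6 : γ₂ < 6) (hτ : 1 < τ) : Integrable ψ := by
  refine ⟨hψ.memLp.aestronglyMeasurable, ?_⟩
  have h1 : 1 ≤ betaExp γ₂ τ := by
    refine le_trans ?_ (le_betaExp h2 h6 hτ)
    rw [one_le_div (by linarith)]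
    linarith
  have := lintegral_rpow_density_le one_pos h1 hψ
  simp only [ENNReal.rpow_one] at this
  exact this.trans_lt ENNReal.coe_lt_top

theorem nConverges_of_betaExp {V ψ : ℝ → ℝ} (hV : AssumptionA1 V γ₁ γ₂ c)
    (hψ : AdmissibleDensity ψ (ENNReal.ofReal (betaExp γ₂ τ)) R K)
    (h2 : 2 < γ₁) (h6 : γ₂ < 6) (hτ : 1 < τ) (f : L2) : NConverges V ψ f := by
  have h12 := hV.le
  obtain ⟨C, hC⟩ := exists_strichartz
  obtain ⟨u, hu⟩ := exists_jointRep f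
  have hS := strichartzBound_of_jointRep hC hu le_rfl
  have hm := hu.1
  have hΨ : AEMeasurable fun r => ‖ψ r‖ₑ := hψ.memLp.aestronglyMeasurable.enorm
  refine nConverges_of_lintegral hV hψ.memLp.aestronglyMeasurable ?_ ?_
  · have h6' : ∀ᵐ r, ∫⁻ x, ‖u (r, x)‖ₑ ^ 6 < ⊤ := by
      refine ae_lt_top (Measurable.lintegral_prod_right' (f := fun p => ‖u p‖ₑ ^ 6) (by fun_prop)) ?_
      have := hS.six_le
      rw [Measure.volume_eq_prod, lintegral_prod _ (by fun_prop)] at this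
      exact (this.trans_lt (by finiteness)).ne
    filter_upwards [h6'] with r hr
    have hb : ∀ γ : ℝ, 2 < γ → γ < 6 → ∫⁻ x, ‖T r f x‖ₑ ^ γ < ⊤ := by
      intro γ hγ hγ'
      calc ∫⁻ x, ‖T r f x‖ₑ ^ γ ≤ ∫⁻ x, (‖T r f x‖ₑ ^ 2 + ‖u (r, x)‖ₑ ^ 6) := by
            refine lintegral_mono_ae ?_
            filter_upwards [hu.2 r] with x hx
            rw [hx]
            exact rpow_le_sq_add_pow hγ.le (n := 6) (by exact_mod_cast hγ'.le) _
        _ = ‖T r f‖ₑ ^ 2 + ∫⁻ x, ‖u (r, x)‖ₑ ^ 6 := by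
            rw [lintegral_add_right _ (by fun_prop), enorm_sq_eq_lintegral]
        _ < ⊤ := by finiteness
    have hTm : AEMeasurable fun x => ‖T r f x‖ₑ := (Lp.aestronglyMeasurable _).enorm
    rw [lintegral_add_left' (by fun_prop)]
    exact ENNReal.add_lt_top.2 ⟨hb _ h2 (by linarith), hb _ (by linarith) h6⟩
  · have e : ∀ r, ∫⁻ x, (‖T r f x‖ₑ ^ γ₁ + ‖T r f x‖ₑ ^ γ₂)
        = ∫⁻ x, (fun p => ‖u p‖ₑ ^ γ₁ + ‖u p‖ₑ ^ γ₂) (r, x) := fun r => by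
      refine lintegral_congr_ae ?_
      filter_upwards [hu.2 r] with x hx
      simp only [hx]
    simp only [e]
    rw [lintegral_lintegral_mul_eq (F := fun p => ‖u p‖ₑ ^ γ₁ + ‖u p‖ₑ ^ γ₂) (by fun_prop) hΨ]
    have hb : ∀ γ, 2 < γ → γ ≤ γ₂ → ∫⁻ p, ‖u p‖ₑ ^ γ * ‖ψ p.1‖ₑ < ⊤ := by
      intro γ hγ hγ'
      refine (hS.lintegral_rpow_le hΨ hγ.le (by linarith)
        (hψ.lintegral_rpow_betaExp_le hγ hγ' h6 hτ).1).trans_lt ?_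
      have e1 : 0 ≤ (6 - γ) / 4 := by linarith
      have e2 : 0 ≤ (γ - 2) / 4 := by linarith
      finiteness
    simp only [add_mul]
    have hm' : AEMeasurable (fun p : ℝ × ℝ => ‖ψ p.1‖ₑ) :=
      hΨ.comp_quasiMeasurePreserving Measure.quasiMeasurePreserving_fst
    rw [lintegral_add_left' (by fun_prop)]
    exact ENNReal.add_lt_top.2 ⟨hb _ h2 h12, hb _ (by linarith) le_rfl⟩

/-- The pointwise splitting of `V` produces one term for each growth exponent; each is handled with
its own `α(γ,τ)`, and the minimum of the two serves both. Afterwards `A^γ ≤ A² + A⁶`, the source of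
`λ(1 + λ²)`. -/
theorem exists_N_split_le {C : ℝ≥0}
    (hC : ∀ f : L2, ∫⁻ r, ∫⁻ x, ‖T r f x‖ₑ ^ 6 ≤ C * ‖f‖ₑ ^ 6) (C' : ℝ≥0) (c R : ℝ) (K : ℝ≥0)
    (h2 : 2 < γ₁) (h12 : γ₁ ≤ γ₂) (h6 : γ₂ < 6) (hτ : 1 < τ) :
    ∃ D : ℝ≥0, ∀ (V ψ : ℝ → ℝ), AssumptionA1 V γ₁ γ₂ c →
      AdmissibleDensity ψ (ENNReal.ofReal (betaExp γ₂ τ)) R K →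
      ∀ (f₁ f₀ f₂ : L2) (A L g : ℝ≥0∞), ‖f₁‖ₑ ≤ A → ‖f₀‖ₑ ≤ A → ‖f₂‖ₑ ≤ A → ‖f₀‖ₑ ≤ g * A →
      L ≤ 1 → L ^ min (alphaExp γ₁ τ) (alphaExp γ₂ τ) ≤ g →
      ∫⁻ r in Icc (-R) R, ∫⁻ x, (‖T r f₁ x‖ₑ * ‖T r f₂ x‖ₑ) ^ 2 ≤ C' * L * (A ^ 2 * A ^ 2) →
      ENNReal.ofReal (N V ψ (f₁ + f₀ + f₂) - N V ψ f₁ - N V ψ f₂) ≤ D * (A ^ 2 + A ^ 6) * g := by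
  set B : ℝ≥0 := Real.toNNReal (2 * R) + K ^ betaExp γ₂ τ with hB
  have hfin₁ := splitConst_ne_top h2 (h12.trans_lt h6) hτ B C C'
  have hfin₂ := splitConst_ne_top (h2.trans_le h12) h6 hτ B C C'
  refine ⟨(ENNReal.ofReal (3 * c) * (splitConst γ₁ τ B C C' + splitConst γ₂ τ B C C')).toNNReal, ?_⟩
  rw [ENNReal.coe_toNNReal (by finiteness)]
  intro V ψ hV hψ f₁ f₀ f₂ A L g h₁ h₀ h₂ h₀' hL hLg hq
  have hconv := nConverges_of_betaExp hV hψ h2 h6 hτ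
  refine (N_split_le (hconv _) (hconv _) (hconv _)).trans ?_
  obtain ⟨u₁, hu₁⟩ := exists_jointRep f₁
  obtain ⟨u₀, hu₀⟩ := exists_jointRep f₀
  obtain ⟨u₂, hu₂⟩ := exists_jointRep f₂
  have m₁ := hu₁.1
  have m₀ := hu₀.1
  have m₂ := hu₂.1
  have hΨ : AEMeasurable fun r => ‖ψ r‖ₑ := hψ.memLp.aestronglyMeasurable.enorm
  have hΨ' : AEMeasurable (fun p : ℝ × ℝ => ‖ψ p.1‖ₑ) :=
    hΨ.comp_quasiMeasurePreserving Measure.quasiMeasurePreserving_fst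
  set F : ℝ → ℝ × ℝ → ℝ≥0∞ := fun γ p => (‖u₁ p‖ₑ + ‖u₀ p‖ₑ + ‖u₂ p‖ₑ) ^ (γ - 2) *
    (‖u₀ p‖ₑ * (‖u₁ p‖ₑ + ‖u₀ p‖ₑ + ‖u₂ p‖ₑ) + ‖u₁ p‖ₑ * ‖u₂ p‖ₑ) with hF
  have hFm : ∀ γ, Measurable (F γ) := fun γ => by
    simp only [hF]
    fun_prop
  have hq' : ∫⁻ r in Icc (-R) R, ∫⁻ x, (‖u₁ (r, x)‖ₑ * ‖u₂ (r, x)‖ₑ) ^ 2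
      ≤ C' * L * (A ^ 2 * A ^ 2) := by
    refine le_trans (le_of_eq (lintegral_congr fun r => lintegral_congr_ae ?_)) hq
    filter_upwards [hu₁.2 r, hu₂.2 r] with x h1 h2
    rw [h1, h2]
  have hγ : ∀ γ, 2 < γ → γ ≤ γ₂ → min (alphaExp γ₁ τ) (alphaExp γ₂ τ) ≤ alphaExp γ τ →
      ∫⁻ p, F γ p * ‖ψ p.1‖ₑ ≤ splitConst γ τ B C C' * ((A ^ 2 + A ^ 6) * g) := by
    intro γ hγ hγ' hα
    have hBs := hψ.lintegral_rpow_betaExp_le hγ hγ' h6 hτ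
    refine (StrichartzBound.lintegral_split_le (strichartzBound_of_jointRep hC hu₁ h₁)
      (strichartzBound_of_jointRep hC hu₀ h₀) (strichartzBound_of_jointRep hC hu₀ le_rfl)
      (strichartzBound_of_jointRep hC hu₂ h₂) h₀' hL hLg hα hq' hΨ ?_ hγ (hγ'.trans_lt h6) hτ
      hBs.1 hBs.2).trans ?_
    · filter_upwards [hψ.support] with r hr h
      simp [hr h]
    · rw [mul_assoc]
      gcongr
      exact rpow_le_sq_add_pow hγ.le (n := 6) (by exact_mod_cast (hγ'.trans h6.le)) _
  calc ∫⁻ r, (∫⁻ x, ‖V ‖T r (f₁ + f₀ + f₂) x‖ - V ‖T r f₁ x‖ - V ‖T r f₂ x‖‖ₑ) * ‖ψ r‖ₑ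
      ≤ ∫⁻ r, (∫⁻ x, (fun p => ENNReal.ofReal (3 * c) * (F γ₁ p + F γ₂ p)) (r, x)) * ‖ψ r‖ₑ := by
        refine lintegral_mono fun r => mul_le_mul' (lintegral_mono_ae ?_) le_rfl
        rw [T_add, T_add]
        filter_upwards [hu₁.2 r, hu₀.2 r, hu₂.2 r, Lp.coeFn_add (T r f₁ + T r f₀) (T r f₂),
          Lp.coeFn_add (T r f₁) (T r f₀)] with x h1 h3 h4 h5 h7
        rw [h5, Pi.add_apply, h7, Pi.add_apply, ← h1, ← h3, ← h4]
        refine (hV.enorm_split_le _ _ _).trans (le_of_eq ?_)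
        simp only [hF]
        ring
    _ = ∫⁻ p, ENNReal.ofReal (3 * c) * (F γ₁ p + F γ₂ p) * ‖ψ p.1‖ₑ :=
        lintegral_lintegral_mul_eq
          (F := fun p => ENNReal.ofReal (3 * c) * (F γ₁ p + F γ₂ p)) (by fun_prop) hΨ
    _ = ENNReal.ofReal (3 * c) * ((∫⁻ p, F γ₁ p * ‖ψ p.1‖ₑ) + ∫⁻ p, F γ₂ p * ‖ψ p.1‖ₑ) := by
        rw [← lintegral_add_left' (by fun_prop), ← lintegral_const_mul'' _ (by fun_prop)]
        refine lintegral_congr fun p => ?_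
        ring
    _ ≤ ENNReal.ofReal (3 * c) * (splitConst γ₁ τ B C C' * ((A ^ 2 + A ^ 6) * g)
          + splitConst γ₂ τ B C C' * ((A ^ 2 + A ^ 6) * g)) := by
        gcongr
        · exact hγ γ₁ h2 h12 (min_le_left _ _)
        · exact hγ γ₂ (by linarith) le_rfl (min_le_right _ _)
    _ = _ := by ring

theorem ofReal_norm_sq (f : L2) : ENNReal.ofReal (‖f‖ ^ 2) = ‖f‖ₑ ^ 2 := by
  rw [ENNReal.ofReal_pow (norm_nonneg _), ofReal_norm]

theorem G_ne_top {α s : ℝ} (hα : 0 < α) (hs : 0 < s) : G α s ≠ ⊤ := by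
  have : 1 < (s + 1) ^ (2 * α / (1 + 2 * α)) := Real.one_lt_rpow (by linarith) (by positivity)
  rw [G, Ne, ENNReal.rpow_eq_top_iff]
  simp
  linarith

/-! ### Cutting a function into three pieces -/

theorem le_norm_cut_sq {g : L2} {S S' : Set ℝ} {δ : ℝ}
    (hSS' : S ⊆ S') (hS' : MeasurableSet S') (h : δ ≤ ∫ x in S, ‖g x‖ ^ 2) :
    δ ≤ ‖cut S' g‖ ^ 2 := by
  rw [norm_cut_sq hS']
  refine h.trans (setIntegral_mono_set (integrable_norm_sq g).integrableOn
    (Filter.Eventually.of_forall fun x => by positivity) hSS'.eventuallyLE)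

theorem cut_Iio_add_cut_Ico_add_cut_Ici {p q : ℝ} (hpq : p ≤ q) (g : L2) :
    cut (Iio p) g + cut (Ico p q) g + cut (Ici q) g = g := by
  apply Lp.ext
  filter_upwards [Lp.coeFn_add (cut (Iio p) g + cut (Ico p q) g) (cut (Ici q) g),
    Lp.coeFn_add (cut (Iio p) g) (cut (Ico p q) g), cut_ae measurableSet_Iio g (S := Iio p),
    cut_ae measurableSet_Ico g (S := Ico p q), cut_ae measurableSet_Ici g (S := Ici q)]
    with x h1 h2 h3 h4 h5
  rw [h1, Pi.add_apply, h2, Pi.add_apply, h3, h4, h5]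
  simp only [indicator, mem_Iio, mem_Ico, mem_Ici]
  rcases lt_or_ge x p with h | h
  · simp [h, h.not_ge, (h.trans_le hpq).not_ge]
  · rcases lt_or_ge x q with h' | h'
    · simp [h, h', h.not_gt, h'.not_ge]
    · simp [h, h', h.not_gt, h'.not_gt]

theorem norm_sq_add_norm_sq_le {p q : ℝ} (hpq : p ≤ q) (g : L2) :
    ‖cut (Iio p) g‖ ^ 2 + ‖cut (Ici q) g‖ ^ 2 ≤ ‖g‖ ^ 2 := by
  rw [norm_cut_sq measurableSet_Iio, norm_cut_sq measurableSet_Ici, norm_sq_eq_integral,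
    ← setIntegral_union (Set.disjoint_left.2 fun x hx hx' => (hx.trans_le hpq).not_ge hx')
      measurableSet_Ici (integrable_norm_sq g).integrableOn (integrable_norm_sq g).integrableOn]
  exact setIntegral_le_integral (integrable_norm_sq g)
    (Filter.Eventually.of_forall fun x => by positivity)

/-- Space tails and frequency tails are treated at once. The function `g` is the side on which the
cut is made, and `Φ g` is the initial datum: `Φ` is the identity with `κ = 1`, or the inverse
Fourier transform with `κ = 1/(2π)`. Only additivity, isometry and a bilinear estimate are used. -/
theorem exists_le_H_zero (c R : ℝ) (K : ℝ≥0) (h2 : 2 < γ₁) (h12 : γ₁ ≤ γ₂) (h6 : γ₂ < 6)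
    (hτ : 1 < τ) {Φ : L2 → L2} (hΦadd : ∀ g h, Φ (g + h) = Φ g + Φ h)
    (hΦ : ∀ g, ‖Φ g‖ₑ = ‖g‖ₑ) {κ : ℝ} (hκ : 0 < κ) {C' : ℝ≥0}
    (hbil : ∀ (g h : L2) (a b : ℝ), a < b → (∀ᵐ x, κ * a < x → g x = 0) →
      (∀ᵐ x, x < κ * b → h x = 0) →
      ∫⁻ r in Icc (-R) R, ∫⁻ x, (‖T r (Φ g) x‖ₑ * ‖T r (Φ h) x‖ₑ) ^ 2
        ≤ C' * ENNReal.ofReal (b - a)⁻¹ * (‖g‖ₑ ^ 2 * ‖h‖ₑ ^ 2)) :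
    ∃ D : ℝ≥0, ∀ (V ψ : ℝ → ℝ) (γ₀ : ℝ), AssumptionA1 V γ₁ γ₂ c → AssumptionA2 V γ₀ →
      AdmissibleDensity ψ (ENNReal.ofReal (betaExp γ₂ τ)) R K →
      ∀ (lam δ a b : ℝ) (g : L2), 0 < lam → ‖g‖ ^ 2 = lam → 0 < δ → δ < lam / 2 →
        HasFatTails g δ (κ * a) (κ * b) → 1 < b - a →
        (factor γ₀ δ lam : EReal) * E 0 V ψ lam
            - ((D * ENNReal.ofReal (lam * (1 + lam ^ 2))
                * G (min (alphaExp γ₁ τ) (alphaExp γ₂ τ)) (b - a - 1) : ℝ≥0∞) : EReal)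
          ≤ H 0 V ψ (Φ g) := by
  obtain ⟨C, hC⟩ := exists_strichartz
  obtain ⟨D, hD⟩ := exists_N_split_le hC C' c R K h2 h12 h6 hτ
  refine ⟨D, fun V ψ γ₀ hV hV' hψ lam δ a b g hlam hg hδ hδlam htail hab => ?_⟩
  set α := min (alphaExp γ₁ τ) (alphaExp γ₂ τ) with hα
  have hα0 : 0 < α := lt_min (alphaExp_pos h2 (by linarith) hτ) (alphaExp_pos (by linarith) h6 hτ)
  have hconv := nConverges_of_betaExp hV hψ h2 h6 hτ
  have hE := E_nonpos (d := 0) hV h2 (hψ.integrable_of_betaExp (by linarith) h6 hτ) hlam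
  obtain ⟨a', ℓ, hℓ, haa', hb, hL, hmass⟩ := exists_window_G g hκ hα0 hab
  have hpq : κ * a' ≤ κ * (a' + ℓ) := by gcongr; linarith
  set g₁ := cut (Iio (κ * a')) g with hg₁
  set g₀ := cut (Ico (κ * a') (κ * (a' + ℓ))) g with hg₀
  set g₂ := cut (Ici (κ * (a' + ℓ))) g with hg₂
  have hsum : Φ g = Φ g₁ + Φ g₀ + Φ g₂ := by
    rw [← hΦadd, ← hΦadd, cut_Iio_add_cut_Ico_add_cut_Ici hpq]
  have n₁ : ‖g₁‖ₑ ≤ ‖g‖ₑ := enorm_cut_le measurableSet_Iio g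
  have n₀ : ‖g₀‖ₑ ≤ ‖g‖ₑ := enorm_cut_le measurableSet_Ico g
  have n₂ : ‖g₂‖ₑ ≤ ‖g‖ₑ := enorm_cut_le measurableSet_Ici g
  have hG0 := G_ne_top hα0 (s := b - a - 1) (by linarith)
  have hbound := hD V ψ hV hψ (Φ g₁) (Φ g₀) (Φ g₂) ‖g‖ₑ (ENNReal.ofReal ℓ⁻¹) (G α (b - a - 1))
    (by rwa [hΦ]) (by rwa [hΦ]) (by rwa [hΦ]) (by rwa [hΦ])
    (by rw [ENNReal.ofReal_le_one]; exact inv_le_one_of_one_le₀ hℓ) hL (by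
      refine (hbil g₁ g₂ a' (a' + ℓ) (by linarith) ?_ ?_).trans ?_
      · filter_upwards [cut_ae measurableSet_Iio g (S := Iio (κ * a'))] with x hx h
        rw [hx, indicator_of_notMem (by simpa using h.le)]
      · filter_upwards [cut_ae measurableSet_Ici g (S := Ici (κ * (a' + ℓ)))] with x hx h
        rw [hx, indicator_of_notMem (by simpa using h)]
      · rw [add_sub_cancel_left]
        gcongr)
  rw [← hsum] at hbound
  have hA : ‖g‖ₑ ^ 2 + ‖g‖ₑ ^ 6 = ENNReal.ofReal (lam * (1 + lam ^ 2)) := by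
    rw [show 6 = 2 * 3 from rfl, pow_mul, ← ofReal_norm_sq, hg, ← ENNReal.ofReal_pow hlam.le,
      ← ENNReal.ofReal_add hlam.le (by positivity)]
    congr 1
    ring
  rw [hA] at hbound
  set err := D * ENNReal.ofReal (lam * (1 + lam ^ 2)) * G α (b - a - 1) with herr
  have herr' : err ≠ ⊤ := by finiteness
  have e1 : ((err : ℝ≥0∞) : EReal) = ((err.toReal : ℝ) : EReal) :=
    (EReal.coe_ennreal_toReal herr').symm
  have hN : N V ψ (Φ g) - N V ψ (Φ g₁) - N V ψ (Φ g₂) ≤ err.toReal :=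
    (ENNReal.ofReal_le_iff_le_toReal herr').1 hbound
  have hΦn : ∀ g, ‖Φ g‖ = ‖g‖ := fun g => by
    have := congrArg ENNReal.toReal (hΦ g)
    simpa using this
  have hle : ‖g₁‖ ^ 2 + ‖g₂‖ ^ 2 ≤ lam := hg ▸ norm_sq_add_norm_sq_le hpq g
  have hm₁ : δ ≤ ‖g₁‖ ^ 2 := by
    refine le_norm_cut_sq (Iio_subset_Iio (show κ * a ≤ κ * a' by gcongr)) measurableSet_Iio ?_
    rw [← integral_Iic_eq_integral_Iio]
    exact htail.1
  have hm₂ : δ ≤ ‖g₂‖ ^ 2 :=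
    le_norm_cut_sq (Ici_subset_Ici.2 (by gcongr)) measurableSet_Ici htail.2
  have hscale : ∀ h : L2, 0 < ‖h‖ ^ 2 → ‖h‖ ^ 2 ≤ lam → ∀ e : ℝ, (e : EReal) ≤ E 0 V ψ lam →
      (‖h‖ ^ 2 / lam) ^ (γ₀ / 2) * e ≤ - N V ψ (Φ h) := by
    intro h h0 hl e he
    have := le_energy_of_le_E (k := 0) (f := Φ h) hV' hψ.nonneg he
      (by rw [hΦn]; exact (norm_nonneg _).lt_of_ne (sq_pos_iff.1 h0).symm) (by rwa [hΦn]) le_rfl (fun t ht => by simp)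
      (fun t ht => hconv _)
    rwa [hΦn, zero_sub] at this
  rw [e1]
  refine factor_mul_E_sub_le (h := -N V ψ (Φ g)) hV'.two_lt hE hδ hδlam hm₁ hm₂ hle
    (hscale g₁ (by linarith) (by nlinarith [sq_nonneg ‖g₂‖]))
    (hscale g₂ (by linarith) (by nlinarith [sq_nonneg ‖g₁‖])) (by linarith) ?_
  simp [H]

/-- The energy inequality at zero average dispersion. -/
theorem exists_zero_dispersion (c R : ℝ) (K : ℝ≥0) (h2 : 2 < γ₁) (h12 : γ₁ ≤ γ₂) (h6 : γ₂ < 6)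
    (hτ : 1 < τ) :
    ∃ D : ℝ≥0, 0 < D ∧ ∀ (V ψ : ℝ → ℝ) (γ₀ : ℝ), AssumptionA1 V γ₁ γ₂ c → AssumptionA2 V γ₀ →
      AdmissibleDensity ψ (ENNReal.ofReal (betaExp γ₂ τ)) R K →
      ∀ (lam δ a b : ℝ) (f : L2), 0 < lam → ‖f‖ ^ 2 = lam → 0 < δ → δ < lam / 2 →
        (HasFatTails f δ a b ∨ HasFatTails (hat f) δ a b) →
        (factor γ₀ δ lam : EReal) * E 0 V ψ lam
            - ((D * ENNReal.ofReal (lam * (1 + lam ^ 2))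
                * G (min (alphaExp γ₁ τ) (alphaExp γ₂ τ)) (max (b - a - 1) 0) : ℝ≥0∞) : EReal)
          ≤ H 0 V ψ f := by
  obtain ⟨C₁, hC₁⟩ := exists_bilinear_space R
  obtain ⟨C₂, hC₂⟩ := exists_bilinear_fourier
  have hp : 0 < 2 * Real.pi := by positivity
  obtain ⟨D₁, hD₁⟩ := exists_le_H_zero (Φ := fun g => g) (κ := 1) (C' := C₁) c R K h2 h12 h6 hτ
    (fun _ _ => rfl) (fun _ => rfl) one_pos (fun g h a b hab hg hh => by
      simp only [one_mul] at hg hh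
      exact hC₁ g h a b hab hg hh)
  obtain ⟨D₂, hD₂⟩ := exists_le_H_zero (Φ := fun g => (𝓕⁻ g : L2)) (κ := (2 * Real.pi)⁻¹)
    (C' := C₂ * Real.toNNReal (2 * Real.pi)) c R K h2 h12 h6 hτ
    (fun g h => FourierTransform.fourierInv_add g h)
    (fun g => enorm_fourierInv g) (by positivity) (fun g h a b hab hg hh => by
      refine (setLIntegral_le_lintegral _ _).trans ((hC₂ (𝓕⁻ g) (𝓕⁻ h) ((2 * Real.pi)⁻¹ * a)
        ((2 * Real.pi)⁻¹ * b) (by gcongr) ?_ ?_).trans (le_of_eq ?_))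
      · rwa [FourierTransform.fourier_fourierInv_eq]
      · rwa [FourierTransform.fourier_fourierInv_eq]
      · rw [enorm_fourierInv, enorm_fourierInv, ← mul_sub, mul_inv, inv_inv,
          ENNReal.ofReal_mul hp.le, ENNReal.coe_mul]
        simp only [ENNReal.ofReal, mul_assoc])
  -- The added `1` makes the constant positive, so that its product with `G α 0 = ∞` is `∞`. The
  -- claim is then trivial for `b - a ≤ 1`, the left side being `-∞`.
  refine ⟨D₁ + D₂ + 1, by positivity, fun V ψ γ₀ hV hV' hψ lam δ a b f hlam hf hδ hδlam htail => ?_⟩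
  rcases le_or_gt (b - a) 1 with hab | hab
  · rw [max_eq_right (by linarith), G_zero, ENNReal.mul_top]
    · simp
    · have : 0 < lam * (1 + lam ^ 2) := by positivity
      simp [this]
  rw [max_eq_left (by linarith)]
  have mono : ∀ D : ℝ≥0, D ≤ D₁ + D₂ + 1 → ∀ (x : EReal) (u v : ℝ≥0∞),
      x - (((D₁ + D₂ + 1 : ℝ≥0) * u * v : ℝ≥0∞) : EReal) ≤ x - ((D * u * v : ℝ≥0∞) : EReal) := by
    intro D hD x u v
    refine EReal.sub_le_sub le_rfl (EReal.coe_ennreal_le_coe_ennreal_iff.2 ?_)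
    gcongr
  rcases htail with h | h
  · refine (mono D₁ (by rw [add_assoc]; exact le_self_add) _ _ _).trans
      (hD₁ V ψ γ₀ hV hV' hψ lam δ a b f hlam hf hδ hδlam (by simpa using h) hab)
  · have := hD₂ V ψ γ₀ hV hV' hψ lam δ a b (𝓕 f) hlam
      (by rw [← hf]; congr 1; exact Lp.norm_fourier_eq f) hδ hδlam h.hat hab
    rw [FourierTransform.fourierInv_fourier_eq] at this
    exact (mono D₂ (by rw [add_right_comm]; exact le_add_self) _ _ _).trans this

end ZeroDispersion

/-! ### Smooth cutoffs -/

/-- A smooth cutoff function with Lipschitz constant `L`. -/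
structure Cutoff (L : ℝ) (χ : ℝ → ℝ) : Prop where
  growth : (fun x => (χ x : ℂ)).HasTemperateGrowth
  contDiff : ContDiff ℝ 1 χ
  nonneg : ∀ x, 0 ≤ χ x
  le_one : ∀ x, χ x ≤ 1
  abs_deriv_le : ∀ x, |deriv χ x| ≤ L

/-- Multiplication by a real function. -/
def rmul (χ : ℝ → ℝ) (f : L2) : L2 := bmul (fun x => (χ x : ℂ)) f

theorem rmul_ae {χ : ℝ → ℝ} (hχ : Measurable χ) {K : ℝ} (hK : ∀ x, |χ x| ≤ K) (f : L2) :
    rmul χ f =ᵐ[volume] fun x => (χ x : ℂ) * f x :=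
  bmul_ae (χ := fun x => (χ x : ℂ)) (by fun_prop) (K := K) (fun x => by simpa using hK x) f

theorem norm_rmul_le {χ : ℝ → ℝ} (hχ : Measurable χ) {K : ℝ} (hK : ∀ x, |χ x| ≤ K) (f : L2) :
    ‖rmul χ f‖ ≤ K * ‖f‖ := by
  refine Lp.norm_le_mul_norm_of_ae_le_mul ?_
  filter_upwards [rmul_ae hχ hK f] with x hx
  rw [hx, norm_mul, Complex.norm_real]
  exact mul_le_mul_of_nonneg_right (hK x) (norm_nonneg _)

theorem exists_clm_rmul {χ : ℝ → ℝ} (hχ : Measurable χ) {K : ℝ} (hK : ∀ x, |χ x| ≤ K) :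
    ∃ A : L2 →L[ℂ] L2, ∀ f, A f = rmul χ f := by
  refine ⟨LinearMap.mkContinuous
    { toFun := rmul χ
      map_add' := fun f g => ?_
      map_smul' := fun c f => ?_ } K (norm_rmul_le hχ hK), fun f => rfl⟩
  · apply Lp.ext
    filter_upwards [rmul_ae hχ hK (f + g), rmul_ae hχ hK f, rmul_ae hχ hK g, Lp.coeFn_add f g,
      Lp.coeFn_add (rmul χ f) (rmul χ g)] with x h1 h2 h3 h4 h5
    rw [h1, h5, h4, Pi.add_apply, Pi.add_apply, h2, h3, mul_add]
  · apply Lp.ext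
    filter_upwards [rmul_ae hχ hK (c • f), rmul_ae hχ hK f, Lp.coeFn_smul c f,
      Lp.coeFn_smul c (rmul χ f)] with x h1 h2 h3 h4
    simp only [RingHom.id_apply]
    rw [h1, h4, h3, Pi.smul_apply, Pi.smul_apply, h2]
    simp only [smul_eq_mul]
    ring

theorem inner_rmul_left {χ : ℝ → ℝ} (hχ : Measurable χ) {K : ℝ} (hK : ∀ x, |χ x| ≤ K) (f g : L2) :
    inner ℂ (rmul χ f) g = inner ℂ f (rmul χ g) := by
  rw [L2.inner_def, L2.inner_def]
  refine integral_congr_ae ?_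
  filter_upwards [rmul_ae hχ hK f, rmul_ae hχ hK g] with x h1 h2
  rw [h1, h2]
  simp
  ring

theorem rmul_comm {χ η : ℝ → ℝ} (hχ : Measurable χ) {K : ℝ} (hK : ∀ x, |χ x| ≤ K)
    (hη : Measurable η) {K' : ℝ} (hK' : ∀ x, |η x| ≤ K') (f : L2) :
    rmul χ (rmul η f) = rmul η (rmul χ f) := by
  apply Lp.ext
  filter_upwards [rmul_ae hχ hK (rmul η f), rmul_ae hη hK' (rmul χ f), rmul_ae hχ hK f,
    rmul_ae hη hK' f] with x h1 h2 h3 h4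
  rw [h1, h2, h3, h4]
  ring

namespace Cutoff

variable {L : ℝ} {χ : ℝ → ℝ}

theorem abs_le_one (h : Cutoff L χ) (x : ℝ) : |χ x| ≤ 1 :=
  abs_le.2 ⟨by linarith [h.nonneg x], h.le_one x⟩

theorem measurable (h : Cutoff L χ) : Measurable χ := h.contDiff.continuous.measurable

theorem measurable_deriv (_h : Cutoff L χ) : Measurable (deriv χ) := _root_.measurable_deriv χ

theorem const_nonneg (h : Cutoff L χ) : 0 ≤ L := (abs_nonneg _).trans (h.abs_deriv_le 0)

theorem ae_eq (h : Cutoff L χ) (f : L2) : rmul χ f =ᵐ[volume] fun x => (χ x : ℂ) * f x :=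
  rmul_ae h.measurable h.abs_le_one f

theorem deriv_ae_eq (h : Cutoff L χ) (f : L2) :
    rmul (deriv χ) f =ᵐ[volume] fun x => ((deriv χ x : ℝ) : ℂ) * f x :=
  rmul_ae h.measurable_deriv h.abs_deriv_le f

theorem norm_le (h : Cutoff L χ) (f : L2) : ‖rmul χ f‖ ≤ ‖f‖ := by
  simpa using norm_rmul_le h.measurable h.abs_le_one f

theorem norm_deriv_le (h : Cutoff L χ) (f : L2) : ‖rmul (deriv χ) f‖ ≤ L * ‖f‖ :=
  norm_rmul_le h.measurable_deriv h.abs_deriv_le f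

theorem hasDerivAt (h : Cutoff L χ) (x : ℝ) :
    HasDerivAt (fun x => (χ x : ℂ)) ((deriv χ x : ℝ) : ℂ) x :=
  ((h.contDiff.differentiable (by norm_num)) x).hasDerivAt.ofReal_comp

theorem one_sub (h : Cutoff L χ) : Cutoff L fun x => 1 - χ x where
  growth := by
    have := h.growth
    simp only [Complex.ofReal_sub]
    fun_prop
  contDiff := contDiff_const.sub h.contDiff
  nonneg x := by linarith [h.le_one x]
  le_one x := by linarith [h.nonneg x]
  abs_deriv_le x := by
    rw [deriv_const_sub, abs_neg]
    exact h.abs_deriv_le x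

end Cutoff

theorem isWeakDeriv_iff_integral_deriv {f g : L2} : IsWeakDeriv f g ↔
    ∀ φ : SchwartzMap ℝ ℂ, ∫ x, -(deriv φ x * f x) = ∫ x, φ x * g x := by
  have e1 : ∀ φ : SchwartzMap ℝ ℂ,
      TemperedDistribution.derivCLM ℂ (Lp.toTemperedDistribution f) φ
        = ∫ x, -(deriv φ x * f x) := by
    intro φ
    rw [TemperedDistribution.derivCLM_apply_apply, Lp.toTemperedDistribution_apply]
    refine integral_congr_ae (Filter.Eventually.of_forall fun x => ?_)
    simp
  have e2 : ∀ φ : SchwartzMap ℝ ℂ, Lp.toTemperedDistribution g φ = ∫ x, φ x * g x := by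
    intro φ
    rw [Lp.toTemperedDistribution_apply]
    rfl
  constructor
  · intro h φ
    rw [← e1, ← e2, h]
  · intro h
    show TemperedDistribution.derivCLM ℂ (Lp.toTemperedDistribution f) = _
    ext φ
    rw [e1, e2, h]

theorem integrable_schwartz_mul (φ : SchwartzMap ℝ ℂ) (f : L2) :
    Integrable fun x => φ x * f x :=
  (SchwartzMap.memLp φ 2 volume).integrable_mul (Lp.memLp f)

/-- The Leibniz rule for weak derivatives. -/
theorem Cutoff.isWeakDeriv {L : ℝ} {χ : ℝ → ℝ} (h : Cutoff L χ) {f g : L2}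
    (hfg : IsWeakDeriv f g) :
    IsWeakDeriv (rmul χ f) (rmul (deriv χ) f + rmul χ g) := by
  rw [isWeakDeriv_iff_integral_deriv] at hfg ⊢
  intro φ
  -- The cutoff is moved onto the test function: the definition for `f` is applied to `χφ`, which is
  -- Schwartz because `χ` has temperate growth.
  set φχ : SchwartzMap ℝ ℂ := SchwartzMap.smulLeftCLM ℂ (fun x => (χ x : ℂ)) φ with hφχ
  have e0 : ∀ x, φχ x = χ x * φ x := fun x => by
    rw [hφχ, SchwartzMap.smulLeftCLM_apply_apply h.growth, smul_eq_mul]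
  have e1 : ∀ x, deriv φχ x = ((deriv χ x : ℝ) : ℂ) * φ x + χ x * deriv φ x := fun x => by
    have : (φχ : ℝ → ℂ) = fun x => (χ x : ℂ) * φ x := funext e0
    rw [this]
    exact ((h.hasDerivAt x).mul φ.differentiableAt.hasDerivAt).deriv
  have i1 : Integrable fun x => -(deriv φχ x * f x) := by
    have := (integrable_schwartz_mul (SchwartzMap.derivCLM ℂ ℂ φχ) f).neg
    simpa using this
  have i2 := integrable_schwartz_mul φ (rmul (deriv χ) f)
  calc ∫ x, -(deriv φ x * (rmul χ f) x)
      = ∫ x, (-(deriv φχ x * f x) + φ x * (rmul (deriv χ) f) x) := by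
        refine integral_congr_ae ?_
        filter_upwards [h.ae_eq f, h.deriv_ae_eq f] with x h1 h2
        rw [h1, h2, e1]
        ring
    _ = (∫ x, φχ x * g x) + ∫ x, φ x * (rmul (deriv χ) f) x := by
        rw [integral_add i1 i2, hfg]
    _ = ∫ x, (φχ x * g x + φ x * (rmul (deriv χ) f) x) :=
        (integral_add (integrable_schwartz_mul φχ g) i2).symm
    _ = _ := by
        refine integral_congr_ae ?_
        filter_upwards [h.ae_eq g, Lp.coeFn_add (rmul (deriv χ) f) (rmul χ g)] with x h1 h2
        rw [h2, Pi.add_apply, h1, e0]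
        ring

/-- A smooth step from `0` on `(-∞, p]` to `1` on `[p + w, ∞)`. -/
def step (p w x : ℝ) : ℝ := Real.smoothTransition ((x - p) / w)

theorem step_eq_zero {p w x : ℝ} (hw : 0 < w) (hx : x ≤ p) : step p w x = 0 :=
  Real.smoothTransition.zero_of_nonpos (div_nonpos_of_nonpos_of_nonneg (by linarith) hw.le)

theorem step_eq_one {p w x : ℝ} (hw : 0 < w) (hx : p + w ≤ x) : step p w x = 1 :=
  Real.smoothTransition.one_of_one_le (by rw [one_le_div hw]; linarith)

theorem hasCompactSupport_deriv_step {p w : ℝ} (hw : 0 < w) :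
    HasCompactSupport (deriv (step p w)) := by
  refine HasCompactSupport.intro (K := Icc p (p + w)) isCompact_Icc fun x hx => ?_
  rw [mem_Icc, not_and_or, not_le, not_le] at hx
  rcases hx with hx | hx
  · have : step p w =ᶠ[nhds x] fun _ => 0 := by
      filter_upwards [Iio_mem_nhds hx] with y hy using step_eq_zero hw (le_of_lt hy)
    rw [this.deriv_eq, deriv_const]
  · have : step p w =ᶠ[nhds x] fun _ => 1 := by
      filter_upwards [Ioi_mem_nhds hx] with y hy using step_eq_one hw (le_of_lt hy)
    rw [this.deriv_eq, deriv_const]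

theorem contDiff_step (p w : ℝ) {n : ℕ∞} : ContDiff ℝ n (step p w) :=
  Real.smoothTransition.contDiff.comp ((contDiff_id.sub contDiff_const).div_const w)

/-- The profile has a continuous compactly supported derivative, bounded by `M`; rescaling to width
`w` gives slope `M/w`. A bounded function with such a derivative has temperate growth. -/
theorem exists_cutoff_step : ∃ M : ℝ, 0 ≤ M ∧ ∀ p w : ℝ, 0 < w → Cutoff (M / w) (step p w) := by
  have h01 : step 0 1 = Real.smoothTransition := by
    funext x
    simp [step]
  have hc : Continuous (deriv Real.smoothTransition) :=
    (Real.smoothTransition.contDiff (n := 1)).continuous_deriv le_rfl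
  obtain ⟨M, hM⟩ := hc.bounded_above_of_compact_support
    (h01 ▸ hasCompactSupport_deriv_step (p := 0) (w := 1) one_pos)
  refine ⟨M, (norm_nonneg _).trans (hM 0), fun p w hw => ⟨?_, contDiff_step p w,
    fun x => Real.smoothTransition.nonneg _, fun x => Real.smoothTransition.le_one _, fun x => ?_⟩⟩
  · have h1 : (step p w).HasTemperateGrowth := by
      refine Function.HasTemperateGrowth.of_fderiv (k := 0) (C := 1) ?_
        ((contDiff_step p w (n := 1)).differentiable (by norm_num)) fun x => ?_
      · refine HasCompactSupport.hasTemperateGrowth ?_ ?_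
        · have := hasCompactSupport_deriv_step (p := p) hw
          have e : fderiv ℝ (step p w)
              = (fun d => ContinuousLinearMap.toSpanSingleton ℝ d) ∘ deriv (step p w) :=
            funext fun x => toSpanSingleton_deriv.symm
          rw [e]
          exact this.comp_left (by simp)
        · exact (contDiff_step p w (n := ⊤)).fderiv_right le_rfl
      · rw [pow_zero, mul_one, Real.norm_eq_abs, abs_le]
        exact ⟨by linarith [Real.smoothTransition.nonneg ((x - p) / w), show step p w x
          = Real.smoothTransition ((x - p) / w) from rfl], Real.smoothTransition.le_one _⟩
    exact Function.HasTemperateGrowth.comp Function.Complex.hasTemperateGrowth_ofReal h1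
  · have hd : HasDerivAt (step p w) (deriv Real.smoothTransition ((x - p) / w) * (1 / w)) x := by
      refine HasDerivAt.comp x (h := fun x => (x - p) / w)
        ((Real.smoothTransition.contDiff (n := 1)).differentiable (by norm_num) _).hasDerivAt ?_
      exact ((hasDerivAt_id x).sub_const p).div_const w
    rw [hd.deriv, abs_mul, abs_of_pos (by positivity : 0 < 1 / w), mul_one_div]
    gcongr
    exact hM _

/-! ### Propagation speed of `H¹` functions -/

theorem real_inner_eq_re (f g : L2) : inner ℝ f g = (inner ℂ f g).re := by
  have h1 := real_inner_eq_norm_add_mul_self_sub_norm_mul_self_sub_norm_mul_self_div_two f g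
  have h2 := re_inner_eq_norm_add_mul_self_sub_norm_mul_self_sub_norm_mul_self_div_two (𝕜 := ℂ) f g
  rw [h1, ← h2]
  rfl

/-- Integration by parts without boundary terms: by Plancherel it is the fact that the multiplier
`2πiξ` is purely imaginary. -/
theorem IsWeakDeriv.inner_eq_neg {a a' b b' : L2} (ha : IsWeakDeriv a a') (hb : IsWeakDeriv b b') :
    inner ℂ a b' = -inner ℂ a' b := by
  rw [← Lp.inner_fourier_eq a b', ← Lp.inner_fourier_eq a' b, L2.inner_def, L2.inner_def,
    ← integral_neg]
  refine integral_congr_ae ?_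
  filter_upwards [isWeakDeriv_iff.1 ha, isWeakDeriv_iff.1 hb] with ξ h1 h2
  rw [h1, h2]
  simp [map_ofNat]
  ring

theorem IsWeakDeriv.T {f g : L2} (h : IsWeakDeriv f g) (r : ℝ) :
    IsWeakDeriv (T r f) (T r g) := by
  rw [isWeakDeriv_iff] at h ⊢
  filter_upwards [h, fourier_T_ae r f, fourier_T_ae r g] with ξ h1 h2 h3
  rw [h2, h3, h1]
  ring

theorem schrodingerSymbol_add (r h ξ : ℝ) :
    schrodingerSymbol (r + h) ξ = schrodingerSymbol r ξ
      * Complex.exp (-(Complex.I * ((h * (2 * Real.pi * ξ) ^ 2 : ℝ) : ℂ))) := by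
  rw [schrodingerSymbol, schrodingerSymbol, ← Complex.exp_add]
  congr 1
  push_cast
  ring

/-- The Schrödinger equation for band-limited functions. -/
theorem hasDerivAt_T {f f' f'' : L2} (hf : IsWeakDeriv f f') (hf' : IsWeakDeriv f' f'') {Ω : ℝ}
    (hΩ : ∀ᵐ ξ, Ω < |ξ| → (𝓕 f : L2) ξ = 0) (r : ℝ) :
    HasDerivAt (fun r => T r f) (Complex.I • T r f'') r := by
  rw [hasDerivAt_iff_isLittleO_nhds_zero]
  -- On the band `|ξ| ≤ Ω` the exponent is at most `|h| B`, so `|e^z - 1 - z| ≤ |z|²` gives a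
  -- remainder of order `h²` uniformly in `ξ`.
  refine Asymptotics.IsBigO.trans_isLittleO (g := fun h : ℝ => h ^ 2) ?_
    (Asymptotics.isLittleO_pow_id one_lt_two)
  set B : ℝ := (2 * Real.pi * Ω) ^ 2 with hB
  have hB0 : 0 ≤ B := by positivity
  refine Asymptotics.IsBigO.of_bound (B ^ 2 * ‖f‖) ?_
  have hev : ∀ᶠ h : ℝ in nhds 0, |h| * B ≤ 1 := by
    have : Filter.Tendsto (fun h : ℝ => |h| * B) (nhds 0) (nhds 0) := by
      have : Continuous fun h : ℝ => |h| * B := by fun_prop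
      simpa using this.tendsto 0
    filter_upwards [this.eventually (gt_mem_nhds one_pos)] with h hh using hh.le
  filter_upwards [hev] with h hh
  have e1 : ‖T (r + h) f - T r f - h • (Complex.I • T r f'')‖
      = ‖(𝓕 (T (r + h) f - T r f - (h : ℂ) • (Complex.I • T r f'')) : L2)‖ := by
    rw [Lp.norm_fourier_eq]
    rfl
  rw [e1, show B ^ 2 * ‖f‖ * ‖h ^ 2‖ = B ^ 2 * ‖h ^ 2‖ * ‖(𝓕 f : L2)‖ by
    rw [Lp.norm_fourier_eq]; ring]
  refine Lp.norm_le_mul_norm_of_ae_le_mul ?_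
  rw [fourier_sub, fourier_sub, FourierTransform.fourier_smul, FourierTransform.fourier_smul]
  filter_upwards [fourier_T_ae (r + h) f, fourier_T_ae r f, fourier_T_ae r f'', isWeakDeriv_iff.1 hf,
    isWeakDeriv_iff.1 hf', hΩ,
    Lp.coeFn_sub ((𝓕 (T (r + h) f) : L2) - 𝓕 (T r f)) ((h : ℂ) • (Complex.I • 𝓕 (T r f''))),
    Lp.coeFn_sub (𝓕 (T (r + h) f) : L2) (𝓕 (T r f)),
    Lp.coeFn_smul (h : ℂ) (Complex.I • (𝓕 (T r f'') : L2)),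
    Lp.coeFn_smul Complex.I (𝓕 (T r f'') : L2)] with ξ h1 h2 h3 h4 h5 h6 h7 h8 h9 h10
  rw [h7, Pi.sub_apply, h8, Pi.sub_apply, h9, Pi.smul_apply, h10, Pi.smul_apply, h1, h2, h3, h5, h4]
  rcases lt_or_ge Ω |ξ| with hξ | hξ
  · simp [h6 hξ]
  set z : ℂ := -(Complex.I * ((h * (2 * Real.pi * ξ) ^ 2 : ℝ) : ℂ)) with hz
  have e2 : schrodingerSymbol (r + h) ξ * (𝓕 f : L2) ξ - schrodingerSymbol r ξ * (𝓕 f : L2) ξ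
      - (h : ℂ) • (Complex.I • (schrodingerSymbol r ξ * (2 * Real.pi * Complex.I * ξ
        * (2 * Real.pi * Complex.I * ξ * (𝓕 f : L2) ξ))))
      = schrodingerSymbol r ξ * (Complex.exp z - 1 - z) * (𝓕 f : L2) ξ := by
    rw [schrodingerSymbol_add, ← hz]
    simp only [smul_eq_mul, hz]
    push_cast
    linear_combination (-(h : ℂ) * Complex.I * schrodingerSymbol r ξ * (2 * Real.pi * ξ) ^ 2
      * (𝓕 f : L2) ξ) * Complex.I_sq
  have hz1 : ‖z‖ ≤ |h| * B := by
    rw [hz, norm_neg, norm_mul, Complex.norm_I, one_mul, Complex.norm_real, Real.norm_eq_abs,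
      abs_mul, abs_of_nonneg (sq_nonneg (2 * Real.pi * ξ)), hB, mul_pow, mul_pow _ Ω, ← sq_abs ξ]
    gcongr
  rw [e2, norm_mul, norm_mul, norm_schrodingerSymbol, one_mul]
  gcongr
  refine (Complex.norm_exp_sub_one_sub_id_le (hz1.trans hh)).trans ?_
  calc ‖z‖ ^ 2 ≤ (|h| * B) ^ 2 := by gcongr
    _ = B ^ 2 * ‖h ^ 2‖ := by
      rw [mul_pow, sq_abs, Real.norm_of_nonneg (sq_nonneg h)]
      ring

/-- A nonnegative function with `|m'| ≤ 2 K √m` satisfies `√(m r) ≤ √(m 0) + K |r|`. -/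
theorem sqrt_le_of_abs_deriv_le {m m' : ℝ → ℝ} {K : ℝ} (hm : ∀ r, HasDerivAt m (m' r) r)
    (hm0 : ∀ r, 0 ≤ m r) (hK : ∀ r, |m' r| ≤ 2 * K * √(m r)) (hK0 : 0 ≤ K) (r : ℝ) :
    √(m r) ≤ √(m 0) + K * |r| := by
  -- The square root is not differentiable where `m` vanishes; the shift by `ε` removes this and is
  -- sent to zero at the end.
  have key : ∀ ε : ℝ, 0 < ε → √(m r) ≤ √(m 0 + ε) + K * |r| := by
    intro ε hε
    have hd : ∀ s, HasDerivAt (fun s => √(m s + ε)) (m' s / (2 * √(m s + ε))) s := fun s =>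
      ((hm s).add_const ε).sqrt (by linarith [hm0 s])
    have hb : ∀ s ∈ (univ : Set ℝ), ‖m' s / (2 * √(m s + ε))‖ ≤ K := fun s _ => by
      have hpos : 0 < √(m s + ε) := Real.sqrt_pos.2 (by linarith [hm0 s])
      rw [norm_div, Real.norm_eq_abs, Real.norm_of_nonneg (by positivity), div_le_iff₀ (by positivity)]
      have : √(m s) ≤ √(m s + ε) := Real.sqrt_le_sqrt (by linarith)
      calc |m' s| ≤ 2 * K * √(m s) := hK s
        _ ≤ 2 * K * √(m s + ε) := by gcongr
        _ = _ := by ring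
    have := convex_univ.norm_image_sub_le_of_norm_hasDerivWithin_le
      (fun s _ => (hd s).hasDerivWithinAt) hb (mem_univ 0) (mem_univ r)
    rw [sub_zero, Real.norm_eq_abs, Real.norm_eq_abs] at this
    have h1 := (abs_le.1 this).2
    have h2 : √(m r) ≤ √(m r + ε) := Real.sqrt_le_sqrt (by linarith)
    linarith
  have hlim : Filter.Tendsto (fun ε : ℝ => √(m 0 + ε) + K * |r|) (nhdsWithin 0 (Ioi 0))
      (nhds (√(m 0) + K * |r|)) := by
    have : Continuous fun ε : ℝ => √(m 0 + ε) + K * |r| := by fun_prop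
    have := this.tendsto 0
    simp only [add_zero] at this
    exact this.mono_left nhdsWithin_le_nhds
  exact ge_of_tendsto hlim (by filter_upwards [self_mem_nhdsWithin] with ε hε using key ε hε)

/-- With `u = T r f`, the derivative of `‖χu‖²` is `2 Re⟨χu, iχu''⟩`. Integrating by parts, the term
`‖χu'‖²` contributes nothing to the real part, and `4 Im⟨χ'χu, u'⟩` remains, of size at most
`4L‖χu‖‖f'‖`. Hence `‖χu‖` changes at speed at most `2L‖f'‖`. -/
theorem Cutoff.norm_rmul_T_le_of_bandlimited {L : ℝ} {χ : ℝ → ℝ} (h : Cutoff L χ) {f f' f'' : L2}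
    (hf : IsWeakDeriv f f') (hf' : IsWeakDeriv f' f'') {Ω : ℝ}
    (hΩ : ∀ᵐ ξ, Ω < |ξ| → (𝓕 f : L2) ξ = 0) (r : ℝ) :
    ‖rmul χ (T r f)‖ ≤ ‖rmul χ f‖ + 2 * L * ‖f'‖ * |r| := by
  obtain ⟨A, hA⟩ := exists_clm_rmul h.measurable h.abs_le_one
  have hL := h.const_nonneg
  set m' : ℝ → ℝ := fun r => 2 * inner ℝ (rmul χ (T r f)) (rmul χ (Complex.I • T r f'')) with hm'
  have hd : ∀ r, HasDerivAt (fun r => ‖rmul χ (T r f)‖ ^ 2) (m' r) r := by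
    intro r
    have h1 : HasDerivAt (fun r => rmul χ (T r f)) (rmul χ (Complex.I • T r f'')) r := by
      simp only [← hA]
      exact (A.restrictScalars ℝ).hasFDerivAt.comp_hasDerivAt r (hasDerivAt_T hf hf' hΩ r)
    exact h1.norm_sq
  have hb : ∀ r, |m' r| ≤ 2 * (2 * L * ‖f'‖) * √(‖rmul χ (T r f)‖ ^ 2) := by
    intro r
    rw [Real.sqrt_sq (norm_nonneg _)]
    have hu := hf.T r
    have hu' := hf'.T r
    set u := T r f
    set u' := T r f'
    have n1 : ‖u'‖ = ‖f'‖ := norm_T r f'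
    have e1 : inner ℂ (rmul χ u) (rmul χ (Complex.I • T r f''))
        = -Complex.I * (2 * inner ℂ (rmul (deriv χ) (rmul χ u)) u'
          + inner ℂ (rmul χ u') (rmul χ u')) := by
      rw [← inner_rmul_left h.measurable h.abs_le_one, inner_smul_right,
        (h.isWeakDeriv (h.isWeakDeriv hu)).inner_eq_neg hu', inner_add_left]
      have e2 : rmul χ (rmul (deriv χ) u + rmul χ u')
          = rmul (deriv χ) (rmul χ u) + rmul χ (rmul χ u') := by
        rw [← hA, map_add, hA, hA,
          rmul_comm h.measurable h.abs_le_one h.measurable_deriv h.abs_deriv_le]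
      rw [e2, inner_add_left, inner_rmul_left h.measurable h.abs_le_one (rmul χ u')]
      ring
    obtain ⟨q, e3⟩ : ∃ q : ℝ, (inner ℂ (rmul χ u') (rmul χ u') : ℂ) = (q : ℂ) :=
      ⟨‖rmul χ u'‖ ^ 2, by rw [inner_self_eq_norm_sq_to_K]; simp⟩
    have e4 : m' r = 4 * (inner ℂ (rmul (deriv χ) (rmul χ u)) u').im := by
      rw [hm']
      simp only
      rw [real_inner_eq_re, e1, e3]
      simp
      ring
    rw [e4, abs_mul, abs_of_pos (by norm_num : (0 : ℝ) < 4)]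
    have h5 : |(inner ℂ (rmul (deriv χ) (rmul χ u)) u' : ℂ).im| ≤ L * ‖rmul χ u‖ * ‖f'‖ := by
      refine (Complex.abs_im_le_norm _).trans ((norm_inner_le_norm _ _).trans ?_)
      rw [n1]
      gcongr
      exact h.norm_deriv_le _
    linarith
  have := sqrt_le_of_abs_deriv_le hd (fun r => by positivity) hb (by positivity) r
  simp only [Real.sqrt_sq (norm_nonneg _)] at this
  have hT0 : T 0 f = f := by
    apply fourier_injective
    apply Lp.ext
    filter_upwards [fourier_T_ae 0 f] with ξ h1
    rw [h1]
    simp [schrodingerSymbol]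
  rwa [hT0] at this

/-- Frequency truncation supplies the second derivative used for band-limited data and does not
increase `‖f'‖`; both sides pass to the limit. -/
theorem Cutoff.norm_rmul_T_le {L : ℝ} {χ : ℝ → ℝ} (h : Cutoff L χ) {f f' : L2}
    (hf : IsWeakDeriv f f') (r : ℝ) :
    ‖rmul χ (T r f)‖ ≤ ‖rmul χ f‖ + 2 * L * ‖f'‖ * |r| := by
  obtain ⟨A, hA⟩ := exists_clm_rmul h.measurable h.abs_le_one
  have hL := h.const_nonneg
  set F : ℕ → L2 := fun n => 𝓕⁻ (cut (Icc (-(n : ℝ)) n) (𝓕 f)) with hF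
  have hFf : Filter.Tendsto F Filter.atTop (nhds f) := by
    have := tendsto_cut (𝓕 f)
    rw [tendsto_iff_norm_sub_tendsto_zero] at this ⊢
    simpa only [hF, norm_fourierInv_sub] using this
  have hn : ∀ n, ‖rmul χ (T r (F n))‖ ≤ ‖rmul χ (F n)‖ + 2 * L * ‖f'‖ * |r| := by
    intro n
    set S := Icc (-(n : ℝ)) n with hS
    have hSm : MeasurableSet S := measurableSet_Icc
    have w1 : IsWeakDeriv (F n) (𝓕⁻ (cut S (𝓕 f'))) := by
      rw [isWeakDeriv_iff, FourierTransform.fourier_fourierInv_eq,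
        FourierTransform.fourier_fourierInv_eq]
      filter_upwards [cut_ae hSm (𝓕 f), cut_ae hSm (𝓕 f'), isWeakDeriv_iff.1 hf] with ξ h1 h2 h3
      rw [h1, h2]
      by_cases hξ : ξ ∈ S <;> simp [hξ, h3]
    have hmem : MemLp (fun ξ : ℝ => (2 * Real.pi * Complex.I * ξ) * (cut S (𝓕 f')) ξ) 2 volume := by
      refine (Lp.memLp (𝓕 f')).of_le_mul (c := 2 * Real.pi * n)
        (Continuous.aestronglyMeasurable (by fun_prop) |>.mul (Lp.aestronglyMeasurable _)) ?_
      filter_upwards [cut_ae hSm (𝓕 f')] with ξ h1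
      rw [h1]
      by_cases hξ : ξ ∈ S
      · have : |ξ| ≤ n := abs_le.2 hξ
        simp only [indicator_of_mem hξ, norm_mul, Complex.norm_real, Real.norm_eq_abs,
          Complex.norm_I, Complex.norm_ofNat, abs_of_pos Real.pi_pos, mul_one]
        gcongr
      · simp only [indicator_of_notMem hξ, mul_zero, norm_zero]
        positivity
    have w2 : IsWeakDeriv (𝓕⁻ (cut S (𝓕 f')) : L2) (𝓕⁻ hmem.toLp) := by
      rw [isWeakDeriv_iff, FourierTransform.fourier_fourierInv_eq,
        FourierTransform.fourier_fourierInv_eq]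
      exact hmem.coeFn_toLp
    have hΩ : ∀ᵐ ξ, (n : ℝ) < |ξ| → (𝓕 (F n) : L2) ξ = 0 := by
      rw [hF]
      simp only [FourierTransform.fourier_fourierInv_eq]
      filter_upwards [cut_ae hSm (𝓕 f)] with ξ h1 hξ
      rw [h1, indicator_of_notMem]
      intro h'
      exact absurd (abs_le.2 h') (not_le.2 hξ)
    have hle : ‖(𝓕⁻ (cut S (𝓕 f')) : L2)‖ ≤ ‖f'‖ := by
      rw [← enorm_le_iff_norm_le, enorm_fourierInv, ← enorm_fourier f']
      exact enorm_cut_le hSm _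
    refine (h.norm_rmul_T_le_of_bandlimited w1 w2 hΩ r).trans ?_
    gcongr
  have t1 : Filter.Tendsto (fun n => ‖rmul χ (T r (F n))‖) Filter.atTop
      (nhds ‖rmul χ (T r f)‖) := by
    have hT : Filter.Tendsto (fun n => T r (F n)) Filter.atTop (nhds (T r f)) := by
      rw [tendsto_iff_norm_sub_tendsto_zero] at hFf ⊢
      simpa only [← T_sub, norm_T] using hFf
    simp only [← hA]
    exact ((A.continuous.tendsto _).comp hT).norm
  have t2 : Filter.Tendsto (fun n => ‖rmul χ (F n)‖ + 2 * L * ‖f'‖ * |r|) Filter.atTop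
      (nhds (‖rmul χ f‖ + 2 * L * ‖f'‖ * |r|)) := by
    simp only [← hA]
    exact ((A.continuous.tendsto _).comp hFf).norm.add_const _
  exact le_of_tendsto_of_tendsto' t1 t2 hn

/-! ### Positive average dispersion -/

theorem lintegral_enorm_mul_enorm_le (f g : L2) : ∫⁻ x, ‖f x‖ₑ * ‖g x‖ₑ ≤ ‖f‖ₑ * ‖g‖ₑ := by
  have hf : AEMeasurable (fun x => ‖f x‖ₑ) := (Lp.aestronglyMeasurable _).enorm
  have hg : AEMeasurable (fun x => ‖g x‖ₑ) := (Lp.aestronglyMeasurable _).enorm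
  have h := ENNReal.lintegral_mul_le_Lp_mul_Lq volume Real.HolderConjugate.two_two hf hg
  simp only [ENNReal.rpow_two, ← enorm_sq_eq_lintegral, Pi.mul_apply] at h
  refine h.trans (le_of_eq ?_)
  have e : ∀ x : ℝ≥0∞, (x ^ 2) ^ (1 / 2 : ℝ) = x := fun x => by
    rw [← ENNReal.rpow_natCast, ← ENNReal.rpow_mul]
    norm_num
  rw [e, e]

theorem h1Norm_le {f g : L2} (h : IsWeakDeriv f g) : h1Norm f ≤ ‖f‖ₑ + ‖g‖ₑ := by
  refine (ENNReal.pow_le_pow_left_iff (n := 2) two_ne_zero).1 ?_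
  rw [h1Norm_sq, derivNorm_eq h, add_sq]
  exact add_le_add (le_self_add) le_rfl

/-- Insert `1 = η + (1 - η)`. At time zero `η` kills `f` and `1 - η` kills `g`, so in each half one
of the two waves consists only of what has leaked through a cutoff of slope `L` during time at most
`R`. -/
theorem Cutoff.lintegral_T_mul_T_le {L : ℝ} {η : ℝ → ℝ} (h : Cutoff L η) {f f' g g' : L2}
    (hf : IsWeakDeriv f f') (hg : IsWeakDeriv g g') (hηf : rmul η f = 0)
    (hηg : rmul (fun x => 1 - η x) g = 0) {r R : ℝ} (hr : |r| ≤ R) :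
    ∫⁻ x, ‖T r f x‖ₑ * ‖T r g x‖ₑ
      ≤ ENNReal.ofReal (2 * L * R) * (‖f'‖ₑ * ‖g‖ₑ + ‖f‖ₑ * ‖g'‖ₑ) := by
  have hL := h.const_nonneg
  have hR : 0 ≤ R := (abs_nonneg r).trans hr
  have key : ∀ {χ : ℝ → ℝ}, Cutoff L χ → ∀ {u u' : L2}, IsWeakDeriv u u' → rmul χ u = 0 →
      ‖rmul χ (T r u)‖ₑ ≤ ENNReal.ofReal (2 * L * R) * ‖u'‖ₑ := by
    intro χ hχ u u' hu h0
    have := hχ.norm_rmul_T_le hu r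
    rw [h0, norm_zero, zero_add] at this
    rw [← ofReal_norm, ← ofReal_norm u', ← ENNReal.ofReal_mul (by positivity)]
    refine ENNReal.ofReal_le_ofReal (this.trans ?_)
    calc 2 * L * ‖u'‖ * |r| ≤ 2 * L * ‖u'‖ * R := by gcongr
      _ = _ := by ring
  have hm : ∀ u : L2, AEMeasurable (fun x => ‖u x‖ₑ) := fun u =>
    (Lp.aestronglyMeasurable _).enorm
  calc ∫⁻ x, ‖T r f x‖ₑ * ‖T r g x‖ₑ
      = ∫⁻ x, (‖rmul η (T r f) x‖ₑ * ‖T r g x‖ₑ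
          + ‖T r f x‖ₑ * ‖rmul (fun x => 1 - η x) (T r g) x‖ₑ) := by
        refine lintegral_congr_ae ?_
        filter_upwards [h.ae_eq (T r f), h.one_sub.ae_eq (T r g)] with x h1 h2
        have e : ∀ t : ℝ, 0 ≤ t → ‖(t : ℂ)‖ₑ = ENNReal.ofReal t := fun t ht => by
          rw [← ofReal_norm, Complex.norm_real, Real.norm_of_nonneg ht]
        rw [h1, h2, enorm_mul, enorm_mul, e _ (h.nonneg x), e _ (h.one_sub.nonneg x)]
        have e2 : ENNReal.ofReal (η x) + ENNReal.ofReal (1 - η x) = 1 := by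
          rw [← ENNReal.ofReal_add (h.nonneg x) (h.one_sub.nonneg x)]
          simp
        calc ‖T r f x‖ₑ * ‖T r g x‖ₑ
            = (ENNReal.ofReal (η x) + ENNReal.ofReal (1 - η x)) * (‖T r f x‖ₑ * ‖T r g x‖ₑ) := by
              rw [e2, one_mul]
          _ = _ := by ring
    _ = (∫⁻ x, ‖rmul η (T r f) x‖ₑ * ‖T r g x‖ₑ)
          + ∫⁻ x, ‖T r f x‖ₑ * ‖rmul (fun x => 1 - η x) (T r g) x‖ₑ :=
        lintegral_add_left' ((hm _).mul (hm _)) _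
    _ ≤ ENNReal.ofReal (2 * L * R) * ‖f'‖ₑ * ‖g‖ₑ
          + ‖f‖ₑ * (ENNReal.ofReal (2 * L * R) * ‖g'‖ₑ) := by
        refine add_le_add ((lintegral_enorm_mul_enorm_le _ _).trans ?_)
          ((lintegral_enorm_mul_enorm_le _ _).trans ?_)
        · rw [enorm_T]
          gcongr
          exact key h hf hηf
        · rw [enorm_T]
          gcongr
          exact key h.one_sub hg hηg
    _ = _ := by ring

theorem Cutoff.norm_sq_add_norm_sq_le {L L' : ℝ} {χ η : ℝ → ℝ} (hχ : Cutoff L χ)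
    (hη : Cutoff L' η) (hsum : ∀ x, χ x ^ 2 + η x ^ 2 ≤ 1) (f : L2) :
    ‖rmul χ f‖ ^ 2 + ‖rmul η f‖ ^ 2 ≤ ‖f‖ ^ 2 := by
  rw [norm_sq_eq_integral, norm_sq_eq_integral, norm_sq_eq_integral,
    ← integral_add (integrable_norm_sq _) (integrable_norm_sq _)]
  refine integral_mono_ae ((integrable_norm_sq _).add (integrable_norm_sq _))
    (integrable_norm_sq _) ?_
  filter_upwards [hχ.ae_eq f, hη.ae_eq f] with x h1 h2
  rw [h1, h2, norm_mul, norm_mul, Complex.norm_real, Complex.norm_real, mul_pow, mul_pow,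
    ← add_mul, Real.norm_eq_abs, Real.norm_eq_abs, sq_abs, sq_abs]
  exact mul_le_of_le_one_left (by positivity) (hsum x)

theorem Cutoff.le_norm_sq {L : ℝ} {χ : ℝ → ℝ} (hχ : Cutoff L χ) {S : Set ℝ} (hS : MeasurableSet S)
    (h1 : ∀ x ∈ S, χ x = 1) (f : L2) : ∫ x in S, ‖f x‖ ^ 2 ≤ ‖rmul χ f‖ ^ 2 := by
  rw [norm_sq_eq_integral, ← integral_indicator hS]
  refine integral_mono_ae ((integrable_norm_sq f).indicator hS) (integrable_norm_sq _) ?_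
  filter_upwards [hχ.ae_eq f] with x hx
  by_cases h : x ∈ S
  · rw [indicator_of_mem h, hx, h1 x h]
    simp
  · rw [indicator_of_notMem h]
    positivity

/-- Kinetic energy of a smooth splitting. -/
theorem Cutoff.norm_deriv_sq_add_le {L : ℝ} {χ η : ℝ → ℝ} (hχ : Cutoff L χ) (hη : Cutoff L η)
    (hsum : ∀ x, χ x ^ 2 + η x ^ 2 ≤ 1) (f g : L2) :
    ‖rmul (deriv χ) f + rmul χ g‖ ^ 2 + ‖rmul (deriv η) f + rmul η g‖ ^ 2
      ≤ ‖g‖ ^ 2 + 2 * L * (1 + L) * (‖f‖ ^ 2 + ‖g‖ ^ 2) := by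
  have hL := hχ.const_nonneg
  have key : ∀ {χ : ℝ → ℝ}, Cutoff L χ → ‖rmul (deriv χ) f + rmul χ g‖ ^ 2
      ≤ ‖rmul χ g‖ ^ 2 + L * (1 + L) * (‖f‖ ^ 2 + ‖g‖ ^ 2) := by
    intro χ h
    have h1 : ‖rmul (deriv χ) f + rmul χ g‖ ≤ L * ‖f‖ + ‖rmul χ g‖ :=
      (norm_add_le _ _).trans (add_le_add (h.norm_deriv_le f) le_rfl)
    have h2 := h.norm_le g
    have h3 : L * (2 * ‖f‖ * ‖rmul χ g‖) ≤ L * (‖f‖ ^ 2 + ‖g‖ ^ 2) := by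
      gcongr
      nlinarith [sq_nonneg (‖f‖ - ‖g‖), norm_nonneg f, norm_nonneg g]
    calc ‖rmul (deriv χ) f + rmul χ g‖ ^ 2 ≤ (L * ‖f‖ + ‖rmul χ g‖) ^ 2 := by gcongr
      _ ≤ _ := by nlinarith [mul_nonneg (sq_nonneg L) (sq_nonneg ‖g‖)]
  have := hχ.norm_sq_add_norm_sq_le hη hsum g
  have h1 := key hχ
  have h2 := key hη
  linarith

theorem AdmissibleDensity.lintegral_le {ψ : ℝ → ℝ} {R : ℝ} {K : ℝ≥0}
    (hψ : AdmissibleDensity ψ 1 R K) : ∫⁻ r, ‖ψ r‖ₑ ≤ K := by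
  rw [← eLpNorm_one_eq_lintegral_enorm]
  exact hψ.norm_le

theorem nConverges_of_memH1 {V ψ : ℝ → ℝ} {γ₁ γ₂ c R : ℝ} {K : ℝ≥0}
    (hV : AssumptionA1 V γ₁ γ₂ c) (hψ : AdmissibleDensity ψ 1 R K) {f : L2} (hf : MemH1 f) :
    NConverges V ψ f := by
  obtain ⟨S, hS⟩ := exists_enorm_T_le
  have h2 := hV.two_le
  have h12 := hV.le
  have hh := h1Norm_ne_top hf
  set B : ℝ≥0∞ := (S * h1Norm f) ^ (γ₁ - 2) * ‖f‖ₑ ^ 2 + (S * h1Norm f) ^ (γ₂ - 2) * ‖f‖ₑ ^ 2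
    with hB
  have e1 : 0 ≤ γ₁ - 2 := by linarith
  have e2 : 0 ≤ γ₂ - 2 := by linarith
  have hBtop : B < ⊤ := by finiteness
  have hb : ∀ r, ∫⁻ x, (‖T r f x‖ₑ ^ γ₁ + ‖T r f x‖ₑ ^ γ₂) ≤ B := fun r => by
    have hm : AEMeasurable (fun x => ‖T r f x‖ₑ) := (Lp.aestronglyMeasurable _).enorm
    rw [lintegral_add_left' (by fun_prop), hB, ← enorm_T r f]
    exact add_le_add (lintegral_enorm_rpow_le (hS f hf r) h2)
      (lintegral_enorm_rpow_le (hS f hf r) (h2.trans h12))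
  refine nConverges_of_lintegral hV hψ.memLp.aestronglyMeasurable
    (Filter.Eventually.of_forall fun r => (hb r).trans_lt hBtop) ?_
  calc ∫⁻ r, (∫⁻ x, (‖T r f x‖ₑ ^ γ₁ + ‖T r f x‖ₑ ^ γ₂)) * ‖ψ r‖ₑ
      ≤ ∫⁻ r, B * ‖ψ r‖ₑ := lintegral_mono fun r => mul_le_mul' (hb r) le_rfl
    _ = B * ∫⁻ r, ‖ψ r‖ₑ := lintegral_const_mul' _ _ hBtop.ne
    _ ≤ B * K := mul_le_mul' le_rfl hψ.lintegral_le
    _ < ⊤ := by finiteness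

/-- The nonlinear part of the splitting error, for three functions in `H¹`. -/
theorem AssumptionA1.lintegral_split_le {V : ℝ → ℝ} {γ₁ γ₂ c : ℝ} (hV : AssumptionA1 V γ₁ γ₂ c)
    {u₁ u₀ u₂ : L2} {Y : ℝ≥0∞} (h₁ : ∀ᵐ x, ‖u₁ x‖ₑ ≤ Y) (h₀ : ∀ᵐ x, ‖u₀ x‖ₑ ≤ Y)
    (h₂ : ∀ᵐ x, ‖u₂ x‖ₑ ≤ Y) :
    ∫⁻ x, ‖V ‖(u₁ + u₀ + u₂) x‖ - V ‖u₁ x‖ - V ‖u₂ x‖‖ₑ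
      ≤ ENNReal.ofReal (3 * c) * ((3 * Y) ^ (γ₁ - 2) + (3 * Y) ^ (γ₂ - 2))
        * (‖u₀‖ₑ * (‖u₁‖ₑ + ‖u₀‖ₑ + ‖u₂‖ₑ) + ∫⁻ x, ‖u₁ x‖ₑ * ‖u₂ x‖ₑ) := by
  have h2 := hV.two_le
  have h12 := hV.le
  have hm : ∀ u : L2, AEMeasurable (fun x => ‖u x‖ₑ) := fun u =>
    (Lp.aestronglyMeasurable _).enorm
  have m₁ := hm u₁
  have m₀ := hm u₀
  have m₂ := hm u₂
  calc ∫⁻ x, ‖V ‖(u₁ + u₀ + u₂) x‖ - V ‖u₁ x‖ - V ‖u₂ x‖‖ₑ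
      ≤ ∫⁻ x, ENNReal.ofReal (3 * c) * ((3 * Y) ^ (γ₁ - 2) + (3 * Y) ^ (γ₂ - 2))
        * (‖u₀ x‖ₑ * ‖u₁ x‖ₑ + ‖u₀ x‖ₑ * ‖u₀ x‖ₑ + ‖u₀ x‖ₑ * ‖u₂ x‖ₑ + ‖u₁ x‖ₑ * ‖u₂ x‖ₑ) := by
        refine lintegral_mono_ae ?_
        filter_upwards [h₁, h₀, h₂, Lp.coeFn_add (u₁ + u₀) u₂, Lp.coeFn_add u₁ u₀]
          with x k₁ k₀ k₂ e1 e2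
        rw [e1, Pi.add_apply, e2, Pi.add_apply]
        refine (hV.enorm_split_le _ _ _).trans ?_
        have hW : ‖u₁ x‖ₑ + ‖u₀ x‖ₑ + ‖u₂ x‖ₑ ≤ 3 * Y := by
          calc _ ≤ Y + Y + Y := by gcongr
            _ = 3 * Y := by ring
        refine mul_le_mul' (mul_le_mul' le_rfl (add_le_add ?_ ?_)) (le_of_eq (by ring))
        · exact ENNReal.rpow_le_rpow hW (by linarith)
        · exact ENNReal.rpow_le_rpow hW (by linarith)
    _ = ENNReal.ofReal (3 * c) * ((3 * Y) ^ (γ₁ - 2) + (3 * Y) ^ (γ₂ - 2))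
        * ((∫⁻ x, ‖u₀ x‖ₑ * ‖u₁ x‖ₑ) + (∫⁻ x, ‖u₀ x‖ₑ * ‖u₀ x‖ₑ) + (∫⁻ x, ‖u₀ x‖ₑ * ‖u₂ x‖ₑ)
          + ∫⁻ x, ‖u₁ x‖ₑ * ‖u₂ x‖ₑ) := by
        rw [lintegral_const_mul'' _ (by fun_prop), lintegral_add_left' (by fun_prop),
          lintegral_add_left' (by fun_prop), lintegral_add_left' (by fun_prop)]
    _ ≤ _ := by
        gcongr
        rw [mul_add, mul_add]
        exact add_le_add (add_le_add (lintegral_enorm_mul_enorm_le _ _)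
          (lintegral_enorm_mul_enorm_le _ _)) (lintegral_enorm_mul_enorm_le _ _)

/-- The smooth splitting of an `H¹` function along a window of length `ℓ`. -/
theorem exists_h1_splitting : ∃ P : ℝ≥0, ∀ (f f' : L2) (p ℓ : ℝ), IsWeakDeriv f f' → 1 ≤ ℓ →
    ∃ f₁ f₀ f₂ g₁ g₂ : L2, f₁ + f₀ + f₂ = f ∧ IsWeakDeriv f₁ g₁ ∧ IsWeakDeriv f₂ g₂ ∧ MemH1 f₀ ∧
      ‖f₁‖ₑ ≤ ‖f‖ₑ ∧ ‖f₂‖ₑ ≤ ‖f‖ₑ ∧ ‖f₀‖ₑ ≤ ‖cut (Ico p (p + ℓ)) f‖ₑ ∧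
      h1Norm f₁ ≤ P * h1Norm f ∧ h1Norm f₀ ≤ P * h1Norm f ∧ h1Norm f₂ ≤ P * h1Norm f ∧
      ‖f₁‖ ^ 2 + ‖f₂‖ ^ 2 ≤ ‖f‖ ^ 2 ∧
      ∫ x in Iic p, ‖f x‖ ^ 2 ≤ ‖f₁‖ ^ 2 ∧ ∫ x in Ici (p + ℓ), ‖f x‖ ^ 2 ≤ ‖f₂‖ ^ 2 ∧
      ‖g₁‖ ^ 2 + ‖g₂‖ ^ 2 ≤ ‖f'‖ ^ 2 + P * ℓ⁻¹ * (‖f‖ ^ 2 + ‖f'‖ ^ 2) ∧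
      ∀ r R, |r| ≤ R → ∫⁻ x, ‖T r f₁ x‖ₑ * ‖T r f₂ x‖ₑ
        ≤ P * ENNReal.ofReal R * ENNReal.ofReal ℓ⁻¹ * h1Norm f ^ 2 := by
  obtain ⟨M, hM0, hM⟩ := exists_cutoff_step
  -- The first summand serves the `H¹` norms of the pieces, the second the overlap of the waves and
  -- the kinetic error.
  set P : ℝ := (6 * M + 4) + 12 * M * (3 * M + 1) with hP
  have hP1 : 6 * M + 4 ≤ P := by rw [hP]; nlinarith
  have hP2 : 12 * M * (3 * M + 1) ≤ P := by rw [hP]; linarith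
  have hP0 : 0 ≤ P := by linarith
  refine ⟨P.toNNReal, fun f f' p ℓ hf hℓ => ?_⟩
  -- The window is divided into thirds: `χ` descends in the first, `η` rises in the last, and the
  -- step in the middle third separates the two supports for the overlap estimate.
  have hw : 0 < ℓ / 3 := by linarith
  set L : ℝ := M / (ℓ / 3) with hLdef
  have hL : L = 3 * M * ℓ⁻¹ := by rw [hLdef]; field_simp
  have hℓ1 : ℓ⁻¹ ≤ 1 := inv_le_one_of_one_le₀ hℓ
  have hℓ0 : 0 < ℓ⁻¹ := by positivity
  have hL3 : L ≤ 3 * M := by rw [hL]; exact mul_le_of_le_one_right (by positivity) hℓ1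
  have hs₁ : Cutoff L fun x => 1 - step p (ℓ / 3) x := (hM p (ℓ / 3) hw).one_sub
  have hs₂ : Cutoff L (step (p + ℓ / 3) (ℓ / 3)) := hM _ _ hw
  have hs₃ : Cutoff L (step (p + 2 * ℓ / 3) (ℓ / 3)) := hM _ _ hw
  set χ : ℝ → ℝ := fun x => 1 - step p (ℓ / 3) x with hχ
  set η : ℝ → ℝ := step (p + 2 * ℓ / 3) (ℓ / 3) with hη
  have hL0 := hs₁.const_nonneg
  have d₁ := hs₁.isWeakDeriv hf
  have d₂ := hs₃.isWeakDeriv hf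
  set f₁ := rmul χ f with hf₁
  set f₂ := rmul η f with hf₂
  set g₁ := rmul (deriv χ) f + rmul χ f' with hg₁
  set g₂ := rmul (deriv η) f + rmul η f' with hg₂
  have χ0 : ∀ x, p + ℓ / 3 ≤ x → χ x = 0 := fun x hx => by
    simp only [hχ, step_eq_one hw hx, sub_self]
  have η0 : ∀ x, x ≤ p + 2 * ℓ / 3 → η x = 0 := fun x hx => step_eq_zero hw hx
  -- At every point at least one of the two cutoffs vanishes.
  have hprod : ∀ x, χ x ^ 2 + η x ^ 2 ≤ 1 := fun x => by
    rcases le_total (p + ℓ / 3) x with h | h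
    · rw [χ0 x h]
      nlinarith [hs₃.nonneg x, hs₃.le_one x]
    · rw [η0 x (by linarith)]
      nlinarith [hs₁.nonneg x, hs₁.le_one x]
  have hff : ‖f‖ₑ ≤ h1Norm f := enorm_le_h1Norm f
  have hff' : ‖f'‖ₑ ≤ h1Norm f := derivNorm_eq hf ▸ derivNorm_le_h1Norm f
  have n₁ : ‖f₁‖ₑ ≤ ‖f‖ₑ := enorm_le_iff_norm_le.2 (hs₁.norm_le f)
  have n₂ : ‖f₂‖ₑ ≤ ‖f‖ₑ := enorm_le_iff_norm_le.2 (hs₃.norm_le f)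
  have hg : ∀ {χ : ℝ → ℝ}, Cutoff L χ →
      ‖rmul (deriv χ) f + rmul χ f'‖ₑ ≤ ENNReal.ofReal (3 * M + 1) * h1Norm f := by
    intro χ h
    refine (enorm_add_le _ _).trans ?_
    rw [ENNReal.ofReal_add (by positivity) one_pos.le, add_mul, ENNReal.ofReal_one, one_mul]
    refine add_le_add ?_ ((enorm_le_iff_norm_le.2 (h.norm_le f')).trans hff')
    refine le_trans ?_ (mul_le_mul' le_rfl hff)
    rw [← ofReal_norm, ← ofReal_norm f, ← ENNReal.ofReal_mul (by positivity)]
    exact ENNReal.ofReal_le_ofReal ((h.norm_deriv_le f).trans (by gcongr))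
  have hg₁' : ‖g₁‖ₑ ≤ ENNReal.ofReal (3 * M + 1) * h1Norm f := hg hs₁
  have hg₂' : ‖g₂‖ₑ ≤ ENNReal.ofReal (3 * M + 1) * h1Norm f := hg hs₃
  have d₀ : IsWeakDeriv (f - f₁ - f₂) (f' - g₁ - g₂) := (hf.sub d₁).sub d₂
  have hcut : ‖f - f₁ - f₂‖ₑ ≤ ‖cut (Ico p (p + ℓ)) f‖ₑ := by
    refine enorm_le_iff_norm_le.2 (Lp.norm_le_norm_of_ae_le ?_)
    filter_upwards [hs₁.ae_eq f, hs₃.ae_eq f, Lp.coeFn_sub (f - f₁) f₂, Lp.coeFn_sub f f₁,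
      cut_ae measurableSet_Ico f (S := Ico p (p + ℓ))] with x e1 e2 e3 e4 e5
    rw [e3, Pi.sub_apply, e4, Pi.sub_apply, e1, e2, e5]
    have e6 : f x - (χ x : ℂ) * f x - (η x : ℂ) * f x = ((1 - χ x - η x : ℝ) : ℂ) * f x := by
      push_cast
      ring
    rw [e6, norm_mul, Complex.norm_real]
    by_cases hx : x ∈ Ico p (p + ℓ)
    · rw [indicator_of_mem hx]
      refine mul_le_of_le_one_left (norm_nonneg _) (abs_le.2 ⟨?_, ?_⟩)
      · linarith [hs₁.le_one x, hs₃.le_one x]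
      · linarith [hs₁.nonneg x, hs₃.nonneg x]
    · have : 1 - χ x - η x = 0 := by
        rw [mem_Ico, not_and_or, not_le, not_lt] at hx
        rcases hx with hx | hx
        · rw [η0 x (by linarith)]
          simp only [hχ, step_eq_zero hw hx.le]
          ring
        · rw [χ0 x (by linarith), hη, step_eq_one hw (by linarith)]
          ring
      simp [this]
  have hPh : ∀ {u : L2} {q : ℝ}, 0 ≤ q → q ≤ P → h1Norm u ≤ ENNReal.ofReal q * h1Norm f →
      h1Norm u ≤ (P.toNNReal : ℝ≥0∞) * h1Norm f := fun hq0 hq hu =>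
    hu.trans (mul_le_mul' (ENNReal.ofReal_le_ofReal hq) le_rfl)
  have b₁ : h1Norm f₁ ≤ ENNReal.ofReal (3 * M + 2) * h1Norm f := by
    refine (h1Norm_le d₁).trans ((add_le_add (n₁.trans hff) hg₁').trans (le_of_eq ?_))
    rw [show 3 * M + 2 = 1 + (3 * M + 1) by ring, ENNReal.ofReal_add one_pos.le (by positivity),
      add_mul, ENNReal.ofReal_one, one_mul]
  have b₂ : h1Norm f₂ ≤ ENNReal.ofReal (3 * M + 2) * h1Norm f := by
    refine (h1Norm_le d₂).trans ((add_le_add (n₂.trans hff) hg₂').trans (le_of_eq ?_))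
    rw [show 3 * M + 2 = 1 + (3 * M + 1) by ring, ENNReal.ofReal_add one_pos.le (by positivity),
      add_mul, ENNReal.ofReal_one, one_mul]
  have b₀ : h1Norm (f - f₁ - f₂) ≤ ENNReal.ofReal (6 * M + 4) * h1Norm f := by
    refine (h1Norm_le d₀).trans ?_
    have h1 : ‖f - f₁ - f₂‖ₑ ≤ h1Norm f :=
      (hcut.trans (enorm_cut_le measurableSet_Ico f)).trans hff
    have h2 : ‖f' - g₁ - g₂‖ₑ ≤ ‖f'‖ₑ + ‖g₁‖ₑ + ‖g₂‖ₑ :=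
      enorm_sub_le.trans (add_le_add enorm_sub_le le_rfl)
    refine (add_le_add h1 (h2.trans (add_le_add (add_le_add hff' hg₁') hg₂'))).trans (le_of_eq ?_)
    rw [show 6 * M + 4 = 2 + 2 * (3 * M + 1) by ring, ENNReal.ofReal_add two_pos.le (by positivity),
      ENNReal.ofReal_mul two_pos.le, ENNReal.ofReal_ofNat]
    ring
  refine ⟨f₁, f - f₁ - f₂, f₂, g₁, g₂, by abel, d₁, d₂, ⟨_, d₀⟩, n₁, n₂, hcut,
    hPh (by positivity) (by linarith) b₁, hPh (by positivity) hP1 b₀,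
    hPh (by positivity) (by linarith) b₂, hs₁.norm_sq_add_norm_sq_le hs₃ hprod f, ?_, ?_, ?_, ?_⟩
  · exact hs₁.le_norm_sq measurableSet_Iic
      (fun x hx => by simp only [hχ, step_eq_zero hw (mem_Iic.1 hx), sub_zero]) f
  · exact hs₃.le_norm_sq measurableSet_Ici
      (fun x hx => step_eq_one hw (by linarith [mem_Ici.1 hx])) f
  · refine (hs₁.norm_deriv_sq_add_le hs₃ hprod f f').trans
      (add_le_add le_rfl (mul_le_mul_of_nonneg_right ?_ (by positivity)))
    rw [Real.coe_toNNReal P hP0]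
    have : 2 * (3 * M) * (1 + 3 * M) ≤ P := by nlinarith
    calc 2 * L * (1 + L) ≤ 2 * L * (1 + 3 * M) := by gcongr
      _ = 2 * (3 * M) * (1 + 3 * M) * ℓ⁻¹ := by rw [hL]; ring
      _ ≤ P * ℓ⁻¹ := by gcongr
  · intro r R hr
    have hR : 0 ≤ R := (abs_nonneg r).trans hr
    have z₁ : rmul (step (p + ℓ / 3) (ℓ / 3)) f₁ = 0 := by
      apply Lp.ext
      filter_upwards [hs₂.ae_eq f₁, hs₁.ae_eq f, Lp.coeFn_zero ℂ 2 (volume : Measure ℝ)]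
        with x e1 e2 e3
      rw [e1, e2, e3]
      rcases le_total (p + ℓ / 3) x with h | h
      · simp [χ0 x h]
      · simp [step_eq_zero hw h]
    have z₂ : rmul (fun x => 1 - step (p + ℓ / 3) (ℓ / 3) x) f₂ = 0 := by
      apply Lp.ext
      filter_upwards [hs₂.one_sub.ae_eq f₂, hs₃.ae_eq f, Lp.coeFn_zero ℂ 2 (volume : Measure ℝ)]
        with x e1 e2 e3
      rw [e1, e2, e3]
      rcases le_total x (p + 2 * ℓ / 3) with h | h
      · simp [η0 x h]
      · simp [step_eq_one hw (show p + ℓ / 3 + ℓ / 3 ≤ x by linarith)]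
    refine (hs₂.lintegral_T_mul_T_le d₁ d₂ z₁ z₂ hr).trans ?_
    calc ENNReal.ofReal (2 * L * R) * (‖g₁‖ₑ * ‖f₂‖ₑ + ‖f₁‖ₑ * ‖g₂‖ₑ)
        ≤ ENNReal.ofReal (2 * L * R) * (ENNReal.ofReal (3 * M + 1) * h1Norm f * h1Norm f
            + h1Norm f * (ENNReal.ofReal (3 * M + 1) * h1Norm f)) := by
          gcongr
          · exact n₂.trans hff
          · exact n₁.trans hff
      _ = ENNReal.ofReal (12 * M * (3 * M + 1)) * ENNReal.ofReal R * ENNReal.ofReal ℓ⁻¹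
            * h1Norm f ^ 2 := by
          rw [← ENNReal.ofReal_mul (by positivity), ← ENNReal.ofReal_mul (by positivity),
            show 12 * M * (3 * M + 1) * R * ℓ⁻¹ = 2 * L * R * (2 * (3 * M + 1)) by rw [hL]; ring,
            ENNReal.ofReal_mul (p := 2 * L * R) (by positivity),
            ENNReal.ofReal_mul (q := 3 * M + 1) two_pos.le, ENNReal.ofReal_ofNat]
          ring
      _ ≤ _ := by
          gcongr
          exact ENNReal.ofReal_le_ofReal hP2

/-- Used with `s = γ - 2` and `n = 8`; this is where `γ₂ < 10` enters and where the factor `1 +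
‖f‖_{H¹}⁸` originates. -/
theorem rpow_le_one_add_pow {s : ℝ} (h0 : 0 ≤ s) {n : ℕ} (hn : s ≤ n) (A : ℝ≥0∞) :
    A ^ s ≤ 1 + A ^ n := by
  rcases le_total A 1 with h | h
  · exact le_add_right (ENNReal.rpow_le_one h h0)
  · refine le_add_left ?_
    rw [← ENNReal.rpow_natCast]
    exact ENNReal.rpow_le_rpow_of_exponent_le h hn

/-- The energy inequality at positive average dispersion. -/
theorem exists_pos_dispersion {d γ₁ γ₂ : ℝ} (c R : ℝ) (K : ℝ≥0) (hd : 0 < d) (h2 : 2 < γ₁)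
    (h12 : γ₁ ≤ γ₂) (h10 : γ₂ < 10) :
    ∃ D : ℝ≥0, 0 < D ∧ ∀ (V ψ : ℝ → ℝ) (γ₀ : ℝ), AssumptionA1 V γ₁ γ₂ c → AssumptionA2 V γ₀ →
      AdmissibleDensity ψ 1 R K →
      ∀ (lam δ a b : ℝ) (f : L2), 0 < lam → MemH1 f → ‖f‖ ^ 2 = lam → 0 < δ → δ < lam / 2 →
        HasFatTails f δ a b →
        (factor γ₀ δ lam : EReal) * E d V ψ lam
            - ((D * h1Norm f ^ 2 * (1 + h1Norm f ^ 8) * G 1 (max (b - a - 1) 0) : ℝ≥0∞) : EReal)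
          ≤ H d V ψ f := by
  obtain ⟨S, hS⟩ := exists_enorm_T_le
  obtain ⟨P, hP⟩ := exists_h1_splitting
  set Q : ℝ≥0∞ := ENNReal.ofReal (3 * c) * ((3 * (S * P)) ^ (γ₁ - 2) + (3 * (S * P)) ^ (γ₂ - 2))
    * (3 + P * ENNReal.ofReal R) * K with hQ
  have e1 : 0 ≤ γ₁ - 2 := by linarith
  have e2 : 0 ≤ γ₂ - 2 := by linarith
  have hQtop : Q ≠ ⊤ := by finiteness
  have hd2 : 0 < d / 2 := by linarith
  -- `Q` accounts for the nonlinear defect and `(d/2) P` for the kinetic one; the `1` ensures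
  -- positivity, so that the error term is `∞` for short gaps.
  refine ⟨Q.toNNReal + (d / 2).toNNReal * P + 1, by positivity,
    fun V ψ γ₀ hV hV' hψ lam δ a b f hlam hfH hf hδ hδlam htail => ?_⟩
  obtain ⟨f', hf'⟩ := hfH
  set h := h1Norm f with hh
  have hhtop : h ≠ ⊤ := h1Norm_ne_top ⟨f', hf'⟩
  have hh0 : h ≠ 0 := by
    intro h0
    have := enorm_le_h1Norm f
    rw [← hh, h0, nonpos_iff_eq_zero, enorm_eq_zero] at this
    rw [this, norm_zero] at hf
    norm_num at hf
    linarith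
  rcases le_or_gt (b - a) 1 with hab | hab
  · rw [max_eq_right (by linarith), G_zero, ENNReal.mul_top (by simp [hh0])]
    simp
  rw [max_eq_left (by linarith)]
  -- Here `α = 1`, because the wave overlap and the kinetic error both decay like `ℓ⁻¹`.
  obtain ⟨a', ℓ, hℓ, haa', hb, hL, hmass⟩ := exists_window_G f one_pos one_pos hab
  simp only [one_mul, ENNReal.rpow_one] at hL hmass
  obtain ⟨f₁, f₀, f₂, g₁, g₂, hsum, d₁, d₂, hH₀, n₁, n₂, n₀, b₁, b₀, b₂, hnorm, hm₁, hm₂, hkin,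
    hbil⟩ := hP f f' a' ℓ hf' hℓ
  have hG0 := G_ne_top one_pos (s := b - a - 1) (by linarith)
  set g := G 1 (b - a - 1) with hg
  have hconv : ∀ {u : L2}, MemH1 u → NConverges V ψ u := fun hu => nConverges_of_memH1 hV hψ hu
  have hff : ‖f‖ₑ ≤ h := enorm_le_h1Norm f
  have hNle : ENNReal.ofReal (N V ψ f - N V ψ f₁ - N V ψ f₂) ≤ Q * h ^ 2 * (1 + h ^ 8) * g := by
    refine (N_split_le (hconv ⟨f', hf'⟩) (hconv ⟨_, d₁⟩) (hconv ⟨_, d₂⟩)).trans ?_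
    set Y : ℝ≥0∞ := S * (P * h) with hY
    set B : ℝ≥0∞ := ENNReal.ofReal (3 * c) * ((3 * Y) ^ (γ₁ - 2) + (3 * Y) ^ (γ₂ - 2))
      * ((3 + P * ENNReal.ofReal R) * (g * h ^ 2)) with hB
    have hBtop : B ≠ ⊤ := by finiteness
    have hsup : ∀ {u : L2}, MemH1 u → h1Norm u ≤ P * h → ∀ r, ∀ᵐ x, ‖T r u x‖ₑ ≤ Y := by
      intro u hu hle r
      filter_upwards [hS u hu r] with x hx
      exact hx.trans (mul_le_mul' le_rfl hle)
    have hin : ∀ r, |r| ≤ R → ∫⁻ x, ‖V ‖T r f x‖ - V ‖T r f₁ x‖ - V ‖T r f₂ x‖‖ₑ ≤ B := by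
      intro r hr
      rw [← hsum, T_add, T_add]
      refine (hV.lintegral_split_le (hsup ⟨_, d₁⟩ b₁ r) (hsup hH₀ b₀ r) (hsup ⟨_, d₂⟩ b₂ r)).trans ?_
      refine mul_le_mul' le_rfl ?_
      simp only [enorm_T]
      have n₀' : ‖f₀‖ₑ ≤ ‖f‖ₑ := n₀.trans (enorm_cut_le measurableSet_Ico f)
      calc ‖f₀‖ₑ * (‖f₁‖ₑ + ‖f₀‖ₑ + ‖f₂‖ₑ) + ∫⁻ x, ‖T r f₁ x‖ₑ * ‖T r f₂ x‖ₑ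
          ≤ (g * h) * (h + h + h) + P * ENNReal.ofReal R * g * h ^ 2 := by
            refine add_le_add (mul_le_mul' ?_ ?_) ((hbil r R hr).trans ?_)
            · exact (n₀.trans hmass).trans (mul_le_mul' le_rfl hff)
            · exact add_le_add (add_le_add (n₁.trans hff) (n₀'.trans hff)) (n₂.trans hff)
            · gcongr
        _ = _ := by ring
    calc ∫⁻ r, (∫⁻ x, ‖V ‖T r f x‖ - V ‖T r f₁ x‖ - V ‖T r f₂ x‖‖ₑ) * ‖ψ r‖ₑ
        ≤ ∫⁻ r, B * ‖ψ r‖ₑ := by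
          refine lintegral_mono_ae ?_
          filter_upwards [hψ.support] with r hr
          rcases le_or_gt |r| R with h' | h'
          · exact mul_le_mul' (hin r h') le_rfl
          · simp [hr h']
      _ = B * ∫⁻ r, ‖ψ r‖ₑ := lintegral_const_mul' _ _ hBtop
      _ ≤ B * K := mul_le_mul' le_rfl hψ.lintegral_le
      _ ≤ Q * h ^ 2 * (1 + h ^ 8) * g := by
          have hs : ∀ s : ℝ, 0 ≤ s → s ≤ (8 : ℕ) →
              (3 * Y) ^ s ≤ (3 * (S * P)) ^ s * (1 + h ^ 8) := by
            intro s hs0 hs8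
            rw [show 3 * Y = 3 * (S * P) * h by rw [hY]; ring, ENNReal.mul_rpow_of_nonneg _ _ hs0]
            exact mul_le_mul' le_rfl (rpow_le_one_add_pow hs0 hs8 h)
          have hs1 := hs _ e1 (by norm_num; linarith)
          have hs2 := hs _ e2 (by norm_num; linarith)
          calc B * K ≤ ENNReal.ofReal (3 * c) * ((3 * (S * P)) ^ (γ₁ - 2) * (1 + h ^ 8)
                + (3 * (S * P)) ^ (γ₂ - 2) * (1 + h ^ 8))
                * ((3 + P * ENNReal.ofReal R) * (g * h ^ 2)) * K := by
                rw [hB]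
                gcongr
            _ = _ := by rw [hQ]; ring
  have hhsq : h ^ 2 = ENNReal.ofReal (‖f‖ ^ 2 + ‖f'‖ ^ 2) := by
    rw [hh, h1Norm_sq, derivNorm_eq hf', ENNReal.ofReal_add (by positivity) (by positivity),
      ofReal_norm_sq, ofReal_norm_sq]
  -- The kinetic energy created by the smooth cut. It is quadratic in the `H¹` norm, and `1 ≤ 1 + h
  -- ^ 8` puts it in the same form as the nonlinear error.
  set κ : ℝ := d / 2 * (P * ℓ⁻¹ * (‖f‖ ^ 2 + ‖f'‖ ^ 2)) with hκ
  have hκle : ENNReal.ofReal κ ≤ (d / 2).toNNReal * P * h ^ 2 * (1 + h ^ 8) * g := by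
    have hℓ0 : 0 < ℓ⁻¹ := by positivity
    rw [hκ, ENNReal.ofReal_mul hd2.le, ENNReal.ofReal_mul (by positivity),
      ENNReal.ofReal_mul (by positivity), ← hhsq, ENNReal.ofReal_coe_nnreal]
    calc ENNReal.ofReal (d / 2) * (P * ENNReal.ofReal ℓ⁻¹ * h ^ 2)
        ≤ ENNReal.ofReal (d / 2) * (P * g * (h ^ 2 * (1 + h ^ 8))) := by
          gcongr
          exact le_mul_of_one_le_right' le_self_add
      _ = _ := by
          rw [ENNReal.ofReal]
          ring
  set err : ℝ≥0∞ := ((Q.toNNReal + (d / 2).toNNReal * P + 1 : ℝ≥0) : ℝ≥0∞) * h ^ 2 * (1 + h ^ 8) * g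
    with herr
  have herr' : err ≠ ⊤ := by finiteness
  have htot : κ + (N V ψ f - N V ψ f₁ - N V ψ f₂) ≤ err.toReal := by
    refine (ENNReal.ofReal_le_iff_le_toReal herr').1 (ENNReal.ofReal_add_le.trans
      ((add_le_add hκle hNle).trans ?_))
    rw [herr]
    push_cast
    rw [ENNReal.coe_toNNReal hQtop]
    calc _ = (Q + (d / 2).toNNReal * P) * h ^ 2 * (1 + h ^ 8) * g := by ring
      _ ≤ _ := mul_le_mul' (mul_le_mul' (mul_le_mul' le_self_add le_rfl) le_rfl) le_rfl
  have hψi : Integrable ψ := ⟨hψ.memLp.aestronglyMeasurable,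
    hψ.lintegral_le.trans_lt ENNReal.coe_lt_top⟩
  have hE := E_nonpos (d := d) hV h2 hψi hlam
  have hscale : ∀ u v : L2, IsWeakDeriv u v → 0 < ‖u‖ ^ 2 → ‖u‖ ^ 2 ≤ lam →
      ∀ e : ℝ, (e : EReal) ≤ E d V ψ lam →
      (‖u‖ ^ 2 / lam) ^ (γ₀ / 2) * e ≤ d / 2 * ‖v‖ ^ 2 - N V ψ u := by
    intro u v huv h0 hl e he
    refine le_energy_of_le_E hV' hψ.nonneg he ((norm_nonneg _).lt_of_ne (sq_pos_iff.1 h0).symm) hl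
      (by positivity) (fun t ht => ?_) (fun t ht => hconv ⟨_, huv.smul t⟩)
    rw [derivNorm_eq (huv.smul t), enorm_smul, ← ofReal_norm (t : ℂ), Complex.norm_real,
      Real.norm_of_nonneg (by linarith), mul_pow, ← ofReal_norm_sq v,
      ← ENNReal.ofReal_pow (by linarith), ← ENNReal.ofReal_mul (by positivity),
      ← ENNReal.ofReal_mul hd2.le]
    exact ENNReal.ofReal_le_ofReal (le_of_eq (by ring))
  have hδ₁ : δ ≤ ‖f₁‖ ^ 2 := by
    refine htail.1.trans (le_trans ?_ hm₁)
    exact setIntegral_mono_set (integrable_norm_sq f).integrableOn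
      (Filter.Eventually.of_forall fun x => by positivity) (Iic_subset_Iic.2 haa').eventuallyLE
  have hδ₂ : δ ≤ ‖f₂‖ ^ 2 := by
    refine htail.2.trans (le_trans ?_ hm₂)
    exact setIntegral_mono_set (integrable_norm_sq f).integrableOn
      (Filter.Eventually.of_forall fun x => by positivity) (Ici_subset_Ici.2 hb).eventuallyLE
  rw [hf] at hnorm
  rw [← EReal.coe_ennreal_toReal herr']
  refine factor_mul_E_sub_le (h := d / 2 * ‖f'‖ ^ 2 - N V ψ f) hV'.two_lt hE hδ hδlam hδ₁ hδ₂ hnorm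
    (hscale f₁ g₁ d₁ (by linarith) (by nlinarith [sq_nonneg ‖f₂‖]))
    (hscale f₂ g₂ d₂ (by linarith) (by nlinarith [sq_nonneg ‖f₁‖])) ?_ ?_
  · have := mul_le_mul_of_nonneg_left hkin hd2.le
    rw [mul_add, mul_add, ← hκ] at this
    linarith
  · rw [H, EReal.coe_sub, derivNorm_eq hf', ← ofReal_norm_sq, ← ENNReal.ofReal_mul hd2.le,
      EReal.coe_ennreal_ofReal, max_eq_left (by positivity)]

end FatTail

end

/-! ### The main theorem -/

theorem mainTheorem7 :
    -- positive average dispersion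
    (∀ (d γ₁ γ₂ c R : ℝ) (K : ℝ≥0), 0 < d → 2 < γ₁ → γ₁ ≤ γ₂ → γ₂ < 10 →
      ∃ C : ℝ≥0, 0 < C ∧
        ∀ (V ψ : ℝ → ℝ) (γ₀ : ℝ),
          FatTail.AssumptionA1 V γ₁ γ₂ c → FatTail.AssumptionA2 V γ₀ →
          FatTail.AdmissibleDensity ψ 1 R K →
          (∀ f : FatTail.L2, FatTail.MemH1 f → FatTail.NConverges V ψ f) ∧
          ∀ (lam δ a b : ℝ) (f : FatTail.L2), 0 < lam → FatTail.MemH1 f → ‖f‖ ^ 2 = lam →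
            0 < δ → δ < lam / 2 → FatTail.HasFatTails f δ a b →
            (FatTail.factor γ₀ δ lam : EReal) * FatTail.E d V ψ lam
                - ((C * FatTail.h1Norm f ^ 2 * (1 + FatTail.h1Norm f ^ 8)
                    * FatTail.G 1 (max (b - a - 1) 0) : ℝ≥0∞) : EReal)
              ≤ FatTail.H d V ψ f) ∧
    -- zero average dispersion
    (∀ (γ₁ γ₂ τ c R : ℝ) (K : ℝ≥0), 2 < γ₁ → γ₁ ≤ γ₂ → γ₂ < 6 → 1 < τ →
      ∃ C : ℝ≥0, 0 < C ∧
        ∀ (V ψ : ℝ → ℝ) (γ₀ : ℝ),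
          FatTail.AssumptionA1 V γ₁ γ₂ c → FatTail.AssumptionA2 V γ₀ →
          FatTail.AdmissibleDensity ψ (ENNReal.ofReal (FatTail.betaExp γ₂ τ)) R K →
          (∀ f : FatTail.L2, FatTail.NConverges V ψ f) ∧
          ∀ (lam δ a b : ℝ) (f : FatTail.L2), 0 < lam → ‖f‖ ^ 2 = lam →
            0 < δ → δ < lam / 2 →
            (FatTail.HasFatTails f δ a b ∨ FatTail.HasFatTails (FatTail.hat f) δ a b) →
            (FatTail.factor γ₀ δ lam : EReal) * FatTail.E 0 V ψ lam
                - ((C * ENNReal.ofReal (lam * (1 + lam ^ 2))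
                    * FatTail.G (min (FatTail.alphaExp γ₁ τ) (FatTail.alphaExp γ₂ τ))
                        (max (b - a - 1) 0) : ℝ≥0∞) : EReal)
              ≤ FatTail.H 0 V ψ f) ∧
    -- the error function decreases to zero
    (∀ α : ℝ, 0 < α → α ≤ 1 →
      AntitoneOn (FatTail.G α) (Ici 0) ∧
        Filter.Tendsto (FatTail.G α) Filter.atTop (nhds 0)) := by
  refine ⟨fun d γ₁ γ₂ c R K hd h2 h12 h10 => ?_, fun γ₁ γ₂ τ c R K h2 h12 h6 hτ => ?_,
    fun α hα _ => ⟨FatTail.antitoneOn_G hα, FatTail.tendsto_G hα⟩⟩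
  · obtain ⟨D, hD, h⟩ := FatTail.exists_pos_dispersion c R K hd h2 h12 h10
    exact ⟨D, hD, fun V ψ γ₀ hV hV' hψ => ⟨fun f hf => FatTail.nConverges_of_memH1 hV hψ hf,
      fun lam δ a b f hlam hfH hf hδ hδlam htail =>
        h V ψ γ₀ hV hV' hψ lam δ a b f hlam hfH hf hδ hδlam htail⟩⟩
  · obtain ⟨D, hD, h⟩ := FatTail.exists_zero_dispersion c R K h2 h12 h6 hτ
    exact ⟨D, hD, fun V ψ γ₀ hV hV' hψ => ⟨FatTail.nConverges_of_betaExp hV hψ h2 h6 hτ,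
      fun lam δ a b f hlam hf hδ hδlam htail =>
        h V ψ γ₀ hV hV' hψ lam δ a b f hlam hf hδ hδlam htail⟩⟩
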